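/- Let $m,n\in\mathbb N$, $p>1$, let $\Omega\subset\mathbb R^n$ be open, and let $|\cdot|$ denote the operator norm on $\mathbb R^{m\times n}$. Let $F\colon\mathbb R^{m\times n}\to\mathbb R$ be * *$p$-homogeneous*: $F(tA)=t^pF(A)$ for all $t>0$ and $A\in\mathbb R^{m\times n}$; and * *quasiconcave*: $F$ is Borel measurable and locally bounded, and for a cube $Q\subset\mathbb R^n$ with sides parallel to the coordinate axes $$\frac1{|Q|}\int_Q F(D\varphi)\,dx\le F\Big(\frac1{|Q|}\int_Q D\varphi\,dx\Big)\quad\text{for all }\varphi\in C^\infty(\mathbb R^n,\mathbb R^m)\text{ with }Q\text{-periodic }D\varphi.$$ Let $u_j\in L^1_{\mathrm{loc}}(\Omega,\mathbb R^m)$, $j\in\mathbb N$, have weak gradients $Du_j$ that are bounded in $L^p_{\mathrm{loc}}(\Omega,\mathbb R^{m\times n})$, i.e. $\sup_j\|Du_j\|_{L^p(K)}<\infty$ for every compact $K\subset\Omega$, and suppose that $F(Du_j)\ge 0$ a.e. in $\Omega$ for every $j$. Then $(F(Du_j))_j$ is locally uniformly integrable in $\Omega$: for every compact $K\subset\Omega$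 one has $\sup_j\int_K|F(Du_j)|\,dx<\infty$, and for every $\varepsilon>0$ there is $\delta>0$ such that $\int_E|F(Du_j)|\,dx\le\varepsilon$ for all $j$ and all measurable $E\subset K$ with $|E|\le\delta$. If in addition there is a constant $c>0$ such that $F(Du_j)\ge c|Du_j|^p$ a.e. in $\Omega$ for every $j$, then $(|Du_j|^p)_j$ is locally uniformly integrable in $\Omega$ as well. -/

import Mathlib

open MeasureTheory Set
open scoped ContDiff NNReal ENNReal

/-- The space `ℝ^{m × n}` of real matrices, as linear maps between Euclidean spaces; its norm is
the operator norm. -/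
abbrev Mat (m n : ℕ) : Type := EuclideanSpace ℝ (Fin n) →L[ℝ] EuclideanSpace ℝ (Fin m)

/-- The closed cube in `ℝⁿ` with lower corner `a` and side length `r`. -/
def cube {n : ℕ} (a : EuclideanSpace ℝ (Fin n)) (r : ℝ) : Set (EuclideanSpace ℝ (Fin n)) :=
  {x | ∀ i, a i ≤ x i ∧ x i ≤ a i + r}

/-- Quasiconcavity of an integrand `F : ℝ^{m × n} → ℝ`: `F` is Borel measurable and bounded on
bounded sets (so that the averages below exist), and for a cube `Q` (of side `r > 0`),
`⨍_Q F(Dφ) ≤ F(⨍_Q Dφ)` for all smooth `φ : ℝⁿ → ℝᵐ` whose derivative `Dφ` is `Q`-periodic. -/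
structure IsQuasiconcave {m n : ℕ} (F : Mat m n → ℝ) : Prop where
  measurable : Measurable F
  locallyBounded : ∀ R : ℝ, ∃ C : ℝ, ∀ A : Mat m n, ‖A‖ ≤ R → |F A| ≤ C
  average_le : ∃ (a : EuclideanSpace ℝ (Fin n)) (r : ℝ), 0 < r ∧
    ∀ φ : EuclideanSpace ℝ (Fin n) → EuclideanSpace ℝ (Fin m), ContDiff ℝ ∞ φ →
      (∀ x i, fderiv ℝ φ (x + EuclideanSpace.single i r) = fderiv ℝ φ x) →
      (⨍ x in cube a r, F (fderiv ℝ φ x)) ≤ F (⨍ x in cube a r, fderiv ℝ φ x)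

/-- (Positive) `p`-homogeneity: `F(tA) = t^p F(A)` for `t > 0`. -/
def IsHomogeneous {m n : ℕ} (p : ℝ) (F : Mat m n → ℝ) : Prop :=
  ∀ (t : ℝ) (A : Mat m n), 0 < t → F (t • A) = t ^ p * F A

/-- `G` is the weak (distributional) gradient `Du` of `u` in the open set `Ω`: both are locally
integrable in `Ω`, and `∫ (∂_v φ) u = - ∫ φ (G v)` for every direction `v` and every test
function `φ ∈ C_c^∞(Ω)`. -/
structure IsWeakGradient {m n : ℕ} (Ω : Set (EuclideanSpace ℝ (Fin n)))
    (u : EuclideanSpace ℝ (Fin n) → EuclideanSpace ℝ (Fin m))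
    (G : EuclideanSpace ℝ (Fin n) → Mat m n) : Prop where
  locallyIntegrable : LocallyIntegrableOn u Ω
  locallyIntegrable_grad : LocallyIntegrableOn G Ω
  integral_eq : ∀ φ : EuclideanSpace ℝ (Fin n) → ℝ, ContDiff ℝ ∞ φ → HasCompactSupport φ →
    tsupport φ ⊆ Ω → ∀ v : EuclideanSpace ℝ (Fin n),
      ∫ x in Ω, (fderiv ℝ φ x v) • u x = - ∫ x in Ω, φ x • G x v

/-- The sequence `G` is bounded in `L^p_loc(Ω)`: on each compact `K ⊆ Ω` the norms
`‖G_j‖_{L^p(K)}` are bounded uniformly in `j`. -/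
def IsBoundedInLpLoc {m n : ℕ} (p : ℝ) (Ω : Set (EuclideanSpace ℝ (Fin n)))
    (G : ℕ → EuclideanSpace ℝ (Fin n) → Mat m n) : Prop :=
  ∀ K : Set (EuclideanSpace ℝ (Fin n)), IsCompact K → K ⊆ Ω →
    ∃ C : ℝ≥0, ∀ j, eLpNorm (G j) (ENNReal.ofReal p) (volume.restrict K) ≤ C

/-- The sequence `f` is locally uniformly integrable in `Ω`: on each compact `K ⊆ Ω` it is
bounded in `L¹(K)` and equi-integrable. -/
def IsLocallyUniformlyIntegrable {n : ℕ} (Ω : Set (EuclideanSpace ℝ (Fin n)))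
    (f : ℕ → EuclideanSpace ℝ (Fin n) → ℝ) : Prop :=
  ∀ K : Set (EuclideanSpace ℝ (Fin n)), IsCompact K → K ⊆ Ω →
    UniformIntegrable f 1 (volume.restrict K)

/-!
The proof shows that the integrals of `f_j = F(Du_j) ≥ 0` over the superlevel sets `{f_j > Λ}` in a
compact set are small for large `Λ`, uniformly in `j`; both claims follow from this
(`uniformIntegrable_of_enorm_le`), since `|Du_j|^p ≤ c⁻¹ f_j` in the coercive case.

*Local estimate.* Quasiconcavity, tested with plane waves whose profile is a smoothed step function,
gives concavity of `F` along the matrices `b ⊗ eᵢ`; with the growth `|F(A)| ≤ M |A|^p` coming from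
homogeneity, this makes `F` locally Lipschitz with constant of order `|A|^{p-1}`
(`exists_lipschitz_bound`). Quasiconcavity also gives `∫ F(Dφ) ≤ 0` for test functions `φ`, by
periodizing `φ` (`IsQuasiconcave.integral_fderiv_nonpos`). Taking `φ = η (u - c)` with a cutoff `η`
between the balls `B_ρ` and `B_{2ρ}`, homogeneity turns `F(η Du)` into `η^p F(Du)`, and the remaining
term `|u - c|^p |Dη|^p` is estimated by a Poincaré inequality whose constant in front of `‖Du‖_p^p`
is as small as desired, at the price of a power of `‖Du‖_1` (`exists_setLIntegral_sub_rpow_le`). As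
`F(Du) ≥ 0`, the outcome is, with `⨍` denoting averages (`exists_lintegral_closedBall_le`)

  `∫_{B_ρ} F(Du) ≤ ε ∫_{B_{2ρ}} |Du|^p + C_ε |B_{2ρ}| (⨍_{B_{2ρ}} |Du|)^p`.

*Covering.* Around almost every point with `f > s^p` there is a critical ball on which the mean of
`f` is still at least `s^p` while it is at most `s^p` on all balls of at least twice the radius.
Select a Vitali family of these balls. On each of them, by the local estimate, either the `ε`-term
dominates, or the mean of `|Du|` over the double ball is at least a multiple of `s`, and then `|Du|`
may be replaced by its restriction to `{|Du| > c s}`. Summation gives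
(`exists_lintegral_superlevel_le`)

  `∫_{f > s^p} f ≤ C ε ∫ |Du|^p + C_ε s^{p-1} ∫_{|Du| > c s} |Du|`.

*Averaging.* The last term need not be small for a single height `s`, but its sum over the dyadic
heights `s 2^k`, `k < N`, is at most a multiple of `∫ |Du|^p` independent of `N`
(`exists_sum_dyadic_truncation_le`). The left-hand side decreases with the height, so that averaging
over `k` leaves `C ε + C_ε / N`, with constants depending on `Du` only through the bound for its
`L^p` norm (`exists_height_lintegral_superlevel_le`).
-/

/-! ### Smooth periodic step functions -/

/-- A smooth `r`-periodic function with values in `[0, 1]` whose mean is *exactly* `θ` and which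
takes only the values `0` and `1` outside a set of measure at most `ε` in the period
`[a, a + r)`. -/
lemma exists_smooth_periodic_step (a : ℝ) {r θ ε : ℝ} (hr : 0 < r) (h0 : 0 < θ) (h1 : θ < 1)
    (hε : 0 < ε) :
    ∃ ψ : ℝ → ℝ, ContDiff ℝ ∞ ψ ∧ (∀ t, ψ (t + r) = ψ t) ∧ (∀ t, ψ t ∈ Icc (0 : ℝ) 1) ∧
      (∫ t in a..(a + r), ψ t) = θ * r ∧
      ∃ s : Set ℝ, MeasurableSet s ∧ volume s ≤ ENNReal.ofReal ε ∧
        ∀ t ∈ Ico a (a + r), t ∉ s → ψ t = 0 ∨ ψ t = 1 := by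
  obtain ⟨e, he0, heε, her⟩ : ∃ e : ℝ, 0 < e ∧ 2 * e ≤ ε ∧ 2 * e ≤ (1 - θ) * r := by
    refine ⟨min (ε / 2) ((1 - θ) * r / 2), by have := sub_pos.2 h1; positivity, ?_, ?_⟩
    · linarith [min_le_left (ε / 2) ((1 - θ) * r / 2)]
    · linarith [min_le_right (ε / 2) ((1 - θ) * r / 2)]
  have hθr : 0 < θ * r := by positivity
  set S := Real.smoothTransition
  let ψ₀ : ℝ → ℝ := fun τ => S (τ / e) - S ((τ - θ * r) / e)
  have hψ₀ : ContDiff ℝ ∞ ψ₀ := by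
    have hS : ContDiff ℝ ∞ S := Real.smoothTransition.contDiff
    exact (hS.comp (by fun_prop)).sub (hS.comp (by fun_prop))
  have hSzero : ∀ τ ≤ 0, S (τ / e) = 0 := fun τ hτ =>
    Real.smoothTransition.zero_of_nonpos (div_nonpos_of_nonpos_of_nonneg hτ he0.le)
  have hSone : ∀ τ, e ≤ τ → S (τ / e) = 1 := fun τ hτ =>
    Real.smoothTransition.one_of_one_le ((one_le_div he0).2 hτ)
  have hneg : ∀ τ ≤ 0, ψ₀ τ = 0 := fun τ hτ => by
    simp only [ψ₀]; rw [hSzero τ hτ, hSzero _ (by linarith)]; ring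
  have hlarge : ∀ τ, θ * r + e ≤ τ → ψ₀ τ = 0 := fun τ hτ => by
    simp only [ψ₀]; rw [hSone τ (by linarith), hSone _ (by linarith)]; ring
  have hψ₀mem : ∀ τ, ψ₀ τ ∈ Icc (0 : ℝ) 1 := fun τ => by
    have hmono : S ((τ - θ * r) / e) ≤ S (τ / e) := Real.smoothTransition.monotone (by gcongr; linarith)
    have h3 : S (τ / e) ≤ 1 := Real.smoothTransition.le_one _
    have h4 : 0 ≤ S ((τ - θ * r) / e) := Real.smoothTransition.nonneg _
    constructor <;> simp only [ψ₀] <;> linarith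
  -- `ψ₀` rises and falls by the same profile shifted by `θ r`, which makes its integral exactly `θ r`.
  let ψ : ℝ → ℝ := fun t => ψ₀ (r * Int.fract ((t - a) / r))
  have hloc : ∀ (k : ℤ) (t : ℝ), t - a - r * k ∈ Ioo (-e) r → ψ t = ψ₀ (t - a - r * k) := by
    intro k t ht
    rcases le_or_gt 0 (t - a - r * k) with h | h
    · have hfl : ⌊(t - a) / r⌋ = k := by
        rw [Int.floor_eq_iff, le_div_iff₀ hr, div_lt_iff₀ hr]
        constructor <;> nlinarith [ht.2]
      simp only [ψ, Int.fract, hfl]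
      congr 1; field_simp
    · have hfl : ⌊(t - a) / r⌋ = k - 1 := by
        rw [Int.floor_eq_iff, le_div_iff₀ hr, div_lt_iff₀ hr]
        push_cast
        constructor <;> nlinarith [ht.1]
      rw [hneg _ h.le]
      simp only [ψ, Int.fract, hfl]
      apply hlarge
      have : r * ((t - a) / r - ((k - 1 : ℤ) : ℝ)) = t - a - r * k + r := by
        push_cast; field_simp; ring
      rw [this]; linarith [ht.1]
  have hfund : ∀ t ∈ Ico a (a + r), ψ t = ψ₀ (t - a) := fun t ht => by
    have := hloc 0 t (by simp; constructor <;> linarith [ht.1, ht.2])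
    simpa using this
  refine ⟨ψ, ?_, ?_, fun t => hψ₀mem _, ?_,
    Icc a (a + e) ∪ Icc (a + θ * r) (a + θ * r + e), by measurability, ?_, ?_⟩
  · rw [contDiff_iff_contDiffAt]
    intro t
    set k := ⌊(t - a) / r⌋
    have h5 := Int.floor_le ((t - a) / r)
    have h6 := Int.lt_floor_add_one ((t - a) / r)
    rw [le_div_iff₀ hr] at h5
    rw [div_lt_iff₀ hr] at h6
    have hev : ψ =ᶠ[nhds t] fun t => ψ₀ (t - a - r * k) := by
      have : ∀ᶠ t' in nhds t, t' - a - r * k ∈ Ioo (-e) r := by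
        have hc : ContinuousAt (fun t' : ℝ => t' - a - r * k) t := by fun_prop
        exact hc (Ioo_mem_nhds (by linarith) (by linarith))
      filter_upwards [this] with t' ht' using hloc k t' ht'
    refine ContDiffAt.congr_of_eventuallyEq ?_ hev
    exact (hψ₀.comp (by fun_prop)).contDiffAt
  · intro t
    simp only [ψ]
    rw [show (t + r - a) / r = (t - a) / r + 1 by field_simp; ring, Int.fract_add_one]
  · have e1 : (∫ t in a..(a + r), ψ t) = ∫ t in a..(a + r), ψ₀ (t - a) := by
      rw [intervalIntegral.integral_of_le (by linarith), intervalIntegral.integral_of_le (by linarith),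
        integral_Ioc_eq_integral_Ioo, integral_Ioc_eq_integral_Ioo]
      exact setIntegral_congr_fun measurableSet_Ioo fun t ht => hfund t ⟨ht.1.le, ht.2⟩
    have hint : ∀ x y, IntervalIntegrable (fun τ => S (τ / e)) volume x y := fun x y =>
      (Real.smoothTransition.continuous.comp (by fun_prop)).intervalIntegrable _ _
    have hint' : ∀ x y, IntervalIntegrable (fun τ => S ((τ - θ * r) / e)) volume x y := fun x y =>
      (Real.smoothTransition.continuous.comp (by fun_prop)).intervalIntegrable _ _
    rw [e1, intervalIntegral.integral_comp_sub_right (fun x => ψ₀ x) a]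
    simp only [sub_self, add_sub_cancel_left, ψ₀]
    rw [intervalIntegral.integral_sub (hint _ _) (hint' _ _),
      intervalIntegral.integral_comp_sub_right (fun x => S (x / e)) (θ * r),
      ← intervalIntegral.integral_add_adjacent_intervals (hint (0 - θ * r) 0) (hint 0 (r - θ * r)),
      ← intervalIntegral.integral_add_adjacent_intervals (hint 0 (r - θ * r)) (hint (r - θ * r) r)]
    have e2 : (∫ x in (0 - θ * r)..0, S (x / e)) = 0 := by
      rw [intervalIntegral.integral_congr (g := fun _ => (0 : ℝ))]
      · simp
      · intro x hx
        rw [uIcc_of_le (by linarith)] at hx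
        exact hSzero x hx.2
    have e3 : (∫ x in (r - θ * r)..r, S (x / e)) = θ * r := by
      rw [intervalIntegral.integral_congr (g := fun _ => (1 : ℝ))]
      · simp
      · intro x hx
        rw [uIcc_of_le (by linarith)] at hx
        exact hSone x (by linarith [hx.1])
    rw [e2, e3]; ring
  · refine (measure_union_le _ _).trans ?_
    rw [Real.volume_Icc, Real.volume_Icc, ← ENNReal.ofReal_add (by linarith) (by linarith)]
    exact ENNReal.ofReal_le_ofReal (by linarith)
  · intro t ht hts
    rw [hfund t ht]
    simp only [mem_union, mem_Icc, not_or, not_and_or, not_le] at hts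
    obtain ⟨h5, h6⟩ := hts
    have h7 : a + e < t := by rcases h5 with h | h <;> linarith [ht.1]
    rcases h6 with h | h
    · right
      simp only [ψ₀]
      rw [hSone _ (by linarith), hSzero _ (by linarith)]; ring
    · left
      exact hlarge _ (by linarith)

/-! ### Concavity in rank-one directions -/

lemma volume_cube_inter {n : ℕ} (a : EuclideanSpace ℝ (Fin n)) (r : ℝ) (i : Fin n) (s : Set ℝ) :
    volume ({x : EuclideanSpace ℝ (Fin n) | x i ∈ s} ∩ cube a r) =
      ENNReal.ofReal r ^ (n - 1) * volume (s ∩ Icc (a i) (a i + r)) := by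
  classical
  have h1 : {x : EuclideanSpace ℝ (Fin n) | x i ∈ s} ∩ cube a r =
      (MeasurableEquiv.toLp 2 (Fin n → ℝ)).symm ⁻¹'
        (univ.pi fun j => if j = i then s ∩ Icc (a i) (a i + r) else Icc (a j) (a j + r)) := by
    ext x
    simp only [cube, mem_inter_iff, mem_ofPred_eq, mem_preimage, mem_pi, mem_univ, forall_true_left]
    constructor
    · rintro ⟨hx, hc⟩ j
      split_ifs with h
      · subst h; exact ⟨hx, hc j⟩
      · exact hc j
    · intro h
      have hi := h i
      simp only [if_true] at hi
      refine ⟨hi.1, fun j => ?_⟩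
      by_cases hj : j = i
      · subst hj; exact hi.2
      · have := h j
        rw [if_neg hj] at this
        exact this
  rw [h1, (EuclideanSpace.volume_preserving_symm_measurableEquiv_toLp (Fin n)).measure_preimage_equiv,
    volume_pi_pi, ← Finset.mul_prod_erase _ _ (Finset.mem_univ i), if_pos rfl, mul_comm]
  congr 1
  rw [Finset.prod_congr rfl (g := fun _ => ENNReal.ofReal r)]
  · simp
  · intro j hj
    rw [if_neg (Finset.ne_of_mem_erase hj), Real.volume_Icc, add_sub_cancel_left]

lemma volume_cube {n : ℕ} (a : EuclideanSpace ℝ (Fin n)) (r : ℝ) :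
    volume (cube a r) = ENNReal.ofReal r ^ n := by
  have h1 : cube a r =
      (MeasurableEquiv.toLp 2 (Fin n → ℝ)).symm ⁻¹' (univ.pi fun j => Icc (a j) (a j + r)) := by
    ext x
    simp [cube, Pi.le_def, forall_and]
  rw [h1, (EuclideanSpace.volume_preserving_symm_measurableEquiv_toLp (Fin n)).measure_preimage_equiv,
    volume_pi_pi]
  simp

lemma measurableSet_cube {n : ℕ} (a : EuclideanSpace ℝ (Fin n)) (r : ℝ) :
    MeasurableSet (cube a r) := by
  unfold cube
  apply IsClosed.measurableSet
  simp only [ofPred_forall]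
  refine isClosed_iInter fun i => ?_
  have hc : Continuous fun x : EuclideanSpace ℝ (Fin n) => x i := by fun_prop
  exact (isClosed_le continuous_const hc).inter (isClosed_le hc continuous_const)

lemma map_coord_restrict_cube {n : ℕ} (a : EuclideanSpace ℝ (Fin n)) (r : ℝ) (i : Fin n) :
    (volume.restrict (cube a r)).map (fun x => x i) =
      ENNReal.ofReal r ^ (n - 1) • volume.restrict (Icc (a i) (a i + r)) := by
  ext s hs
  have hm : Measurable fun x : EuclideanSpace ℝ (Fin n) => x i := by fun_prop
  rw [Measure.map_apply hm hs, Measure.restrict_apply (hm hs), Measure.smul_apply,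
    Measure.restrict_apply hs]
  exact volume_cube_inter a r i s

/-- The average over a cube of a function of one coordinate is a one-dimensional average. -/
lemma average_cube_coord {n : ℕ} {V : Type*} [NormedAddCommGroup V] [NormedSpace ℝ V]
    (a : EuclideanSpace ℝ (Fin n)) {r : ℝ} (hr : 0 < r) (i : Fin n) (g : ℝ → V)
    (hg : StronglyMeasurable g) :
    (⨍ x in cube a r, g (x i)) = r⁻¹ • ∫ t in (a i)..(a i + r), g t := by
  have hm : Measurable fun x : EuclideanSpace ℝ (Fin n) => x i := by fun_prop
  have h := integral_map (μ := volume.restrict (cube a r)) hm.aemeasurable (f := g)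
    hg.aestronglyMeasurable
  have hn : 0 < n := i.pos
  rw [setAverage_eq, ← h, map_coord_restrict_cube, integral_smul_measure,
    intervalIntegral.integral_of_le (by linarith), integral_Icc_eq_integral_Ioc, measureReal_def,
    volume_cube, smul_smul, ENNReal.toReal_pow, ENNReal.toReal_pow, ENNReal.toReal_ofReal hr.le]
  congr 1
  obtain ⟨k, rfl⟩ : ∃ k, n = k + 1 := ⟨n - 1, by omega⟩
  simp only [Nat.add_sub_cancel, pow_succ]
  field_simp

/-- The rank-one matrix `b ⊗ eᵢ`, that is, `x ↦ xᵢ b`. -/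
noncomputable def columnMat {m n : ℕ} (i : Fin n) (b : EuclideanSpace ℝ (Fin m)) : Mat m n :=
  (EuclideanSpace.proj i : EuclideanSpace ℝ (Fin n) →L[ℝ] ℝ).smulRight b

lemma exists_contDiff_antideriv {g : ℝ → ℝ} (hg : ContDiff ℝ ∞ g) :
    ∃ h : ℝ → ℝ, ContDiff ℝ ∞ h ∧ ∀ t, HasDerivAt h (g t) t := by
  refine ⟨fun t => ∫ s in (0 : ℝ)..t, g s, ?_, fun t => ?_⟩
  · have hd : ∀ t, HasDerivAt (fun t => ∫ s in (0 : ℝ)..t, g s) (g t) t := fun t =>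
      hg.continuous.integral_hasStrictDerivAt 0 t |>.hasDerivAt
    rw [contDiff_infty_iff_deriv]
    refine ⟨fun t => (hd t).differentiableAt, ?_⟩
    rw [funext fun t => (hd t).deriv]
    exact hg
  · exact hg.continuous.integral_hasStrictDerivAt 0 t |>.hasDerivAt

/-- Quasiconcavity tested with plane waves `φ(x) = A x + h(xᵢ) b`. -/
lemma IsQuasiconcave.exists_average_columns_le {m n : ℕ} {F : Mat m n → ℝ} (hF : IsQuasiconcave F)
    (i : Fin n) : ∃ (a r : ℝ), 0 < r ∧ ∀ (A : Mat m n) (b : EuclideanSpace ℝ (Fin m)) (g : ℝ → ℝ),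
      ContDiff ℝ ∞ g → (∀ t, g (t + r) = g t) →
      r⁻¹ * (∫ t in a..(a + r), F (A + g t • columnMat i b)) ≤
        F (A + (r⁻¹ * ∫ t in a..(a + r), g t) • columnMat i b) := by
  obtain ⟨a, r, hr, H⟩ := hF.average_le
  refine ⟨a i, r, hr, fun A b g hg hper => ?_⟩
  obtain ⟨h, hh, hder⟩ := exists_contDiff_antideriv hg
  let φ : EuclideanSpace ℝ (Fin n) → EuclideanSpace ℝ (Fin m) := fun x => A x + h (x i) • b
  have hD : ∀ x, fderiv ℝ φ x = A + g (x i) • columnMat i b := fun x => by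
    have h1 : HasFDerivAt (fun x : EuclideanSpace ℝ (Fin n) => x i)
      (EuclideanSpace.proj i : EuclideanSpace ℝ (Fin n) →L[ℝ] ℝ) x :=
      (EuclideanSpace.proj i : EuclideanSpace ℝ (Fin n) →L[ℝ] ℝ).hasFDerivAt
    have h2 := ((hder (x i)).comp_hasFDerivAt x h1).smul_const b
    have h3 := (A.hasFDerivAt (x := x)).add h2
    rw [show φ = (⇑A + fun y => (h ∘ fun x => x.ofLp i) y • b) from rfl, h3.fderiv]
    ext y j
    simp [columnMat, mul_assoc]
  have hφ : ContDiff ℝ ∞ φ := by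
    have : ContDiff ℝ ∞ fun x : EuclideanSpace ℝ (Fin n) => x i :=
      (EuclideanSpace.proj i : EuclideanSpace ℝ (Fin n) →L[ℝ] ℝ).contDiff
    exact A.contDiff.add ((hh.comp this).smul contDiff_const)
  have key := H φ hφ (fun x j => by
    rw [hD, hD]
    by_cases hij : i = j
    · subst hij; simp [hper]
    · simp [hij])
  simp only [hD] at key
  have hcont : Continuous fun t : ℝ => A + g t • columnMat i b := by
    have := hg.continuous; fun_prop
  rw [average_cube_coord a hr i (fun t => F (A + g t • columnMat i b))
    (hF.measurable.comp hcont.measurable).stronglyMeasurable,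
    average_cube_coord a hr i (fun t => A + g t • columnMat i b) hcont.stronglyMeasurable] at key
  have e1 : (r⁻¹ • ∫ t in (a i)..(a i + r), (A + g t • columnMat i b)) =
      A + (r⁻¹ * ∫ t in (a i)..(a i + r), g t) • columnMat i b := by
    have hi : IntervalIntegrable (fun t => g t • columnMat i b) volume (a i) (a i + r) :=
      (hg.continuous.smul continuous_const).intervalIntegrable _ _
    rw [intervalIntegral.integral_add intervalIntegrable_const hi,
      intervalIntegral.integral_smul_const, intervalIntegral.integral_const, smul_add, smul_smul,
      smul_smul]
    congr 1
    rw [add_sub_cancel_left, inv_mul_cancel₀ hr.ne', one_smul]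
  rw [e1] at key
  simpa using key

/-- Quasiconcavity implies concavity in the directions `b ⊗ eᵢ`. -/
lemma IsQuasiconcave.concaveOn_column {m n : ℕ} {F : Mat m n → ℝ} (hF : IsQuasiconcave F)
    (A : Mat m n) (i : Fin n) (b : EuclideanSpace ℝ (Fin m)) :
    ConcaveOn ℝ univ fun s : ℝ => F (A + s • columnMat i b) := by
  obtain ⟨a, r, hr, H⟩ := hF.exists_average_columns_le i
  set f : ℝ → ℝ := fun s => F (A + s • columnMat i b) with hf
  have hfm : Measurable f := hF.measurable.comp (by fun_prop)
  refine concaveOn_iff_forall_pos.2 ⟨convex_univ, ?_⟩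
  intro s₁ _ s₂ _ θ θ' hθ hθ' hsum
  obtain rfl : θ' = 1 - θ := by linarith
  obtain ⟨C, hC⟩ := hF.locallyBounded (‖A‖ + (|s₁| + |s₂|) * ‖columnMat i b‖)
  have hfC : ∀ w ∈ Icc (0 : ℝ) 1, |f (w * s₁ + (1 - w) * s₂)| ≤ C := fun w hw => by
    refine hC _ ((norm_add_le _ _).trans ?_)
    rw [norm_smul]
    gcongr
    rw [Real.norm_eq_abs]
    refine (abs_add_le _ _).trans ?_
    rw [abs_mul, abs_mul, abs_of_nonneg hw.1, abs_of_nonneg (sub_nonneg.2 hw.2)]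
    have := abs_nonneg s₁
    have := abs_nonneg s₂
    nlinarith [hw.1, hw.2]
  have hC0 : 0 ≤ C := (abs_nonneg _).trans (hfC 0 (by simp))
  simp only [smul_eq_mul]
  refine le_of_forall_pos_le_add fun η hη => ?_
  obtain ⟨ψ, hψ, hper, hmem, hint, S, hS, hSv, hS01⟩ :=
    exists_smooth_periodic_step a hr hθ (by linarith) (ε := η * r / (2 * C + 1)) (by positivity)
  have key := H A b (fun t => ψ t * s₁ + (1 - ψ t) * s₂) (by fun_prop) (fun t => by rw [hper])
  have hii : IntervalIntegrable ψ volume a (a + r) := hψ.continuous.intervalIntegrable _ _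
  have hmean : r⁻¹ * (∫ t in a..(a + r), (ψ t * s₁ + (1 - ψ t) * s₂)) = θ * s₁ + (1 - θ) * s₂ := by
    rw [intervalIntegral.integral_add (hii.mul_const _)
      ((intervalIntegrable_const.sub hii).mul_const _), intervalIntegral.integral_mul_const,
      intervalIntegral.integral_mul_const, intervalIntegral.integral_sub (by simp) hii, hint]
    simp
    field_simp
  rw [hmean] at key
  -- Off the transition set `S` the profile `ψ t * s₁ + (1 - ψ t) * s₂` is `s₁` or `s₂`.
  have hpt : ∀ t ∈ Ico a (a + r), ψ t * f s₁ + (1 - ψ t) * f s₂ - S.indicator (fun _ => 2 * C) t ≤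
      f (ψ t * s₁ + (1 - ψ t) * s₂) := by
    intro t ht
    by_cases hts : t ∈ S
    · rw [indicator_of_mem hts]
      have h1 := abs_le.1 (hfC (ψ t) (hmem t))
      have h2 := abs_le.1 (hfC 1 (by simp))
      have h3 := abs_le.1 (hfC 0 (by simp))
      simp only [one_mul, sub_self, zero_mul, add_zero, sub_zero, zero_add] at h2 h3
      nlinarith [(hmem t).1, (hmem t).2]
    · rw [indicator_of_notMem hts]
      rcases hS01 t ht hts with h | h <;> simp [h]
  have hlow : (∫ t in a..(a + r), (ψ t * f s₁ + (1 - ψ t) * f s₂ - S.indicator (fun _ => 2 * C) t)) ≤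
      ∫ t in a..(a + r), f (ψ t * s₁ + (1 - ψ t) * s₂) := by
    rw [intervalIntegral.integral_of_le (by linarith), intervalIntegral.integral_of_le (by linarith),
      integral_Ioc_eq_integral_Ioo, integral_Ioc_eq_integral_Ioo]
    refine setIntegral_mono_on ?_ ?_ measurableSet_Ioo fun t ht => hpt t ⟨ht.1.le, ht.2⟩
    · have hc := hψ.continuous
      refine Integrable.sub ?_ ((integrable_indicator_iff hS).2 (integrable_const _).integrableOn)
      exact ((by fun_prop : Continuous fun t => ψ t * f s₁ + (1 - ψ t) * f s₂).integrableOn_Icc).mono_set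
        Ioo_subset_Icc_self
    · refine Measure.integrableOn_of_bounded (M := C) (by simp) ?_ ?_
      · have hc := hψ.continuous
        exact (hfm.comp (by fun_prop)).aestronglyMeasurable
      · exact Filter.Eventually.of_forall fun t => hfC _ (hmem t)
  have hSint : (∫ t in a..(a + r), S.indicator (fun _ => 2 * C) t) ≤ η * r := by
    rw [intervalIntegral.integral_of_le (by linarith), integral_indicator hS, setIntegral_const,
      smul_eq_mul, measureReal_def]
    have h1 : ((volume.restrict (Ioc a (a + r))) S).toReal ≤ η * r / (2 * C + 1) := by
      refine ENNReal.toReal_le_of_le_ofReal (by positivity) ?_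
      exact (Measure.restrict_apply_le _ _).trans hSv
    calc _ ≤ η * r / (2 * C + 1) * (2 * C) := by gcongr
      _ ≤ η * r / (2 * C + 1) * (2 * C + 1) := by gcongr; linarith
      _ = η * r := by field_simp
  have hSii : IntervalIntegrable (S.indicator (fun _ => 2 * C)) volume a (a + r) := by
    rw [intervalIntegrable_iff, uIoc_of_le (by linarith)]
    exact (integrable_indicator_iff hS).2 (integrable_const _).integrableOn
  rw [intervalIntegral.integral_sub ((hii.mul_const _).add
      ((intervalIntegrable_const.sub hii).mul_const _)) hSii,
    intervalIntegral.integral_add (hii.mul_const _)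
      ((intervalIntegrable_const.sub hii).mul_const _), intervalIntegral.integral_mul_const,
      intervalIntegral.integral_mul_const, intervalIntegral.integral_sub (by simp) hii, hint] at hlow
  simp only [intervalIntegral.integral_const, add_sub_cancel_left, smul_eq_mul, mul_one] at hlow
  have hkey' : (∫ t in a..(a + r), f (ψ t * s₁ + (1 - ψ t) * s₂)) ≤
      r * f (θ * s₁ + (1 - θ) * s₂) := by
    rwa [← div_eq_inv_mul, div_le_iff₀ hr, mul_comm] at key
  have : r * (θ * f s₁ + (1 - θ) * f s₂) ≤ r * (f (θ * s₁ + (1 - θ) * s₂) + η) := by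
    nlinarith
  exact le_of_mul_le_mul_left this hr

/-! ### Consequences of homogeneity and separate concavity -/

lemma IsHomogeneous.map_zero {m n : ℕ} {p : ℝ} {F : Mat m n → ℝ} (hp : 1 < p)
    (hFp : IsHomogeneous p F) : F 0 = 0 := by
  have h := hFp 2 0 two_pos
  have hz : (2 : ℝ) • (0 : Mat m n) = 0 := by ext; simp
  rw [hz] at h
  have h2 : (1 : ℝ) < 2 ^ p := Real.one_lt_rpow (by norm_num) (by linarith)
  by_contra h0
  exact h2.ne' (mul_right_cancel₀ h0 (by linarith))

lemma IsHomogeneous.exists_abs_le {m n : ℕ} {p : ℝ} {F : Mat m n → ℝ} (hp : 1 < p)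
    (hFp : IsHomogeneous p F) (hF : IsQuasiconcave F) :
    ∃ M : ℝ, 0 ≤ M ∧ ∀ A, |F A| ≤ M * ‖A‖ ^ p := by
  obtain ⟨C, hC⟩ := hF.locallyBounded 1
  refine ⟨C, (abs_nonneg _).trans (hC 0 (by simp)), fun A => ?_⟩
  rcases eq_or_ne A 0 with rfl | hA
  · rw [hFp.map_zero hp, norm_zero, Real.zero_rpow (by linarith)]; simp
  · have hA' : 0 < ‖A‖ := norm_pos_iff.2 hA
    have h := hFp ‖A‖ (‖A‖⁻¹ • A) hA'
    rw [smul_smul, mul_inv_cancel₀ hA'.ne', one_smul] at h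
    rw [h, abs_mul, abs_of_nonneg (by positivity), mul_comm]
    gcongr
    apply hC
    rw [norm_smul, norm_inv, norm_norm, inv_mul_cancel₀ hA'.ne']

/-- A concave function on the line bounded by `L` on `[-τ, 1 + τ]` has increment at most
`2 L / τ` over `[0, 1]`. -/
lemma ConcaveOn.abs_sub_le_of_abs_le {f : ℝ → ℝ} (hf : ConcaveOn ℝ univ f) {τ L : ℝ} (hτ : 0 < τ)
    (hL : ∀ s ∈ Icc (-τ) (1 + τ), |f s| ≤ L) : |f 1 - f 0| ≤ 2 * L / τ := by
  have h1 := hf.slope_anti_adjacent (mem_univ (-τ)) (mem_univ 1) (by linarith : -τ < 0) one_pos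
  have h2 := hf.slope_anti_adjacent (mem_univ 0) (mem_univ (1 + τ)) one_pos (by linarith : 1 < 1 + τ)
  simp only [sub_zero, div_one, zero_sub, neg_neg, add_sub_cancel_left] at h1 h2
  have b1 := abs_le.1 (hL (-τ) ⟨le_rfl, by linarith⟩)
  have b2 := abs_le.1 (hL 0 ⟨by linarith, by linarith⟩)
  have b3 := abs_le.1 (hL 1 ⟨by linarith, by linarith⟩)
  have b4 := abs_le.1 (hL (1 + τ) ⟨by linarith, le_rfl⟩)
  rw [abs_le]
  constructor
  · refine le_trans ?_ h2
    rw [← neg_div]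
    gcongr
    linarith
  · refine h1.trans ?_
    gcongr
    linarith

/-- The Lipschitz estimate along `b ⊗ eᵢ`: a concave function of one variable bounded on a long
interval has small slopes in the middle of it. -/
lemma exists_column_lipschitz {m n : ℕ} {p : ℝ} {F : Mat m n → ℝ} (hp : 1 < p)
    (hFp : IsHomogeneous p F) (hF : IsQuasiconcave F) :
    ∃ C : ℝ, 0 ≤ C ∧ ∀ (A : Mat m n) (i : Fin n) (b : EuclideanSpace ℝ (Fin m)) (R : ℝ),
      ‖A‖ + ‖columnMat i b‖ ≤ R →
      |F (A + columnMat i b) - F A| ≤ C * R ^ (p - 1) * ‖columnMat i b‖ := by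
  obtain ⟨M, hM0, hM⟩ := hFp.exists_abs_le hp hF
  refine ⟨2 * (M * 3 ^ p), by positivity, fun A i b R hR => ?_⟩
  set X : Mat m n := columnMat i b with hX
  rcases eq_or_ne X 0 with h0 | h0
  · simp [h0]
  have hXpos : 0 < ‖X‖ := norm_pos_iff.2 h0
  have hRpos : 0 < R := by have := norm_nonneg A; linarith
  have h := (hF.concaveOn_column A i b).abs_sub_le_of_abs_le (τ := R / ‖X‖) (L := M * (3 * R) ^ p)
    (by positivity) (fun s hs => by
      refine (hM _).trans ?_
      gcongr
      refine (norm_add_le _ _).trans ?_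
      rw [norm_smul, ← hX]
      have h1 : ‖s‖ ≤ 1 + R / ‖X‖ := by
        rw [Real.norm_eq_abs, abs_le]; constructor <;> linarith [hs.1, hs.2]
      have h2 : ‖s‖ * ‖X‖ ≤ ‖X‖ + R := by
        calc _ ≤ (1 + R / ‖X‖) * ‖X‖ := by gcongr
          _ = _ := by field_simp
      linarith)
  rw [← hX] at h
  have hz : (0 : ℝ) • X = 0 := zero_smul ℝ X
  simp only [one_smul, hz, add_zero] at h
  refine h.trans (le_of_eq ?_)
  rw [Real.mul_rpow (by norm_num) hRpos.le, Real.rpow_sub_one hRpos.ne']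
  field_simp

lemma columnMat_apply {m n : ℕ} (i : Fin n) (b : EuclideanSpace ℝ (Fin m))
    (x : EuclideanSpace ℝ (Fin n)) : columnMat i b x = x i • b := rfl

lemma sum_columnMat {m n : ℕ} (X : Mat m n) :
    ∑ i, columnMat i (X (EuclideanSpace.single i 1)) = X := by
  ext x j
  have hx : x = ∑ i, x i • (EuclideanSpace.single i (1 : ℝ) : EuclideanSpace ℝ (Fin n)) := by
    ext k; simp [Finset.sum_apply, Pi.single_apply]
  conv_rhs => rw [hx]
  simp [columnMat_apply]

lemma norm_columnMat_le {m n : ℕ} (X : Mat m n) (i : Fin n) :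
    ‖columnMat i (X (EuclideanSpace.single i 1))‖ ≤ ‖X‖ := by
  refine ContinuousLinearMap.opNorm_le_bound _ (norm_nonneg _) fun x => ?_
  rw [columnMat_apply, norm_smul, mul_comm]
  have h1 : ‖X (EuclideanSpace.single i 1)‖ ≤ ‖X‖ := by
    simpa using X.le_opNorm (EuclideanSpace.single i (1 : ℝ))
  exact mul_le_mul h1 (PiLp.norm_apply_le x i) (norm_nonneg _) (norm_nonneg _)

/-- A `p`-homogeneous quasiconcave function is locally Lipschitz, with the natural growth. -/
lemma exists_lipschitz_bound {m n : ℕ} {p : ℝ} {F : Mat m n → ℝ} (hp : 1 < p)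
    (hFp : IsHomogeneous p F) (hF : IsQuasiconcave F) :
    ∃ C : ℝ, 0 ≤ C ∧ ∀ A X : Mat m n,
      |F (A + X) - F A| ≤ C * (‖A‖ + ‖X‖) ^ (p - 1) * ‖X‖ := by
  obtain ⟨C, hC0, hC⟩ := exists_column_lipschitz hp hFp hF
  refine ⟨n * C * (n + 1 : ℝ) ^ (p - 1), by positivity, fun A X => ?_⟩
  set Y : Fin n → Mat m n := fun i => columnMat i (X (EuclideanSpace.single i 1)) with hY
  -- The columns of `X` are added one at a time; all intermediate matrices have norm at most `R`.
  set R : ℝ := (n + 1) * (‖A‖ + ‖X‖)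
  have key : ∀ s : Finset (Fin n),
      |F (A + ∑ i ∈ s, Y i) - F A| ≤ s.card * (C * R ^ (p - 1) * ‖X‖) := by
    intro s
    induction s using Finset.induction_on with
    | empty => simp
    | insert i s hi ih =>
      have hs : (s.card : ℝ) + 1 ≤ n := by
        have : (insert i s).card ≤ n := by simpa using (insert i s).card_le_univ
        rw [Finset.card_insert_of_notMem hi] at this
        exact_mod_cast this
      have hnorm : ‖A + ∑ i ∈ s, Y i‖ + ‖Y i‖ ≤ R := by
        have h1 : ‖∑ i ∈ s, Y i‖ ≤ s.card * ‖X‖ := by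
          refine (norm_sum_le _ _).trans ?_
          refine (Finset.sum_le_card_nsmul _ _ ‖X‖ fun j _ => norm_columnMat_le X j).trans ?_
          rw [nsmul_eq_mul]
        have h2 := norm_add_le A (∑ i ∈ s, Y i)
        have h3 : ‖Y i‖ ≤ ‖X‖ := norm_columnMat_le X i
        have h4 := norm_nonneg A
        have h5 := norm_nonneg X
        simp only [R]
        nlinarith
      have hstep := hC (A + ∑ i ∈ s, Y i) i (X (EuclideanSpace.single i 1)) R hnorm
      have hR0 : 0 ≤ R := by simp only [R]; positivity
      rw [Finset.sum_insert hi, Finset.card_insert_of_notMem hi]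
      have e1 : A + (Y i + ∑ i ∈ s, Y i) = A + ∑ i ∈ s, Y i + Y i := by abel
      rw [e1]
      have h6 : |F (A + ∑ i ∈ s, Y i + Y i) - F (A + ∑ i ∈ s, Y i)| ≤ C * R ^ (p - 1) * ‖X‖ :=
        hstep.trans (by gcongr; exact norm_columnMat_le X i)
      have h7 := abs_sub_le (F (A + ∑ i ∈ s, Y i + Y i)) (F (A + ∑ i ∈ s, Y i)) (F A)
      push_cast
      linarith
  have h := key Finset.univ
  rw [sum_columnMat, Finset.card_univ, Fintype.card_fin] at h
  refine h.trans (le_of_eq ?_)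
  simp only [R]
  rw [Real.mul_rpow (by positivity) (by positivity)]
  ring

/-- A form of Young's inequality. -/
lemma exists_add_rpow_mul_le {p ε : ℝ} (hp : 1 < p) (hε : 0 < ε) :
    ∃ C : ℝ, 0 ≤ C ∧ ∀ a b : ℝ, 0 ≤ a → 0 ≤ b → (a + b) ^ (p - 1) * b ≤ ε * a ^ p + C * b ^ p := by
  set δ : ℝ := min 1 (ε / 2 ^ (p - 1))
  have hδ : 0 < δ := by positivity
  refine ⟨(1 / δ + 1) ^ (p - 1), by positivity, fun a b ha hb => ?_⟩
  have hp1 : 0 ≤ p - 1 := by linarith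
  have hpow : ∀ x : ℝ, 0 ≤ x → x ^ (p - 1) * x = x ^ p := fun x hx => by
    rcases hx.eq_or_lt with rfl | hx'
    · rw [mul_zero, Real.zero_rpow (by linarith)]
    · rw [Real.rpow_sub_one hx'.ne']; field_simp
  rcases le_total b (δ * a) with h | h
  · have h1 : b ≤ a := h.trans (by
      calc δ * a ≤ 1 * a := by gcongr; exact min_le_left _ _
        _ = a := one_mul a)
    calc (a + b) ^ (p - 1) * b ≤ (2 * a) ^ (p - 1) * (δ * a) := by
          gcongr; linarith
      _ = 2 ^ (p - 1) * δ * (a ^ (p - 1) * a) := by rw [Real.mul_rpow (by norm_num) ha]; ring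
      _ = 2 ^ (p - 1) * δ * a ^ p := by rw [hpow a ha]
      _ ≤ 2 ^ (p - 1) * (ε / 2 ^ (p - 1)) * a ^ p := by gcongr; exact min_le_right _ _
      _ = ε * a ^ p := by field_simp
      _ ≤ _ := le_add_of_nonneg_right (by positivity)
  · have h1 : a ≤ 1 / δ * b := by
      rw [one_div, ← div_eq_inv_mul, le_div_iff₀ hδ]; linarith
    calc (a + b) ^ (p - 1) * b ≤ ((1 / δ + 1) * b) ^ (p - 1) * b := by
          gcongr; linarith
      _ = (1 / δ + 1) ^ (p - 1) * (b ^ (p - 1) * b) := by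
          rw [Real.mul_rpow (by positivity) hb]; ring
      _ = (1 / δ + 1) ^ (p - 1) * b ^ p := by rw [hpow b hb]
      _ ≤ _ := le_add_of_nonneg_left (by positivity)

/-- Replacing `A` by `A + X` changes `F` by a small multiple of `‖A‖ ^ p` and a large multiple of
`‖X‖ ^ p`. -/
lemma exists_abs_sub_le {m n : ℕ} {p : ℝ} {F : Mat m n → ℝ} (hp : 1 < p)
    (hFp : IsHomogeneous p F) (hF : IsQuasiconcave F) {ε : ℝ} (hε : 0 < ε) :
    ∃ C : ℝ, 0 ≤ C ∧ ∀ A X : Mat m n, |F (A + X) - F A| ≤ ε * ‖A‖ ^ p + C * ‖X‖ ^ p := by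
  obtain ⟨L, hL0, hL⟩ := exists_lipschitz_bound hp hFp hF
  obtain ⟨C, hC0, hC⟩ := exists_add_rpow_mul_le hp (ε := ε / (L + 1)) (by positivity)
  refine ⟨(L + 1) * C, by positivity, fun A X => (hL A X).trans ?_⟩
  calc L * (‖A‖ + ‖X‖) ^ (p - 1) * ‖X‖ ≤ (L + 1) * ((‖A‖ + ‖X‖) ^ (p - 1) * ‖X‖) := by
        rw [mul_assoc]; gcongr; linarith
    _ ≤ (L + 1) * (ε / (L + 1) * ‖A‖ ^ p + C * ‖X‖ ^ p) := by
        gcongr; exact hC _ _ (norm_nonneg _) (norm_nonneg _)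
    _ = _ := by field_simp

/-! ### Quasiconcavity with compactly supported perturbations -/

lemma integral_fderiv_eq_zero {m n : ℕ} {φ : EuclideanSpace ℝ (Fin n) → EuclideanSpace ℝ (Fin m)}
    (hφ : ContDiff ℝ ∞ φ) (hc : HasCompactSupport φ) : ∫ x, fderiv ℝ φ x = 0 := by
  have hint : Integrable (fderiv ℝ φ) :=
    (hφ.continuous_fderiv (by simp)).integrable_of_hasCompactSupport (hc.fderiv ℝ)
  ext1 v
  rw [ContinuousLinearMap.integral_apply hint]
  have h := integral_smul_fderiv_eq_neg_fderiv_smul_of_integrable (μ := volume) (𝕜 := ℝ)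
    (f := fun _ : EuclideanSpace ℝ (Fin n) => (1 : ℝ)) (g := φ) (v := v) (by simp)
    (by simpa using hint.apply_continuousLinearMap v)
    (by simpa using hφ.continuous.integrable_of_hasCompactSupport hc)
    (by simp) (fun x _ => (hφ.differentiable (by simp)).differentiableAt)
  simpa using h

/-- Periodic rescaling of `ℝⁿ`: in each coordinate, the cell `[aᵢ, aᵢ + r)` and its translates are
mapped affinely onto `[-2R, 2R)`. -/
noncomputable def cellMap {n : ℕ} (a : EuclideanSpace ℝ (Fin n)) (r R : ℝ)
    (x : EuclideanSpace ℝ (Fin n)) : EuclideanSpace ℝ (Fin n) :=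
  WithLp.toLp 2 fun i => 4 * R * (Int.fract ((x i - a i) / r) - 1 / 2)

lemma lt_abs_fract_sub_half {u v : ℝ} (hv : Int.fract v = 0) (huv : |u - v| < 1 / 4) :
    1 / 4 < |Int.fract u - 1 / 2| := by
  have hv' : v = ⌊v⌋ := by rw [Int.fract] at hv; linarith
  rw [abs_lt] at huv
  rw [lt_abs]
  rcases le_or_gt v u with h | h
  · right
    have : ⌊u⌋ = ⌊v⌋ := by rw [Int.floor_eq_iff, ← hv']; constructor <;> linarith
    rw [Int.fract, this, ← hv']; linarith
  · left
    have : ⌊u⌋ = ⌊v⌋ - 1 := by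
      rw [Int.floor_eq_iff]; push_cast; rw [← hv']; constructor <;> linarith
    rw [Int.fract, this]; push_cast; rw [← hv']; linarith

section cellMap

variable {m n : ℕ} (a : EuclideanSpace ℝ (Fin n)) {r R : ℝ}
  {φ : EuclideanSpace ℝ (Fin n) → EuclideanSpace ℝ (Fin m)}

lemma lt_norm_of_lt_abs_apply {n : ℕ} {x : EuclideanSpace ℝ (Fin n)} {i : Fin n} {R : ℝ}
    (h : R < |x i|) : R < ‖x‖ :=
  h.trans_le (PiLp.norm_apply_le x i)

lemma cellMap_add_single (hr : 0 < r) (x : EuclideanSpace ℝ (Fin n)) (i : Fin n) :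
    cellMap a r R (x + EuclideanSpace.single i r) = cellMap a r R x := by
  ext j
  simp only [cellMap]
  by_cases h : j = i
  · subst h
    simp only [PiLp.add_apply, PiLp.single_apply, if_true]
    rw [show (x j + r - a j) / r = (x j - a j) / r + 1 by field_simp; ring, Int.fract_add_one]
  · simp [h]

lemma continuousAt_coord (i : Fin n) (x : EuclideanSpace ℝ (Fin n)) :
    ContinuousAt (fun y : EuclideanSpace ℝ (Fin n) => (y i - a i) / r) x := by
  fun_prop

/-- The periodization `s φ(κ x)`, with `κ` the periodic rescaling by `1 / s`, of a function `φ`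
supported in a ball is smooth, and its derivative is `Dφ(κ x)`. -/
lemma periodization_smooth (hr : 0 < r) (hR : 0 < R) (hφ : ContDiff ℝ ∞ φ)
    (hsupp : ∀ x, R < ‖x‖ → φ x = 0) (x : EuclideanSpace ℝ (Fin n)) :
    ContDiffAt ℝ ∞ (fun y => (r / (4 * R)) • φ (cellMap a r R y)) x ∧
    fderiv ℝ (fun y => (r / (4 * R)) • φ (cellMap a r R y)) x = fderiv ℝ φ (cellMap a r R x) := by
  by_cases hA : ∃ i, Int.fract ((x i - a i) / r) = 0
  -- On the boundary of a cell, everything vanishes nearby.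
  · obtain ⟨i, hi⟩ := hA
    have hbig : ∀ᶠ y in nhds x, R < ‖cellMap a r R y‖ := by
      have hc := Metric.tendsto_nhds.1 (continuousAt_coord a (r := r) i x) (1 / 4) (by norm_num)
      filter_upwards [hc] with y hy
      apply lt_norm_of_lt_abs_apply (i := i)
      have := lt_abs_fract_sub_half hi hy
      simp only [cellMap]
      rw [abs_mul, abs_of_pos (by positivity)]
      nlinarith
    have hev : (fun y => (r / (4 * R)) • φ (cellMap a r R y)) =ᶠ[nhds x] fun _ => 0 := by
      filter_upwards [hbig] with y hy
      rw [hsupp _ hy, smul_zero]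
    refine ⟨contDiffAt_const.congr_of_eventuallyEq hev, ?_⟩
    rw [hev.fderiv_eq]
    have hev2 : φ =ᶠ[nhds (cellMap a r R x)] fun _ => 0 := by
      filter_upwards [(isOpen_lt continuous_const continuous_norm).mem_nhds hbig.self_of_nhds]
        with z hz using hsupp z hz
    rw [hev2.fderiv_eq]
    simp
  · push Not at hA
    let c : EuclideanSpace ℝ (Fin n) :=
      WithLp.toLp 2 fun i => a i + r * ⌊(x i - a i) / r⌋ + r / 2
    have hev0 : ∀ᶠ y in nhds x, ∀ i, ⌊(y i - a i) / r⌋ = ⌊(x i - a i) / r⌋ := by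
      rw [Filter.eventually_all]
      intro i
      have h1 : (⌊(x i - a i) / r⌋ : ℝ) < (x i - a i) / r := by
        have := (Int.fract_nonneg ((x i - a i) / r)).lt_of_ne' (hA i)
        rw [Int.fract] at this; linarith
      have h2 := Int.lt_floor_add_one ((x i - a i) / r)
      filter_upwards [continuousAt_coord a i x (Ioo_mem_nhds h1 h2)] with y hy
      rw [Int.floor_eq_iff]
      exact ⟨hy.1.le, hy.2⟩
    have hcell : ∀ᶠ y in nhds x, cellMap a r R y = (4 * R / r) • (y - c) := by
      filter_upwards [hev0] with y hy
      ext i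
      simp only [cellMap, Int.fract, hy i, c, PiLp.smul_apply, PiLp.sub_apply, smul_eq_mul]
      field_simp
      ring
    have hev : (fun y => (r / (4 * R)) • φ (cellMap a r R y)) =ᶠ[nhds x]
        fun y => (r / (4 * R)) • φ ((4 * R / r) • (y - c)) := by
      filter_upwards [hcell] with y hy
      rw [hy]
    refine ⟨ContDiffAt.congr_of_eventuallyEq ?_ hev, ?_⟩
    · have h1 : ContDiff ℝ ∞ fun y : EuclideanSpace ℝ (Fin n) => (4 * R / r) • (y - c) := by fun_prop
      have h2 : ContDiff ℝ ∞ fun y => φ ((4 * R / r) • (y - c)) := hφ.comp h1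
      exact (h2.const_smul (r / (4 * R))).contDiffAt
    · rw [hev.fderiv_eq, hcell.self_of_nhds]
      have h1 : HasFDerivAt (fun y => (4 * R / r) • (y - c))
          ((4 * R / r) • ContinuousLinearMap.id ℝ (EuclideanSpace ℝ (Fin n))) x :=
        ((hasFDerivAt_id x).sub_const c).const_smul (4 * R / r)
      have h2 : HasFDerivAt φ (fderiv ℝ φ ((4 * R / r) • (x - c))) ((4 * R / r) • (x - c)) :=
        (hφ.differentiable (by simp)).differentiableAt.hasFDerivAt
      have h3 := (h2.comp x h1).const_smul (r / (4 * R))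
      have h4 : HasFDerivAt (fun y => (r / (4 * R)) • φ ((4 * R / r) • (y - c))) _ x := h3
      rw [h4.fderiv]
      ext v j
      simp only [ContinuousLinearMap.comp_smul, ContinuousLinearMap.comp_id,
        _root_.smul_apply, PiLp.smul_apply, smul_eq_mul]
      field_simp

/-- Over one cell, the periodized function has the same integrals as the original one. -/
lemma setIntegral_cube_cellMap {V : Type*} [NormedAddCommGroup V] [NormedSpace ℝ V]
    (hr : 0 < r) (hR : 0 < R) {H : EuclideanSpace ℝ (Fin n) → V} (hH : ∀ x, R < ‖x‖ → H x = 0) :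
    ∫ x in cube a r, H (cellMap a r R x) = (r / (4 * R)) ^ n • ∫ x, H x := by
  let c : EuclideanSpace ℝ (Fin n) := WithLp.toLp 2 fun i => a i + r / 2
  have hcube : ∀ x ∈ cube a r, H (cellMap a r R x) = H ((4 * R / r) • (x - c)) := by
    intro x hx
    by_cases hA : ∃ i, x i = a i + r
    · obtain ⟨i, hi⟩ := hA
      rw [hH _ (lt_norm_of_lt_abs_apply (i := i) ?_), hH _ (lt_norm_of_lt_abs_apply (i := i) ?_)]
      · simp only [c, PiLp.smul_apply, PiLp.sub_apply, smul_eq_mul, hi]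
        rw [show 4 * R / r * (a i + r - (a i + r / 2)) = 2 * R by field_simp; ring,
          abs_of_pos (by positivity)]
        linarith
      · simp only [cellMap, hi]
        rw [show (a i + r - a i) / r = 1 by field_simp; ring, Int.fract_one, abs_mul,
          abs_of_pos (by positivity)]
        norm_num; linarith
    · push Not at hA
      congr 1
      ext i
      have h0 : ⌊(x i - a i) / r⌋ = 0 := by
        rw [Int.floor_eq_iff]
        have := (hx i).2.lt_of_ne (hA i)
        have := (hx i).1
        constructor
        · push_cast; apply div_nonneg <;> linarith
        · push_cast; rw [div_lt_iff₀ hr]; linarith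
      simp only [cellMap, Int.fract, h0, c, PiLp.smul_apply, PiLp.sub_apply, smul_eq_mul]
      push_cast
      field_simp
      ring
  have hout : ∀ x ∉ cube a r, H ((4 * R / r) • (x - c)) = 0 := by
    intro x hx
    simp only [cube, mem_ofPred_eq, not_forall, not_and_or, not_le] at hx
    obtain ⟨i, hi⟩ := hx
    refine hH _ (lt_norm_of_lt_abs_apply (i := i) ?_)
    simp only [c, PiLp.smul_apply, PiLp.sub_apply, smul_eq_mul]
    rw [abs_mul, abs_of_pos (by positivity), div_mul_eq_mul_div, lt_div_iff₀ hr]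
    have : r / 2 < |x i - (a i + r / 2)| := by
      rw [lt_abs]
      rcases hi with h | h
      · right; linarith
      · left; linarith
    nlinarith
  rw [setIntegral_congr_fun (measurableSet_cube a r) hcube,
    setIntegral_eq_integral_of_forall_compl_eq_zero hout,
    integral_sub_right_eq_self (fun x => H ((4 * R / r) • x)) c, Measure.integral_comp_smul]
  congr 1
  rw [finrank_euclideanSpace, Fintype.card_fin, abs_of_pos (by positivity), ← inv_pow, inv_div]

end cellMap

/-- A quasiconcave function vanishing at `0` has nonpositive integral along the gradient of every
test function: the periodization of `φ` is a competitor whose gradient has mean `0`. -/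
lemma IsQuasiconcave.integral_fderiv_nonpos {m n : ℕ} {F : Mat m n → ℝ} (hF : IsQuasiconcave F)
    (hF0 : F 0 = 0) {φ : EuclideanSpace ℝ (Fin n) → EuclideanSpace ℝ (Fin m)}
    (hφ : ContDiff ℝ ∞ φ) (hc : HasCompactSupport φ) : ∫ x, F (fderiv ℝ φ x) ≤ 0 := by
  obtain ⟨a, r, hr, H⟩ := hF.average_le
  obtain ⟨R, hR, hsub⟩ : ∃ R : ℝ, 0 < R ∧ tsupport φ ⊆ Metric.closedBall 0 R := by
    obtain ⟨R, hR⟩ := hc.isBounded.subset_closedBall 0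
    exact ⟨max R 1, by positivity, hR.trans (Metric.closedBall_subset_closedBall (le_max_left _ _))⟩
  have hnot : ∀ x : EuclideanSpace ℝ (Fin n), R < ‖x‖ → x ∉ tsupport φ := fun x hx hx' => by
    have := hsub hx'
    rw [mem_closedBall_zero_iff] at this
    linarith
  have hsupp : ∀ x, R < ‖x‖ → φ x = 0 := fun x hx => image_eq_zero_of_notMem_tsupport (hnot x hx)
  have hsupp' : ∀ x, R < ‖x‖ → fderiv ℝ φ x = 0 := fun x hx =>
    image_eq_zero_of_notMem_tsupport fun h => hnot x hx (tsupport_fderiv_subset ℝ h)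
  have hper := periodization_smooth (φ := φ) a hr hR hφ hsupp
  have key := H (fun y => (r / (4 * R)) • φ (cellMap a r R y))
    (contDiff_iff_contDiffAt.2 fun x => (hper x).1)
    (fun x i => by rw [(hper _).2, (hper _).2, cellMap_add_single a hr])
  simp only [(hper _).2] at key
  rw [setAverage_eq, setAverage_eq,
    setIntegral_cube_cellMap (H := fun x => F (fderiv ℝ φ x)) a hr hR
      (fun x hx => by rw [hsupp' x hx, hF0]),
    setIntegral_cube_cellMap (H := fun x => fderiv ℝ φ x) a hr hR hsupp',
    integral_fderiv_eq_zero hφ hc, smul_zero, smul_zero, hF0, smul_smul, smul_eq_mul] at key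
  refine nonpos_of_mul_nonpos_right key ?_
  rw [measureReal_def, volume_cube, ENNReal.toReal_pow, ENNReal.toReal_ofReal hr.le]
  positivity

/-! ### Poincaré inequalities on balls -/

/-- Jensen's inequality for the power `q`. -/
lemma lintegral_rpow_le_measure_univ_rpow_mul {α : Type*} [MeasurableSpace α] {μ : Measure α} {q : ℝ}
    (hq : 1 ≤ q) {f : α → ℝ≥0∞} (hf : AEMeasurable f μ) :
    (∫⁻ x, f x ∂μ) ^ q ≤ μ univ ^ (q - 1) * ∫⁻ x, f x ^ q ∂μ := by
  rcases hq.eq_or_lt with rfl | hq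
  · simp
  have hpq : q.HolderConjugate (q / (q - 1)) := Real.HolderConjugate.conjExponent hq
  have h := ENNReal.lintegral_mul_le_Lp_mul_Lq μ hpq hf (aemeasurable_const (b := (1 : ℝ≥0∞)))
  simp only [Pi.mul_apply, mul_one, ENNReal.one_rpow, lintegral_const, one_mul] at h
  have h0 : 0 ≤ q := by linarith
  calc (∫⁻ x, f x ∂μ) ^ q ≤
      ((∫⁻ x, f x ^ q ∂μ) ^ (1 / q) * μ univ ^ (1 / (q / (q - 1)))) ^ q := by gcongr
    _ = μ univ ^ (q - 1) * ∫⁻ x, f x ^ q ∂μ := by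
      rw [ENNReal.mul_rpow_of_nonneg _ _ h0, ← ENNReal.rpow_mul, ← ENNReal.rpow_mul, mul_comm]
      have h1 : q ≠ 0 := by linarith
      congr 2
      · field_simp
      · rw [one_div_mul_cancel h1, ENNReal.rpow_one]

lemma enorm_sub_le_lintegral_fderiv {E V : Type*} [NormedAddCommGroup E] [NormedSpace ℝ E]
    [NormedAddCommGroup V] [NormedSpace ℝ V] [CompleteSpace V] {U : E → V} (hU : ContDiff ℝ 1 U) (x v : E) :
    ‖U x - U (x + v)‖ₑ ≤ ∫⁻ t in Ioc (0 : ℝ) 1, ‖fderiv ℝ U (x + t • v)‖ₑ * ‖v‖ₑ := by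
  have hcont : Continuous fun t : ℝ => fderiv ℝ U (x + t • v) v :=
    ((hU.continuous_fderiv (by simp)).comp (by fun_prop)).clm_apply continuous_const
  have hder : ∀ t : ℝ, HasDerivAt (fun t : ℝ => U (x + t • v)) (fderiv ℝ U (x + t • v) v) t := by
    intro t
    have h1 : HasDerivAt (fun t : ℝ => x + t • v) v t := by
      simpa using ((hasDerivAt_id t).smul_const v).const_add x
    exact ((hU.differentiable (by simp)).differentiableAt.hasFDerivAt).comp_hasDerivAt t h1
  have h := intervalIntegral.integral_eq_sub_of_hasDerivAt (a := 0) (b := 1) (fun t _ => hder t)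
    (hcont.intervalIntegrable _ _)
  simp only [one_smul, zero_smul, add_zero] at h
  rw [← enorm_neg, neg_sub, ← h, intervalIntegral.integral_of_le zero_le_one]
  refine (enorm_integral_le_lintegral_enorm _).trans (lintegral_mono fun t => ?_)
  exact ContinuousLinearMap.le_opENorm _ _

section Poincare

variable {E : Type*} [NormedAddCommGroup E] [NormedSpace ℝ E] [FiniteDimensional ℝ E]
  [MeasurableSpace E] [BorelSpace E] (μ : Measure E) [μ.IsAddHaarMeasure]
  {V : Type*} [NormedAddCommGroup V] [NormedSpace ℝ V] [CompleteSpace V]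

lemma lintegral_comp_smul_eq {s : ℝ} (hs : 0 < s) (g : E → ℝ≥0∞) (hg : Measurable g) :
    ∫⁻ x, g (s • x) ∂μ = ENNReal.ofReal ((s ^ Module.finrank ℝ E)⁻¹) * ∫⁻ x, g x ∂μ := by
  rw [← lintegral_map (f := g) (g := fun x => s • x) hg (by fun_prop),
    Measure.map_addHaar_smul μ hs.ne', lintegral_smul_measure, smul_eq_mul, abs_of_pos (by positivity)]

/-- Change of variables under a homothety with ratio `s` which maps the convex set `B` to itself. -/
lemma setLIntegral_comp_homothety_le {B : Set E} (hB : Convex ℝ B) (hBm : MeasurableSet B)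
    {z : E} (hz : z ∈ B) {s : ℝ} (hs : 0 < s) (hs1 : s ≤ 1) {g : E → ℝ≥0∞} (hg : Measurable g) :
    ∫⁻ x in B, g (z + s • (x - z)) ∂μ ≤
      ENNReal.ofReal ((s ^ Module.finrank ℝ E)⁻¹) * ∫⁻ x in B, g x ∂μ := by
  calc ∫⁻ x in B, g (z + s • (x - z)) ∂μ
      ≤ ∫⁻ x, B.indicator g (z + s • (x - z)) ∂μ := by
        rw [← lintegral_indicator hBm]
        refine lintegral_mono fun x => ?_
        by_cases hx : x ∈ B
        · have : z + s • (x - z) ∈ B := by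
            have := hB hz hx (sub_nonneg.2 hs1) hs.le (by ring)
            convert this using 1
            module
          rw [indicator_of_mem hx, indicator_of_mem this]
        · rw [indicator_of_notMem hx]; exact zero_le
    _ = ∫⁻ x, B.indicator g (z + s • x) ∂μ :=
        lintegral_sub_right_eq_self (fun x => B.indicator g (z + s • x)) z
    _ = ENNReal.ofReal ((s ^ Module.finrank ℝ E)⁻¹) * ∫⁻ x, B.indicator g (z + x) ∂μ :=
        lintegral_comp_smul_eq μ hs (fun x => B.indicator g (z + x))
          ((hg.indicator hBm).comp (by fun_prop))
    _ = _ := by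
        rw [lintegral_add_left_eq_self (fun x => B.indicator g x) z, lintegral_indicator hBm]

variable {B : Set E} {D : ℝ}

/-- Moving every point of a convex set `B` of diameter at most `D` towards `y ∈ B` by the
proportion `δ` changes a function by at most `δ D` times its gradient, in every `L^q`. -/
lemma setLIntegral_sub_homothety_le (hB : Convex ℝ B) (hBm : MeasurableSet B)
    (hD : ∀ x ∈ B, ∀ y ∈ B, ‖x - y‖ ≤ D) {U : E → V} (hU : ContDiff ℝ 1 U) {q δ : ℝ} (hq : 1 ≤ q)
    (hδ : 0 < δ) (hδ2 : δ ≤ 1 / 2) {y : E} (hy : y ∈ B) :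
    ∫⁻ x in B, ‖U x - U (x + δ • (y - x))‖ₑ ^ q ∂μ ≤
      ENNReal.ofReal (δ * D) ^ q * 2 ^ Module.finrank ℝ E * ∫⁻ x in B, ‖fderiv ℝ U x‖ₑ ^ q ∂μ := by
  have hq0 : 0 ≤ q := by linarith
  have hcD : Continuous (fderiv ℝ U) := hU.continuous_fderiv (by simp)
  calc ∫⁻ x in B, ‖U x - U (x + δ • (y - x))‖ₑ ^ q ∂μ
      ≤ ∫⁻ x in B, ENNReal.ofReal (δ * D) ^ q *
          ∫⁻ t in Ioc (0 : ℝ) 1, ‖fderiv ℝ U (x + t • δ • (y - x))‖ₑ ^ q ∂volume ∂μ := by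
        refine setLIntegral_mono' hBm fun x hx => ?_
        have hm : Measurable fun t : ℝ => ‖fderiv ℝ U (x + t • δ • (y - x))‖ₑ :=
          ((hcD.comp (by fun_prop)).enorm).measurable
        have h1 := enorm_sub_le_lintegral_fderiv hU x (δ • (y - x))
        have h2 : ‖δ • (y - x)‖ₑ ≤ ENNReal.ofReal (δ * D) := by
          rw [← ofReal_norm]
          apply ENNReal.ofReal_le_ofReal
          rw [norm_smul, Real.norm_eq_abs, abs_of_pos hδ]
          gcongr
          exact hD y hy x hx
        rw [lintegral_mul_const _ hm] at h1
        calc ‖U x - U (x + δ • (y - x))‖ₑ ^ q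
            ≤ ((∫⁻ t in Ioc (0 : ℝ) 1, ‖fderiv ℝ U (x + t • δ • (y - x))‖ₑ) *
                ENNReal.ofReal (δ * D)) ^ q := by
              gcongr
              exact h1.trans (by gcongr)
          _ = ENNReal.ofReal (δ * D) ^ q *
                (∫⁻ t in Ioc (0 : ℝ) 1, ‖fderiv ℝ U (x + t • δ • (y - x))‖ₑ) ^ q := by
              rw [ENNReal.mul_rpow_of_nonneg _ _ hq0, mul_comm]
          _ ≤ _ := by
              gcongr
              refine (lintegral_rpow_le_measure_univ_rpow_mul hq hm.aemeasurable).trans ?_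
              simp
    _ = ENNReal.ofReal (δ * D) ^ q * ∫⁻ x in B, ∫⁻ t in Ioc (0 : ℝ) 1,
          ‖fderiv ℝ U (x + t • δ • (y - x))‖ₑ ^ q ∂volume ∂μ := by
        rw [lintegral_const_mul]
        apply Measurable.lintegral_prod_right'
          (f := fun z : E × ℝ => ‖fderiv ℝ U (z.1 + z.2 • δ • (y - z.1))‖ₑ ^ q)
        exact ((hcD.comp (by fun_prop)).enorm).measurable.pow_const q
    _ = ENNReal.ofReal (δ * D) ^ q * ∫⁻ t in Ioc (0 : ℝ) 1, ∫⁻ x in B,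
          ‖fderiv ℝ U (x + t • δ • (y - x))‖ₑ ^ q ∂μ ∂volume := by
        rw [lintegral_lintegral_swap]
        apply Measurable.aemeasurable
        apply Measurable.pow_const
        exact ((hcD.comp (by fun_prop)).enorm).measurable
    _ ≤ ENNReal.ofReal (δ * D) ^ q * ∫⁻ _ in Ioc (0 : ℝ) 1,
          2 ^ Module.finrank ℝ E * ∫⁻ x in B, ‖fderiv ℝ U x‖ₑ ^ q ∂μ := by
        refine mul_le_mul' le_rfl (setLIntegral_mono' measurableSet_Ioc fun t ht => ?_)
        have hs : 1 / 2 ≤ 1 - t * δ := by nlinarith [ht.1, ht.2]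
        have h := setLIntegral_comp_homothety_le μ hB hBm hy (s := 1 - t * δ) (by linarith)
          (by nlinarith [ht.1]) (g := fun x => ‖fderiv ℝ U x‖ₑ ^ q)
          (hcD.enorm.measurable.pow_const q)
        have e : ∀ x, y + (1 - t * δ) • (x - y) = x + t • δ • (y - x) := fun x => by module
        simp only [e] at h
        refine h.trans ?_
        gcongr
        rw [← inv_pow, ENNReal.ofReal_pow (by positivity)]
        gcongr
        rw [show (2 : ℝ≥0∞) = ENNReal.ofReal 2 by simp]
        apply ENNReal.ofReal_le_ofReal
        rw [inv_le_comm₀ (by linarith) (by norm_num)]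
        linarith
    _ = _ := by simp [mul_assoc]

/-- A Poincaré inequality in `L¹`. The values at `x` and `y` are compared through the value at the
midpoint, and `c` is the value at a well-chosen point `y`. -/
lemma exists_setLIntegral_sub_le (hB : Convex ℝ B) (hBm : MeasurableSet B)
    (hD : ∀ x ∈ B, ∀ y ∈ B, ‖x - y‖ ≤ D) (hB0 : μ B ≠ 0) (hBt : μ B ≠ ⊤) {U : E → V}
    (hU : ContDiff ℝ 1 U) :
    ∃ c : V, ∫⁻ x in B, ‖U x - c‖ₑ ∂μ ≤
      ENNReal.ofReal D * 2 ^ Module.finrank ℝ E * ∫⁻ x in B, ‖fderiv ℝ U x‖ₑ ∂μ := by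
  set I := ENNReal.ofReal (1 / 2 * D) * 2 ^ Module.finrank ℝ E * ∫⁻ x in B, ‖fderiv ℝ U x‖ₑ ∂μ with hI
  have hcU := hU.continuous
  have hstep : ∀ y ∈ B, ∫⁻ x in B, ‖U x - U (x + (1 / 2 : ℝ) • (y - x))‖ₑ ∂μ ≤ I := fun y hy => by
    have h := setLIntegral_sub_homothety_le μ hB hBm hD hU (q := 1) (δ := 1 / 2) le_rfl
      (by norm_num) le_rfl hy
    simpa only [ENNReal.rpow_one] using h
  have hm2 : Measurable fun z : E × E => ‖U z.1 - U (z.1 + (1 / 2 : ℝ) • (z.2 - z.1))‖ₑ := by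
    have : Continuous fun z : E × E => U z.1 - U (z.1 + (1 / 2 : ℝ) • (z.2 - z.1)) := by fun_prop
    exact this.enorm.measurable
  have hm2' : Measurable fun z : E × E => ‖U z.2 - U (z.2 + (1 / 2 : ℝ) • (z.1 - z.2))‖ₑ := by
    have : Continuous fun z : E × E => U z.2 - U (z.2 + (1 / 2 : ℝ) • (z.1 - z.2)) := by fun_prop
    exact this.enorm.measurable
  have hmid : ∫⁻ y in B, ∫⁻ x in B, ‖U x - U (x + (1 / 2 : ℝ) • (y - x))‖ₑ ∂μ ∂μ ≤ I * μ B := by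
    refine (setLIntegral_mono' hBm hstep).trans (by simp)
  have hdouble : ∫⁻ y in B, ∫⁻ x in B, ‖U x - U y‖ₑ ∂μ ∂μ ≤ (I + I) * μ B := by
    calc ∫⁻ y in B, ∫⁻ x in B, ‖U x - U y‖ₑ ∂μ ∂μ
        ≤ ∫⁻ y in B, (∫⁻ x in B, ‖U x - U (x + (1 / 2 : ℝ) • (y - x))‖ₑ ∂μ +
            ∫⁻ x in B, ‖U y - U (y + (1 / 2 : ℝ) • (x - y))‖ₑ ∂μ) ∂μ := by
          refine lintegral_mono fun y => ?_
          rw [← lintegral_add_left (show Measurable fun x => ‖U x - U (x + (1 / 2 : ℝ) • (y - x))‖ₑ from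
            hm2.comp (measurable_id.prodMk measurable_const))]
          refine lintegral_mono fun x => ?_
          have e : y + (1 / 2 : ℝ) • (x - y) = x + (1 / 2 : ℝ) • (y - x) := by module
          rw [e, ← enorm_neg (U y - _), neg_sub]
          refine (le_of_eq ?_).trans (enorm_add_le _ _)
          congr 1; abel
      _ = ∫⁻ y in B, ∫⁻ x in B, ‖U x - U (x + (1 / 2 : ℝ) • (y - x))‖ₑ ∂μ ∂μ +
            ∫⁻ y in B, ∫⁻ x in B, ‖U y - U (y + (1 / 2 : ℝ) • (x - y))‖ₑ ∂μ ∂μ := by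
          rw [lintegral_add_left]
          exact hm2'.lintegral_prod_right
      _ = ∫⁻ y in B, ∫⁻ x in B, ‖U x - U (x + (1 / 2 : ℝ) • (y - x))‖ₑ ∂μ ∂μ +
            ∫⁻ y in B, ∫⁻ x in B, ‖U x - U (x + (1 / 2 : ℝ) • (y - x))‖ₑ ∂μ ∂μ := by
          congr 1
          rw [lintegral_lintegral_swap]
          exact hm2.aemeasurable
      _ ≤ _ := by rw [add_mul]; gcongr
  have hm3 : Measurable fun z : E × E => ‖U z.2 - U z.1‖ₑ := by
    have : Continuous fun z : E × E => U z.2 - U z.1 := by fun_prop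
    exact this.enorm.measurable
  obtain ⟨y, -, hyle⟩ := exists_le_setLAverage hB0 hBt
    (f := fun y => ∫⁻ x in B, ‖U x - U y‖ₑ ∂μ) hm3.lintegral_prod_right.aemeasurable
  refine ⟨U y, hyle.trans ?_⟩
  rw [setLAverage_eq]
  refine ENNReal.div_le_of_le_mul (hdouble.trans (le_of_eq ?_))
  congr 1
  rw [hI, ← two_mul, ← mul_assoc, ← mul_assoc]
  congr 2
  rw [show (2 : ℝ≥0∞) = ENNReal.ofReal 2 by simp, ← ENNReal.ofReal_mul (by norm_num)]
  congr 1; ring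

/-- A Poincaré inequality on a convex set, with an arbitrarily small constant in front of the
`L^q` norm of the gradient at the cost of a term with its `L¹` norm. To this end `U x` is compared with the average of `U` over the
image of `B` under the homothety of centre `x` and small ratio `δ`. -/
lemma exists_setLIntegral_sub_rpow_le (hB : Convex ℝ B) (hBm : MeasurableSet B)
    (hD : ∀ x ∈ B, ∀ y ∈ B, ‖x - y‖ ≤ D) (hB0 : μ B ≠ 0) (hBt : μ B ≠ ⊤) {U : E → V}
    (hU : ContDiff ℝ 1 U) {q δ : ℝ} (hq : 1 ≤ q) (hδ : 0 < δ) (hδ2 : δ ≤ 1 / 2) :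
    ∃ c : V, ∫⁻ x in B, ‖U x - c‖ₑ ^ q ∂μ ≤
      2 ^ (q - 1) * (ENNReal.ofReal (δ * D) ^ q * 2 ^ Module.finrank ℝ E *
        ∫⁻ x in B, ‖fderiv ℝ U x‖ₑ ^ q ∂μ) +
      2 ^ (q - 1) * (μ B ^ (1 - q) * (ENNReal.ofReal ((δ ^ Module.finrank ℝ E)⁻¹) *
        (ENNReal.ofReal D * 2 ^ Module.finrank ℝ E * ∫⁻ x in B, ‖fderiv ℝ U x‖ₑ ∂μ)) ^ q) := by
  obtain ⟨c, hc⟩ := exists_setLIntegral_sub_le μ hB hBm hD hB0 hBt hU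
  refine ⟨c, ?_⟩
  have hq0 : 0 ≤ q := by linarith
  have hcU := hU.continuous
  set β := ENNReal.ofReal ((δ ^ Module.finrank ℝ E)⁻¹) *
        (ENNReal.ofReal D * 2 ^ Module.finrank ℝ E * ∫⁻ x in B, ‖fderiv ℝ U x‖ₑ ∂μ) with hβ
  set J := ENNReal.ofReal (δ * D) ^ q * 2 ^ Module.finrank ℝ E *
        ∫⁻ x in B, ‖fderiv ℝ U x‖ₑ ^ q ∂μ with hJ
  have hm2 : Measurable fun z : E × E => ‖U z.1 - U (z.1 + δ • (z.2 - z.1))‖ₑ := by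
    have : Continuous fun z : E × E => U z.1 - U (z.1 + δ • (z.2 - z.1)) := by fun_prop
    exact this.enorm.measurable
  have hpt : ∀ x ∈ B, μ B ^ q * ‖U x - c‖ₑ ^ q ≤ 2 ^ (q - 1) *
      (μ B ^ (q - 1) * (∫⁻ y in B, ‖U x - U (x + δ • (y - x))‖ₑ ^ q ∂μ) + β ^ q) := by
    intro x hx
    have h1 : μ B * ‖U x - c‖ₑ ≤ (∫⁻ y in B, ‖U x - U (x + δ • (y - x))‖ₑ ∂μ) + β := by
      have h2 : ∫⁻ y in B, ‖U (x + δ • (y - x)) - c‖ₑ ∂μ ≤ β := by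
        refine (setLIntegral_comp_homothety_le μ hB hBm hx hδ (by linarith)
          (g := fun z => ‖U z - c‖ₑ) (hcU.sub continuous_const).enorm.measurable).trans ?_
        rw [hβ]; gcongr
      calc μ B * ‖U x - c‖ₑ = ∫⁻ y in B, ‖U x - c‖ₑ ∂μ := by simp [mul_comm]
        _ ≤ ∫⁻ y in B, (‖U x - U (x + δ • (y - x))‖ₑ + ‖U (x + δ • (y - x)) - c‖ₑ) ∂μ := by
            refine lintegral_mono fun y => ?_
            refine (le_of_eq ?_).trans (enorm_add_le _ _)
            congr 1; abel
        _ = (∫⁻ y in B, ‖U x - U (x + δ • (y - x))‖ₑ ∂μ) +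
              ∫⁻ y in B, ‖U (x + δ • (y - x)) - c‖ₑ ∂μ :=
            lintegral_add_left (hm2.comp (measurable_const.prodMk measurable_id)) _
        _ ≤ _ := by gcongr
    rw [← ENNReal.mul_rpow_of_nonneg _ _ hq0]
    calc (μ B * ‖U x - c‖ₑ) ^ q
        ≤ ((∫⁻ y in B, ‖U x - U (x + δ • (y - x))‖ₑ ∂μ) + β) ^ q := by gcongr
      _ ≤ 2 ^ (q - 1) * ((∫⁻ y in B, ‖U x - U (x + δ • (y - x))‖ₑ ∂μ) ^ q + β ^ q) :=
          ENNReal.rpow_add_le_mul_rpow_add_rpow _ _ hq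
      _ ≤ _ := by
          gcongr
          have h3 := lintegral_rpow_le_measure_univ_rpow_mul (μ := μ.restrict B) hq
            (f := fun y => ‖U x - U (x + δ • (y - x))‖ₑ)
            (hm2.comp (measurable_const.prodMk measurable_id)).aemeasurable
          simpa using h3
  have hint : μ B ^ q * ∫⁻ x in B, ‖U x - c‖ₑ ^ q ∂μ ≤
      2 ^ (q - 1) * (μ B ^ q * J + μ B * β ^ q) := by
    have hmq : Measurable fun x => ‖U x - c‖ₑ ^ q :=
      (hcU.sub continuous_const).enorm.measurable.pow_const q
    have hmq2 : Measurable fun x => ∫⁻ y in B, ‖U x - U (x + δ • (y - x))‖ₑ ^ q ∂μ :=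
      (hm2.pow_const q).lintegral_prod_right
    rw [← lintegral_const_mul _ hmq]
    refine (setLIntegral_mono' hBm hpt).trans ?_
    rw [lintegral_const_mul _ (by fun_prop), lintegral_add_left (by fun_prop),
      lintegral_const_mul _ hmq2, lintegral_lintegral_swap (hm2.pow_const q).aemeasurable]
    refine mul_le_mul' le_rfl (add_le_add ?_ ?_)
    · calc μ B ^ (q - 1) * ∫⁻ y in B, ∫⁻ x in B, ‖U x - U (x + δ • (y - x))‖ₑ ^ q ∂μ ∂μ
          ≤ μ B ^ (q - 1) * ∫⁻ y in B, J ∂μ := by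
            exact mul_le_mul' le_rfl (setLIntegral_mono' hBm fun y hy =>
              setLIntegral_sub_homothety_le μ hB hBm hD hU hq hδ hδ2 hy)
        _ = μ B ^ q * J := by
            rw [setLIntegral_const, mul_comm J, ← mul_assoc]
            congr 1
            nth_rewrite 2 [← ENNReal.rpow_one (μ B)]
            rw [← ENNReal.rpow_add _ _ hB0 hBt]
            ring_nf
    · simp [mul_comm]
  have hinv : μ B ^ (-q) * μ B ^ q = 1 := by
    rw [← ENNReal.rpow_add _ _ hB0 hBt]; simp
  calc ∫⁻ x in B, ‖U x - c‖ₑ ^ q ∂μ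
      = μ B ^ (-q) * (μ B ^ q * ∫⁻ x in B, ‖U x - c‖ₑ ^ q ∂μ) := by rw [← mul_assoc, hinv, one_mul]
    _ ≤ μ B ^ (-q) * (2 ^ (q - 1) * (μ B ^ q * J + μ B * β ^ q)) := by gcongr
    _ = 2 ^ (q - 1) * (μ B ^ (-q) * μ B ^ q * J) +
          2 ^ (q - 1) * ((μ B ^ (-q) * μ B ^ (1 : ℝ)) * β ^ q) := by
        rw [ENNReal.rpow_one]; ring
    _ = _ := by
        rw [hinv, one_mul, ← ENNReal.rpow_add _ _ hB0 hBt]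
        ring_nf

end Poincare

/-! ### Continuity of the integrand and the cut-off test -/

lemma continuous_of_isQuasiconcave {m n : ℕ} {p : ℝ} {F : Mat m n → ℝ} (hp : 1 < p)
    (hFp : IsHomogeneous p F) (hF : IsQuasiconcave F) : Continuous F := by
  obtain ⟨C, hC0, hC⟩ := exists_lipschitz_bound hp hFp hF
  rw [continuous_iff_continuousAt]
  intro A
  rw [ContinuousAt, tendsto_iff_norm_sub_tendsto_zero]
  have hlim : Filter.Tendsto (fun B : Mat m n => C * (‖A‖ + ‖B - A‖) ^ (p - 1) * ‖B - A‖) (nhds A)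
      (nhds 0) := by
    have hc : Continuous fun B : Mat m n => C * (‖A‖ + ‖B - A‖) ^ (p - 1) * ‖B - A‖ := by
      have : Continuous fun B : Mat m n => (‖A‖ + ‖B - A‖) ^ (p - 1) :=
        (by fun_prop : Continuous fun B : Mat m n => ‖A‖ + ‖B - A‖).rpow_const
          fun _ => Or.inr (by linarith)
      fun_prop
    simpa using hc.tendsto A
  refine squeeze_zero (fun _ => norm_nonneg _) (fun B => ?_) hlim
  have := hC A (B - A)
  rwa [add_sub_cancel] at this

lemma integral_norm_rpow_eq_toReal {α V : Type*} [MeasurableSpace α] [NormedAddCommGroup V]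
    {ν : Measure α} {f : α → V} (hf : AEStronglyMeasurable f ν) {q : ℝ} (hq : 0 ≤ q) :
    ∫ x, ‖f x‖ ^ q ∂ν = (∫⁻ x, ‖f x‖ₑ ^ q ∂ν).toReal := by
  rw [integral_eq_lintegral_of_nonneg_ae (Filter.Eventually.of_forall fun x => by positivity)
    (by exact (hf.norm.aemeasurable.pow_const q).aestronglyMeasurable)]
  congr 1
  refine lintegral_congr fun x => ?_
  rw [← ENNReal.ofReal_rpow_of_nonneg (norm_nonneg _) hq, ofReal_norm]

lemma integrableOn_norm_rpow {E V : Type*} [NormedAddCommGroup E] [MeasurableSpace E] [BorelSpace E]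
    [NormedAddCommGroup V] {μ : Measure E} [IsFiniteMeasureOnCompacts μ] {f : E → V}
    (hf : Continuous f) {K : Set E} (hK : IsCompact K) {q : ℝ} (hq : 0 ≤ q) :
    IntegrableOn (fun x => ‖f x‖ ^ q) K μ :=
  (hf.norm.rpow_const fun _ => Or.inr hq).continuousOn.integrableOn_compact hK

lemma setLIntegral_enorm_rpow_ne_top {E V : Type*} [NormedAddCommGroup E] [MeasurableSpace E]
    [BorelSpace E] [NormedAddCommGroup V] {μ : Measure E} [IsFiniteMeasureOnCompacts μ] {f : E → V}
    (hf : Continuous f) {K : Set E} (hK : IsCompact K) {q : ℝ} (hq : 0 ≤ q) :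
    ∫⁻ x in K, ‖f x‖ₑ ^ q ∂μ ≠ ⊤ := by
  have h := (integrableOn_norm_rpow (μ := μ) hf hK hq).lintegral_lt_top
  refine ne_of_eq_of_ne ?_ h.ne
  refine lintegral_congr fun x => ?_
  rw [← ENNReal.ofReal_rpow_of_nonneg (norm_nonneg _) hq, ofReal_norm]

/-- The Poincaré inequality with small constant, on a closed ball. -/
lemma exists_integral_closedBall_sub_rpow_le {n : ℕ} {V : Type*} [NormedAddCommGroup V]
    [NormedSpace ℝ V] [CompleteSpace V] {U : EuclideanSpace ℝ (Fin n) → V} (hU : ContDiff ℝ 1 U)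
    {q δ R : ℝ} (hq : 1 ≤ q) (hδ : 0 < δ) (hδ2 : δ ≤ 1 / 2) (hR : 0 < R)
    (x₀ : EuclideanSpace ℝ (Fin n)) :
    ∃ c : V, ∫ x in Metric.closedBall x₀ R, ‖U x - c‖ ^ q ≤
      2 ^ (q - 1) * ((δ * (2 * R)) ^ q * 2 ^ n *
        ∫ x in Metric.closedBall x₀ R, ‖fderiv ℝ U x‖ ^ q) +
      2 ^ (q - 1) * (volume.real (Metric.closedBall x₀ R) ^ (1 - q) * ((δ ^ n)⁻¹ *
        (2 * R * 2 ^ n * ∫ x in Metric.closedBall x₀ R, ‖fderiv ℝ U x‖)) ^ q) := by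
  have hq0 : 0 ≤ q := by linarith
  set B := Metric.closedBall x₀ R with hB
  have hBc : IsCompact B := isCompact_closedBall x₀ R
  have hcD : Continuous (fderiv ℝ U) := hU.continuous_fderiv (by simp)
  have hB0 : volume B ≠ 0 := (Metric.measure_closedBall_pos volume x₀ hR).ne'
  obtain ⟨c, hc⟩ := exists_setLIntegral_sub_rpow_le volume (B := B) (D := 2 * R)
    (convex_closedBall x₀ R) measurableSet_closedBall
    (fun x hx y hy => by
      rw [← dist_eq_norm]
      have h1 := Metric.mem_closedBall.1 hx
      have h2 := Metric.mem_closedBall.1 hy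
      linarith [dist_triangle_right x y x₀])
    hB0 hBc.measure_lt_top.ne hU hq hδ hδ2
  refine ⟨c, ?_⟩
  have hmD : AEStronglyMeasurable (fderiv ℝ U) (volume.restrict B) := hcD.aestronglyMeasurable
  have hfin1 := setLIntegral_enorm_rpow_ne_top (μ := volume) hcD hBc hq0
  have hfin2 := setLIntegral_enorm_rpow_ne_top (μ := volume) hcD hBc zero_le_one
  simp only [ENNReal.rpow_one] at hfin2
  rw [finrank_euclideanSpace, Fintype.card_fin] at hc
  have h2 : ∫ x in B, ‖fderiv ℝ U x‖ = (∫⁻ x in B, ‖fderiv ℝ U x‖ₑ).toReal := by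
    simpa using integral_norm_rpow_eq_toReal hmD zero_le_one
  rw [integral_norm_rpow_eq_toReal hmD hq0, h2, integral_norm_rpow_eq_toReal (f := fun x => U x - c)
    (hU.continuous.sub continuous_const).aestronglyMeasurable hq0]
  have htwo : (2 : ℝ≥0∞) ^ (q - 1) ≠ ⊤ := ENNReal.rpow_ne_top_of_nonneg (by linarith) (by simp)
  have hT1 : (2 : ℝ≥0∞) ^ (q - 1) * (ENNReal.ofReal (δ * (2 * R)) ^ q * 2 ^ n *
      ∫⁻ x in B, ‖fderiv ℝ U x‖ₑ ^ q) ≠ ⊤ := by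
    refine ENNReal.mul_ne_top htwo (ENNReal.mul_ne_top (ENNReal.mul_ne_top ?_ (by simp)) hfin1)
    exact ENNReal.rpow_ne_top_of_nonneg hq0 ENNReal.ofReal_ne_top
  have hT2 : (2 : ℝ≥0∞) ^ (q - 1) * (volume B ^ (1 - q) * (ENNReal.ofReal (δ ^ n)⁻¹ *
      (ENNReal.ofReal (2 * R) * 2 ^ n * ∫⁻ x in B, ‖fderiv ℝ U x‖ₑ)) ^ q) ≠ ⊤ := by
    refine ENNReal.mul_ne_top htwo (ENNReal.mul_ne_top
      (ENNReal.rpow_ne_top_of_ne_zero hB0 hBc.measure_lt_top.ne)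
      (ENNReal.rpow_ne_top_of_nonneg hq0 (ENNReal.mul_ne_top (by simp)
        (ENNReal.mul_ne_top (ENNReal.mul_ne_top ENNReal.ofReal_ne_top (by simp)) hfin2))))
  have h := ENNReal.toReal_mono (ENNReal.add_ne_top.2 ⟨hT1, hT2⟩) hc
  rw [ENNReal.toReal_add hT1 hT2] at h
  refine h.trans (le_of_eq ?_)
  simp only [ENNReal.toReal_mul, ← ENNReal.toReal_rpow, ENNReal.toReal_pow, ENNReal.toReal_ofNat,
    measureReal_def]
  rw [ENNReal.toReal_ofReal (by positivity), ENNReal.toReal_ofReal (by positivity),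
    ENNReal.toReal_ofReal (by positivity)]

/-- The standard cutoff function: `1` on the unit ball, supported in the ball of radius `2`. -/
noncomputable def unitBump (n : ℕ) : ContDiffBump (0 : EuclideanSpace ℝ (Fin n)) :=
  ⟨1, 2, one_pos, one_lt_two⟩

/-- The cutoff function of the ball of centre `x₀` and radius `ρ`, supported in the ball of
radius `2ρ`. -/
noncomputable def ballCutoff {n : ℕ} (x₀ : EuclideanSpace ℝ (Fin n)) (ρ : ℝ)
    (x : EuclideanSpace ℝ (Fin n)) : ℝ :=
  unitBump n (ρ⁻¹ • (x - x₀))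

section ballCutoff

variable {n : ℕ} {x₀ x : EuclideanSpace ℝ (Fin n)} {ρ : ℝ}

lemma ballCutoff_contDiff : ContDiff ℝ ∞ (ballCutoff x₀ ρ) := by
  have h1 : ContDiff ℝ ∞ fun x : EuclideanSpace ℝ (Fin n) => ρ⁻¹ • (x - x₀) := by fun_prop
  exact (unitBump n).contDiff.comp h1

lemma ballCutoff_nonneg : 0 ≤ ballCutoff x₀ ρ x := (unitBump n).nonneg

lemma ballCutoff_le_one : ballCutoff x₀ ρ x ≤ 1 := (unitBump n).le_one

lemma ballCutoff_eq_one (hρ : 0 < ρ) (hx : x ∈ Metric.closedBall x₀ ρ) : ballCutoff x₀ ρ x = 1 := by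
  apply (unitBump n).one_of_mem_closedBall
  rw [mem_closedBall_zero_iff, norm_smul, norm_inv, Real.norm_of_nonneg hρ.le, ← dist_eq_norm,
    inv_mul_le_iff₀ hρ]
  simpa [unitBump] using hx

lemma ballCutoff_eq_zero (hρ : 0 < ρ) (hx : x ∉ Metric.closedBall x₀ (2 * ρ)) :
    ballCutoff x₀ ρ x = 0 := by
  apply (unitBump n).zero_of_le_dist
  rw [dist_zero_right, norm_smul, norm_inv, Real.norm_of_nonneg hρ.le, ← dist_eq_norm,
    le_inv_mul_iff₀ hρ]
  rw [Metric.mem_closedBall, not_le] at hx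
  simp only [unitBump]
  linarith

lemma tsupport_ballCutoff_subset (hρ : 0 < ρ) :
    tsupport (ballCutoff x₀ ρ) ⊆ Metric.closedBall x₀ (2 * ρ) := by
  refine closure_minimal (fun x hx => ?_) Metric.isClosed_closedBall
  by_contra h
  exact hx (ballCutoff_eq_zero hρ h)

lemma exists_norm_fderiv_ballCutoff_le (n : ℕ) : ∃ C : ℝ, 0 ≤ C ∧
    ∀ (x₀ x : EuclideanSpace ℝ (Fin n)) (ρ : ℝ), 0 < ρ → ‖fderiv ℝ (ballCutoff x₀ ρ) x‖ ≤ C / ρ := by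
  have hcd : ContDiff ℝ ∞ (unitBump n) := (unitBump n).contDiff
  obtain ⟨C, hC⟩ := ((unitBump n).hasCompactSupport.fderiv ℝ).exists_bound_of_continuous
    (hcd.continuous_fderiv (by simp))
  refine ⟨C, (norm_nonneg _).trans (hC 0), fun x₀ x ρ hρ => ?_⟩
  have h1 : HasFDerivAt (fun y => ρ⁻¹ • (y - x₀))
      (ρ⁻¹ • ContinuousLinearMap.id ℝ (EuclideanSpace ℝ (Fin n))) x :=
    ((hasFDerivAt_id x).sub_const x₀).const_smul ρ⁻¹
  have h2 : HasFDerivAt (unitBump n) (fderiv ℝ (unitBump n) (ρ⁻¹ • (x - x₀))) (ρ⁻¹ • (x - x₀)) :=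
    (hcd.differentiable (by simp)).differentiableAt.hasFDerivAt
  have h3 : HasFDerivAt (ballCutoff x₀ ρ) _ x := h2.comp x h1
  rw [h3.fderiv, ContinuousLinearMap.comp_smul, ContinuousLinearMap.comp_id, norm_smul, norm_inv,
    Real.norm_of_nonneg hρ.le, div_eq_inv_mul]
  gcongr
  exact hC _

end ballCutoff

lemma exists_pos_le_half_mul_rpow_le {p K ε : ℝ} (hp : 0 < p) (hK : 0 ≤ K) (hε : 0 < ε) :
    ∃ δ : ℝ, 0 < δ ∧ δ ≤ 1 / 2 ∧ K * δ ^ p ≤ ε := by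
  refine ⟨min (1 / 2) ((ε / (K + 1)) ^ p⁻¹), by positivity, min_le_left _ _, ?_⟩
  calc K * min (1 / 2) ((ε / (K + 1)) ^ p⁻¹) ^ p ≤ (K + 1) * ((ε / (K + 1)) ^ p⁻¹) ^ p := by
        gcongr
        · linarith
        · exact min_le_right _ _
    _ = ε := by rw [Real.rpow_inv_rpow (by positivity) hp.ne']; field_simp

/-- Testing quasiconcavity with `η (U - c)` and absorbing the lower-order terms by the Poincaré
inequality. -/
lemma exists_integral_cutoff_le {m n : ℕ} {p : ℝ} {F : Mat m n → ℝ} (hp : 1 < p)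
    (hFp : IsHomogeneous p F) (hF : IsQuasiconcave F) {ε : ℝ} (hε : 0 < ε) :
    ∃ C : ℝ, 0 ≤ C ∧ ∀ (U : EuclideanSpace ℝ (Fin n) → EuclideanSpace ℝ (Fin m)), ContDiff ℝ ∞ U →
      ∀ (x₀ : EuclideanSpace ℝ (Fin n)) (ρ : ℝ), 0 < ρ →
      ∫ x in Metric.closedBall x₀ (2 * ρ), ballCutoff x₀ ρ x ^ p * F (fderiv ℝ U x) ≤
        ε * (∫ x in Metric.closedBall x₀ (2 * ρ), ‖fderiv ℝ U x‖ ^ p) +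
        C * (volume.real (Metric.closedBall x₀ (2 * ρ)) ^ (1 - p) *
          (∫ x in Metric.closedBall x₀ (2 * ρ), ‖fderiv ℝ U x‖) ^ p) := by
  have hp0 : 0 < p := by linarith
  obtain ⟨C₁, hC₁0, hC₁⟩ := exists_abs_sub_le hp hFp hF (half_pos hε)
  obtain ⟨C₀, hC₀0, hC₀⟩ := exists_norm_fderiv_ballCutoff_le n
  have hFc := continuous_of_isQuasiconcave hp hFp hF
  set K := C₁ * C₀ ^ p * 2 ^ (p - 1) * 4 ^ p * 2 ^ n
  obtain ⟨δ, hδ, hδ2, hKδ⟩ := exists_pos_le_half_mul_rpow_le hp0 (by positivity : 0 ≤ K) (half_pos hε)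
  refine ⟨C₁ * C₀ ^ p * 2 ^ (p - 1) * ((δ ^ n)⁻¹ * 4 * 2 ^ n) ^ p, by positivity,
    fun U hU x₀ ρ hρ => ?_⟩
  set B := Metric.closedBall x₀ (2 * ρ)
  have hBc : IsCompact B := isCompact_closedBall _ _
  have hU1 : ContDiff ℝ 1 U := hU.of_le (by simp)
  obtain ⟨c, hc⟩ := exists_integral_closedBall_sub_rpow_le hU1 hp.le hδ hδ2
    (by positivity : 0 < 2 * ρ) x₀
  set η := ballCutoff x₀ ρ
  have hη : ContDiff ℝ ∞ η := ballCutoff_contDiff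
  let W : EuclideanSpace ℝ (Fin n) → EuclideanSpace ℝ (Fin m) := fun x => η x • (U x - c)
  have hW : ContDiff ℝ ∞ W := hη.smul (hU.sub contDiff_const)
  have hWc : HasCompactSupport W :=
    (HasCompactSupport.of_support_subset_isCompact hBc
      ((subset_tsupport _).trans (tsupport_ballCutoff_subset hρ)) : HasCompactSupport η).smul_right
  have hDW : ∀ x, fderiv ℝ W x = η x • fderiv ℝ U x + (fderiv ℝ η x).smulRight (U x - c) :=
    fun x => by
      have h1 : HasFDerivAt η (fderiv ℝ η x) x :=
        (hη.differentiable (by simp)).differentiableAt.hasFDerivAt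
      have h2 : HasFDerivAt U (fderiv ℝ U x) x :=
        (hU.differentiable (by simp)).differentiableAt.hasFDerivAt
      have h3 : HasFDerivAt W _ x := h1.smul (h2.sub_const c)
      exact h3.fderiv
  have hWsupp : tsupport W ⊆ B := by
    refine closure_minimal (fun x hx => ?_) Metric.isClosed_closedBall
    by_contra h
    exact hx (by simp only [W]; rw [show η x = 0 from ballCutoff_eq_zero hρ h, zero_smul])
  have hFW : ∫ x in B, F (fderiv ℝ W x) ≤ 0 := by
    rw [setIntegral_eq_integral_of_forall_compl_eq_zero]
    · exact hF.integral_fderiv_nonpos (hFp.map_zero hp) hW hWc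
    · intro x hx
      rw [image_eq_zero_of_notMem_tsupport fun h => hx (hWsupp (tsupport_fderiv_subset ℝ h)),
        hFp.map_zero hp]
  have hcDU : Continuous (fderiv ℝ U) := hU.continuous_fderiv (by simp)
  have hcDW : Continuous (fderiv ℝ W) := hW.continuous_fderiv (by simp)
  have hcU := hU.continuous
  have hcη := hη.continuous
  have hpt : ∀ x ∈ B, η x ^ p * F (fderiv ℝ U x) ≤ F (fderiv ℝ W x) +
      (ε / 2 * ‖fderiv ℝ U x‖ ^ p + C₁ * (C₀ / ρ) ^ p * ‖U x - c‖ ^ p) := by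
    intro x _
    have hη0 : 0 ≤ η x := ballCutoff_nonneg
    have hη1 : η x ≤ 1 := ballCutoff_le_one
    have e : η x ^ p * F (fderiv ℝ U x) = F (η x • fderiv ℝ U x) := by
      rcases hη0.eq_or_lt with h | h
      · rw [← h, Real.zero_rpow hp0.ne', zero_mul]
        have hz : (0 : ℝ) • fderiv ℝ U x = 0 := by ext; simp
        rw [hz, hFp.map_zero hp]
      · rw [hFp _ _ h]
    have h1 := (abs_le.1 (hC₁ (η x • fderiv ℝ U x) ((fderiv ℝ η x).smulRight (U x - c)))).1
    rw [← hDW] at h1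
    have h2 : ‖η x • fderiv ℝ U x‖ ≤ ‖fderiv ℝ U x‖ := by
      rw [norm_smul, Real.norm_of_nonneg hη0]
      exact mul_le_of_le_one_left (norm_nonneg _) hη1
    have h3 : ‖(fderiv ℝ η x).smulRight (U x - c)‖ ^ p ≤ (C₀ / ρ) ^ p * ‖U x - c‖ ^ p := by
      rw [ContinuousLinearMap.norm_smulRight_apply, ← Real.mul_rpow (by positivity) (norm_nonneg _)]
      gcongr
      exact hC₀ x₀ x ρ hρ
    have h4 : ε / 2 * ‖η x • fderiv ℝ U x‖ ^ p ≤ ε / 2 * ‖fderiv ℝ U x‖ ^ p := by gcongr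
    have h5 : C₁ * ‖(fderiv ℝ η x).smulRight (U x - c)‖ ^ p ≤
        C₁ * ((C₀ / ρ) ^ p * ‖U x - c‖ ^ p) := by gcongr
    rw [e]
    linarith
  have hi1 : IntegrableOn (fun x => ‖fderiv ℝ U x‖ ^ p) B := integrableOn_norm_rpow hcDU hBc hp0.le
  have hi2 : IntegrableOn (fun x => ‖U x - c‖ ^ p) B :=
    integrableOn_norm_rpow (hcU.sub continuous_const) hBc hp0.le
  have hi3 : IntegrableOn (fun x => F (fderiv ℝ W x)) B :=
    (hFc.comp hcDW).continuousOn.integrableOn_compact hBc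
  have hi4 : IntegrableOn (fun x => η x ^ p * F (fderiv ℝ U x)) B :=
    ((hcη.rpow_const fun _ => Or.inr hp0.le).mul (hFc.comp hcDU)).continuousOn.integrableOn_compact hBc
  have hi5 : IntegrableOn (fun x => ε / 2 * ‖fderiv ℝ U x‖ ^ p +
      C₁ * (C₀ / ρ) ^ p * ‖U x - c‖ ^ p) B :=
    (hi1.const_mul _).add (hi2.const_mul _)
  have hmain := setIntegral_mono_on hi4 (hi3.add hi5) measurableSet_closedBall hpt
  simp only [Pi.add_apply] at hmain
  rw [integral_add hi3 hi5, integral_add (hi1.const_mul _) (hi2.const_mul _), integral_const_mul,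
    integral_const_mul] at hmain
  set I := ∫ x in B, ‖fderiv ℝ U x‖ ^ p
  set J := ∫ x in B, ‖fderiv ℝ U x‖
  have hI0 : 0 ≤ I := integral_nonneg fun x => by positivity
  have hJ0 : 0 ≤ J := integral_nonneg fun x => by positivity
  have hb : C₁ * (C₀ / ρ) ^ p * ∫ x in B, ‖U x - c‖ ^ p ≤
      ε / 2 * I + C₁ * C₀ ^ p * 2 ^ (p - 1) * ((δ ^ n)⁻¹ * 4 * 2 ^ n) ^ p *
        (volume.real B ^ (1 - p) * J ^ p) := by
    have hρp : 0 < ρ ^ p := by positivity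
    calc C₁ * (C₀ / ρ) ^ p * ∫ x in B, ‖U x - c‖ ^ p
        ≤ C₁ * (C₀ / ρ) ^ p * (2 ^ (p - 1) * ((δ * (2 * (2 * ρ))) ^ p * 2 ^ n * I) +
          2 ^ (p - 1) * (volume.real B ^ (1 - p) * ((δ ^ n)⁻¹ *
            (2 * (2 * ρ) * 2 ^ n * J)) ^ p)) := by gcongr
      _ = K * δ ^ p * I + C₁ * C₀ ^ p * 2 ^ (p - 1) * ((δ ^ n)⁻¹ * 4 * 2 ^ n) ^ p *
            (volume.real B ^ (1 - p) * J ^ p) := by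
          rw [show δ * (2 * (2 * ρ)) = δ * 4 * ρ by ring,
            show (δ ^ n)⁻¹ * (2 * (2 * ρ) * 2 ^ n * J) = (δ ^ n)⁻¹ * 4 * 2 ^ n * ρ * J by ring,
            Real.div_rpow hC₀0 hρ.le, Real.mul_rpow (by positivity) hρ.le,
            Real.mul_rpow hδ.le (by norm_num), Real.mul_rpow (by positivity) hJ0,
            Real.mul_rpow (x := (δ ^ n)⁻¹ * 4 * 2 ^ n) (by positivity) hρ.le]
          simp only [K]
          field_simp
      _ ≤ _ := by gcongr
  linarith

/-! ### Mollification of weak gradients -/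

section Mollification

variable {E : Type*} [NormedAddCommGroup E] [NormedSpace ℝ E] [FiniteDimensional ℝ E]
  [HasContDiffBump E] [MeasurableSpace E] [BorelSpace E] {μ : Measure E} [μ.IsAddHaarMeasure]
  {V : Type*} [NormedAddCommGroup V] [NormedSpace ℝ V]

open scoped Convolution
open ContinuousLinearMap (lsmul)

/-- Convolution with a normalized bump function is a contraction of `L^q`. -/
lemma lintegral_enorm_convolution_rpow_le (φ : ContDiffBump (0 : E)) {h : E → V}
    (hh : StronglyMeasurable h) {q : ℝ} (hq : 1 ≤ q) :
    ∫⁻ x, ‖(φ.normed μ ⋆[lsmul ℝ ℝ, μ] h) x‖ₑ ^ q ∂μ ≤ ∫⁻ x, ‖h x‖ₑ ^ q ∂μ := by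
  have hφm : Measurable fun t => ENNReal.ofReal (φ.normed μ t) :=
    ((φ.contDiff_normed (n := 0)).continuous.measurable).ennreal_ofReal
  -- The mollification is an average of translates of `h` for the probability measure `ν`.
  set ν : Measure E := μ.withDensity fun t => ENNReal.ofReal (φ.normed μ t) with hν
  have hν1 : ν univ = 1 := by
    rw [hν, withDensity_apply _ MeasurableSet.univ, Measure.restrict_univ,
      ← ofReal_integral_eq_lintegral_ofReal φ.integrable_normed
        (Filter.Eventually.of_forall fun x => φ.nonneg_normed x), φ.integral_normed,
      ENNReal.ofReal_one]
  have : IsProbabilityMeasure ν := ⟨hν1⟩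
  have hhm : Measurable fun z : E × E => ‖h (z.1 - z.2)‖ₑ :=
    (hh.comp_measurable (measurable_fst.sub measurable_snd)).enorm
  have hpt : ∀ x, ‖(φ.normed μ ⋆[lsmul ℝ ℝ, μ] h) x‖ₑ ^ q ≤ ∫⁻ t, ‖h (x - t)‖ₑ ^ q ∂ν := by
    intro x
    have hm : Measurable fun t => ‖h (x - t)‖ₑ := hhm.comp (measurable_const.prodMk measurable_id)
    have h1 : ‖(φ.normed μ ⋆[lsmul ℝ ℝ, μ] h) x‖ₑ ≤ ∫⁻ t, ‖h (x - t)‖ₑ ∂ν := by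
      rw [convolution_def, hν, lintegral_withDensity_eq_lintegral_mul _ hφm hm]
      refine (enorm_integral_le_lintegral_enorm _).trans (le_of_eq ?_)
      refine lintegral_congr fun t => ?_
      rw [ContinuousLinearMap.lsmul_apply, enorm_smul, Pi.mul_apply,
        Real.enorm_of_nonneg (φ.nonneg_normed t)]
    calc _ ≤ (∫⁻ t, ‖h (x - t)‖ₑ ∂ν) ^ q := by gcongr
      _ ≤ ν univ ^ (q - 1) * ∫⁻ t, ‖h (x - t)‖ₑ ^ q ∂ν :=
          lintegral_rpow_le_measure_univ_rpow_mul hq hm.aemeasurable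
      _ = _ := by rw [hν1, ENNReal.one_rpow, one_mul]
  calc ∫⁻ x, ‖(φ.normed μ ⋆[lsmul ℝ ℝ, μ] h) x‖ₑ ^ q ∂μ
      ≤ ∫⁻ x, ∫⁻ t, ‖h (x - t)‖ₑ ^ q ∂ν ∂μ := lintegral_mono hpt
    _ = ∫⁻ t, ∫⁻ x, ‖h (x - t)‖ₑ ^ q ∂μ ∂ν :=
        lintegral_lintegral_swap (hhm.pow_const q).aemeasurable
    _ = ∫⁻ t, ∫⁻ x, ‖h x‖ₑ ^ q ∂μ ∂ν := by
        refine lintegral_congr fun t => ?_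
        exact lintegral_sub_right_eq_self (fun x => ‖h x‖ₑ ^ q) t
    _ = _ := by simp

lemma eLpNorm_convolution_le (φ : ContDiffBump (0 : E)) {h : E → V}
    (hh : StronglyMeasurable h) {q : ℝ} (hq : 1 ≤ q) :
    eLpNorm (φ.normed μ ⋆[lsmul ℝ ℝ, μ] h) (ENNReal.ofReal q) μ ≤ eLpNorm h (ENNReal.ofReal q) μ := by
  have h0 : ENNReal.ofReal q ≠ 0 := by simp; linarith
  rw [eLpNorm_eq_lintegral_rpow_enorm_toReal h0 ENNReal.ofReal_ne_top,
    eLpNorm_eq_lintegral_rpow_enorm_toReal h0 ENNReal.ofReal_ne_top,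
    ENNReal.toReal_ofReal (by linarith)]
  gcongr ?_ ^ _
  exact lintegral_enorm_convolution_rpow_le φ hh hq

variable [CompleteSpace V]

lemma exists_eLpNorm_convolution_sub_le_of_continuous {h : E → V} (hh : Continuous h)
    (hc : HasCompactSupport h) {q : ℝ≥0∞} {ε : ℝ} (hε : 0 < ε) :
    ∃ δ > 0, ∀ φ : ContDiffBump (0 : E), φ.rOut ≤ δ →
      eLpNorm ((φ.normed μ ⋆[lsmul ℝ ℝ, μ] h) - h) q μ ≤ ENNReal.ofReal ε := by
  set S := Metric.cthickening 1 (tsupport h)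
  have hSc : IsCompact S := IsCompact.cthickening hc
  have hSfin : (μ S) ^ q.toReal⁻¹ ≠ ⊤ :=
    ENNReal.rpow_ne_top_of_nonneg (by positivity) hSc.measure_lt_top.ne
  set M := ((μ S) ^ q.toReal⁻¹).toReal
  have hM : 0 ≤ M := ENNReal.toReal_nonneg
  obtain ⟨δ, hδ, hunif⟩ := Metric.uniformContinuous_iff.1 (hc.uniformContinuous_of_continuous hh)
    (ε / (M + 1)) (by positivity)
  refine ⟨min δ 1, by positivity, fun φ hφ => ?_⟩
  set w := (φ.normed μ ⋆[lsmul ℝ ℝ, μ] h) - h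
  have hw : ∀ x, ‖w x‖ ≤ ε / (M + 1) := by
    intro x
    rw [show w x = (φ.normed μ ⋆[lsmul ℝ ℝ, μ] h) x - h x from rfl, ← dist_eq_norm]
    refine φ.dist_normed_convolution_le hh.aestronglyMeasurable fun y hy => ?_
    exact (hunif ((Metric.mem_ball.1 hy).trans_le (hφ.trans (min_le_left _ _)))).le
  have hw0 : ∀ x ∉ S, w x = 0 := by
    intro x hx
    have hz : ∀ z ∈ Metric.ball x φ.rOut, h z = 0 := by
      intro z hz
      by_contra hne
      refine hx (Metric.closedBall_subset_cthickening (subset_tsupport _ hne) 1 ?_)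
      rw [Metric.mem_closedBall, dist_comm]
      exact (Metric.mem_ball.1 hz).le.trans (hφ.trans (min_le_right _ _))
    have hx0 : h x = 0 := hz x (Metric.mem_ball_self φ.rOut_pos)
    have := φ.normed_convolution_eq_right (μ := μ) (g := h) (x₀ := x) fun z hz' => by
      rw [hz z hz', hx0]
    simp only [w, Pi.sub_apply, this, sub_self]
  have hind : S.indicator w = w := by
    rw [indicator_eq_self]
    intro x hx
    by_contra h'
    exact hx (hw0 x h')
  rw [← hind, eLpNorm_indicator_eq_eLpNorm_restrict hSc.measurableSet]
  refine (eLpNorm_le_of_ae_bound (Filter.Eventually.of_forall hw)).trans ?_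
  rw [Measure.restrict_apply_univ, ← ENNReal.ofReal_toReal hSfin,
    ← ENNReal.ofReal_mul ENNReal.toReal_nonneg]
  apply ENNReal.ofReal_le_ofReal
  calc M * (ε / (M + 1)) ≤ (M + 1) * (ε / (M + 1)) := by gcongr; linarith
    _ = ε := by field_simp

/-- Mollifications of an `L^q` function converge to it in `L^q`. -/
lemma exists_eLpNorm_convolution_sub_le {g : E → V} (hgm : StronglyMeasurable g) {q : ℝ} (hq : 1 ≤ q)
    (hg : MemLp g (ENNReal.ofReal q) μ) {ε : ℝ} (hε : 0 < ε) :
    ∃ δ > 0, ∀ φ : ContDiffBump (0 : E), φ.rOut ≤ δ →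
      eLpNorm ((φ.normed μ ⋆[lsmul ℝ ℝ, μ] g) - g) (ENNReal.ofReal q) μ ≤ ENNReal.ofReal ε := by
  have hq1 : 1 ≤ ENNReal.ofReal q := by simpa using hq
  obtain ⟨h, hc, hgh, hh, hhL⟩ := hg.exists_hasCompactSupport_eLpNorm_sub_le
    ENNReal.ofReal_ne_top (ε := ENNReal.ofReal (ε / 3)) (by simpa using hε)
  obtain ⟨δ, hδ, H⟩ := exists_eLpNorm_convolution_sub_le_of_continuous (μ := μ) hh hc
    (q := ENNReal.ofReal q) (by positivity : 0 < ε / 3)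
  refine ⟨δ, hδ, fun φ hφ => ?_⟩
  have hgloc : LocallyIntegrable g μ := hg.locallyIntegrable hq1
  have hhloc : LocallyIntegrable h μ := hhL.locallyIntegrable hq1
  have hφc : HasCompactSupport (φ.normed μ) := φ.hasCompactSupport_normed
  have hφd : ContDiff ℝ 0 (φ.normed μ) := φ.contDiff_normed
  have hmeas : ∀ k : E → V, LocallyIntegrable k μ →
      AEStronglyMeasurable (φ.normed μ ⋆[lsmul ℝ ℝ, μ] k) μ := fun k hk =>
    (hφc.contDiff_convolution_left (n := 0) (lsmul ℝ ℝ) hφd hk).continuous.aestronglyMeasurable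
  have hsplit : (φ.normed μ ⋆[lsmul ℝ ℝ, μ] g) - g =
      ((φ.normed μ ⋆[lsmul ℝ ℝ, μ] (g - h)) + ((φ.normed μ ⋆[lsmul ℝ ℝ, μ] h) - h)) - (g - h) := by
    have : (φ.normed μ ⋆[lsmul ℝ ℝ, μ] g) = (φ.normed μ ⋆[lsmul ℝ ℝ, μ] (g - h)) +
        (φ.normed μ ⋆[lsmul ℝ ℝ, μ] h) := by
      rw [← ConvolutionExists.distrib_add
        (hφc.convolutionExists_left _ hφd.continuous (hgloc.sub hhloc))
        (hφc.convolutionExists_left _ hφd.continuous hhloc), sub_add_cancel]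
    rw [this]; abel
  rw [hsplit]
  have hm1 := hmeas (g - h) (hgloc.sub hhloc)
  have hm2 := (hmeas h hhloc).sub hh.aestronglyMeasurable
  calc _ ≤ _ := eLpNorm_sub_le (hm1.add hm2) (hg.1.sub hhL.1) hq1
    _ ≤ (eLpNorm (φ.normed μ ⋆[lsmul ℝ ℝ, μ] (g - h)) (ENNReal.ofReal q) μ +
          eLpNorm ((φ.normed μ ⋆[lsmul ℝ ℝ, μ] h) - h) (ENNReal.ofReal q) μ) +
          eLpNorm (g - h) (ENNReal.ofReal q) μ := by
        gcongr; exact eLpNorm_add_le hm1 hm2 hq1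
    _ ≤ (ENNReal.ofReal (ε / 3) + ENNReal.ofReal (ε / 3)) + ENNReal.ofReal (ε / 3) := by
        gcongr
        · exact (eLpNorm_convolution_le φ (hgm.sub hh.stronglyMeasurable) hq).trans hgh
        · exact H φ hφ
    _ = ENNReal.ofReal ε := by
        rw [← ENNReal.ofReal_add (by positivity) (by positivity),
          ← ENNReal.ofReal_add (by positivity) (by positivity)]
        congr 1; ring

end Mollification

lemma memLp_indicator_of_restrict {α V : Type*} [MeasurableSpace α] [NormedAddCommGroup V]
    {μ : Measure α} {s : Set α} (hs : MeasurableSet s) {f : α → V} {q : ℝ≥0∞}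
    (hf : MemLp f q (μ.restrict s)) : MemLp (s.indicator f) q μ :=
  (memLp_indicator_iff_restrict hs).2 hf

lemma integrable_of_integrableOn_of_eq_zero {α V : Type*} [MeasurableSpace α]
    [NormedAddCommGroup V] {μ : Measure α} {s : Set α} {f : α → V} (hf : IntegrableOn f s μ)
    (h : ∀ x ∉ s, f x = 0) : Integrable f μ :=
  hf.integrable_of_forall_notMem_eq_zero h

section WeakGradient

open scoped Convolution
open ContinuousLinearMap (lsmul)

variable {m n : ℕ} {Ω : Set (EuclideanSpace ℝ (Fin n))}
  {u : EuclideanSpace ℝ (Fin n) → EuclideanSpace ℝ (Fin m)} {G : EuclideanSpace ℝ (Fin n) → Mat m n}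

/-- Away from the boundary, the gradient of a mollification is the mollification of the weak
gradient. -/
lemma IsWeakGradient.fderiv_convolution (hΩ : IsOpen Ω) (h : IsWeakGradient Ω u G)
    {L : Set (EuclideanSpace ℝ (Fin n))} (hL : IsCompact L) (hLΩ : L ⊆ Ω)
    {g : EuclideanSpace ℝ (Fin n) → Mat m n} (hgL : ∀ x ∉ L, g x = 0)
    (hgG : ∀ᵐ x ∂(volume.restrict L), g x = G x)
    (φ : ContDiffBump (0 : EuclideanSpace ℝ (Fin n))) {x : EuclideanSpace ℝ (Fin n)}
    (hx : Metric.closedBall x φ.rOut ⊆ L) :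
    fderiv ℝ (φ.normed volume ⋆[lsmul ℝ ℝ, volume] (L.indicator u)) x =
      (φ.normed volume ⋆[lsmul ℝ ℝ, volume] g) x := by
  set ρ := φ.normed (volume : Measure (EuclideanSpace ℝ (Fin n)))
  have hρc : HasCompactSupport ρ := φ.hasCompactSupport_normed
  have hρd : ContDiff ℝ ∞ ρ := φ.contDiff_normed
  have hLm := hL.measurableSet
  have hu : Integrable (L.indicator u) := by
    rw [integrable_indicator_iff hLm]
    exact h.locallyIntegrable.integrableOn_compact_subset hLΩ hL
  have hGL : IntegrableOn G L := h.locallyIntegrable_grad.integrableOn_compact_subset hLΩ hL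
  have hg : Integrable g := by
    have : IntegrableOn g L := hGL.congr (hgG.mono fun x hx => hx.symm)
    exact integrable_of_integrableOn_of_eq_zero this hgL
  have hder := hρc.hasFDerivAt_convolution_left (lsmul ℝ ℝ : ℝ →L[ℝ] EuclideanSpace ℝ (Fin m) →L[ℝ] _)
    (hρd.of_le (by simp)) hu.locallyIntegrable x
  rw [hder.fderiv]
  have hex1 := (hρc.fderiv ℝ).convolutionExists_left
    ((lsmul ℝ ℝ : ℝ →L[ℝ] EuclideanSpace ℝ (Fin m) →L[ℝ] _).precompL (EuclideanSpace ℝ (Fin n)))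
    (hρd.continuous_fderiv (by simp)) hu.locallyIntegrable x
  have hex2 := hρc.convolutionExists_left (lsmul ℝ ℝ : ℝ →L[ℝ] Mat m n →L[ℝ] _)
    hρd.continuous hg.locallyIntegrable x
  ext1 v
  rw [convolution_def, convolution_def, ContinuousLinearMap.integral_apply hex1,
    ContinuousLinearMap.integral_apply hex2]
  simp only [ContinuousLinearMap.precompL_apply, ContinuousLinearMap.lsmul_apply, _root_.smul_apply]
  rw [← integral_sub_left_eq_self (fun t => fderiv ℝ ρ t v • L.indicator u (x - t)) volume x,
    ← integral_sub_left_eq_self (fun t => ρ t • g (x - t) v) volume x]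
  simp only [sub_sub_cancel]
  -- The definition of the weak gradient is tested with `y ↦ ρ (x - y)`.
  let ψ : EuclideanSpace ℝ (Fin n) → ℝ := fun y => ρ (x - y)
  have hψ : ContDiff ℝ ∞ ψ := hρd.comp (contDiff_const.sub contDiff_id)
  have hψ0 : ∀ y ∉ Metric.closedBall x φ.rOut, ρ (x - y) = 0 := by
    intro y hy
    have h1 : x - y ∉ tsupport ρ := by
      rw [φ.tsupport_normed_eq, mem_closedBall_zero_iff, ← dist_eq_norm, dist_comm]
      exact hy
    exact image_eq_zero_of_notMem_tsupport h1
  have hψD0 : ∀ y ∉ Metric.closedBall x φ.rOut, fderiv ℝ ρ (x - y) = 0 := by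
    intro y hy
    have h1 : x - y ∉ tsupport ρ := by
      rw [φ.tsupport_normed_eq, mem_closedBall_zero_iff, ← dist_eq_norm, dist_comm]
      exact hy
    exact image_eq_zero_of_notMem_tsupport fun h' => h1 (tsupport_fderiv_subset ℝ h')
  have hψs : tsupport ψ ⊆ Metric.closedBall x φ.rOut := by
    refine closure_minimal (fun y hy => ?_) Metric.isClosed_closedBall
    by_contra h'
    exact hy (hψ0 y h')
  have hψc : HasCompactSupport ψ :=
    (isCompact_closedBall x φ.rOut).of_isClosed_subset (isClosed_tsupport _) hψs
  have hψD : ∀ y, fderiv ℝ ψ y v = - fderiv ℝ ρ (x - y) v := by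
    intro y
    have h1 : HasFDerivAt (fun y => x - y) (-ContinuousLinearMap.id ℝ (EuclideanSpace ℝ (Fin n))) y :=
      (hasFDerivAt_id y).const_sub x
    have h2 : HasFDerivAt ρ (fderiv ℝ ρ (x - y)) (x - y) :=
      (hρd.differentiable (by simp)).differentiableAt.hasFDerivAt
    have h3 : HasFDerivAt ψ _ y := h2.comp y h1
    rw [h3.fderiv]
    simp
  have key := h.integral_eq ψ hψ hψc (hψs.trans (hx.trans hLΩ)) v
  simp only [hψD, neg_smul, integral_neg, neg_inj] at key
  have e1 : ∫ y, fderiv ℝ ρ (x - y) v • L.indicator u y = ∫ y in Ω, fderiv ℝ ρ (x - y) v • u y := by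
    rw [← setIntegral_eq_integral_of_forall_compl_eq_zero (s := L)
        (fun y hy => by rw [indicator_of_notMem hy, smul_zero]),
      setIntegral_congr_fun (g := fun y => fderiv ℝ ρ (x - y) v • u y) hLm
        (fun y hy => by simp only [indicator_of_mem hy])]
    refine (setIntegral_eq_of_subset_of_forall_sdiff_eq_zero hΩ.measurableSet hLΩ fun y hy => ?_).symm
    rw [hψD0 y fun hy' => hy.2 (hx hy')]
    simp
  have e2 : ∫ y, ρ (x - y) • g y v = ∫ y in Ω, ρ (x - y) • G y v := by
    rw [← setIntegral_eq_integral_of_forall_compl_eq_zero (s := L)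
        (fun y hy => by rw [hgL y hy]; simp),
      setIntegral_congr_ae (g := fun y => ρ (x - y) • G y v) hLm
        (by
          rw [ae_restrict_iff' hLm] at hgG
          filter_upwards [hgG] with y hy hyL
          rw [hy hyL])]
    refine (setIntegral_eq_of_subset_of_forall_sdiff_eq_zero hΩ.measurableSet hLΩ fun y hy => ?_).symm
    rw [hψ0 y fun hy' => hy.2 (hx hy'), zero_smul]
  rw [e1, e2, key]

/-- Functions with a weak gradient in `L^q` can be approximated by smooth ones, in the sense of
`L^q` convergence of the gradients on compact sets. -/
lemma IsWeakGradient.exists_contDiff_eLpNorm_fderiv_sub_le (hΩ : IsOpen Ω)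
    (h : IsWeakGradient Ω u G) {q : ℝ} (hq : 1 ≤ q)
    (hG : ∀ L : Set (EuclideanSpace ℝ (Fin n)), IsCompact L → L ⊆ Ω →
      MemLp G (ENNReal.ofReal q) (volume.restrict L))
    {K : Set (EuclideanSpace ℝ (Fin n))} (hK : IsCompact K) (hKΩ : K ⊆ Ω) {ε : ℝ} (hε : 0 < ε) :
    ∃ U : EuclideanSpace ℝ (Fin n) → EuclideanSpace ℝ (Fin m), ContDiff ℝ ∞ U ∧
      eLpNorm (fun x => fderiv ℝ U x - G x) (ENNReal.ofReal q) (volume.restrict K) ≤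
        ENNReal.ofReal ε := by
  obtain ⟨δ, hδ, hδΩ⟩ := hK.exists_cthickening_subset_open hΩ hKΩ
  set L := Metric.cthickening δ K
  have hL : IsCompact L := hK.cthickening
  have hLm := hL.measurableSet
  have hGL := hG L hL hδΩ
  set g := L.indicator (hGL.1.mk G)
  have hgm : StronglyMeasurable g := hGL.1.stronglyMeasurable_mk.indicator hLm
  have hgG : ∀ᵐ x ∂(volume.restrict L), g x = G x := by
    filter_upwards [hGL.1.ae_eq_mk, ae_restrict_mem hLm] with x hx hxL
    simp only [g, indicator_of_mem hxL, ← hx]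
  have hgL : ∀ x ∉ L, g x = 0 := fun x hx => indicator_of_notMem hx _
  have hg : MemLp g (ENNReal.ofReal q) :=
    memLp_indicator_of_restrict hLm (hGL.ae_eq hGL.1.ae_eq_mk)
  obtain ⟨r, hr, H⟩ := exists_eLpNorm_convolution_sub_le hgm hq hg hε
  let φ : ContDiffBump (0 : EuclideanSpace ℝ (Fin n)) :=
    ⟨min r δ / 2, min r δ, by positivity, half_lt_self (by positivity)⟩
  have hφr : φ.rOut ≤ r := min_le_left _ _
  have hφδ : φ.rOut ≤ δ := min_le_right _ _
  have hu : Integrable (L.indicator u) := by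
    rw [integrable_indicator_iff hLm]
    exact h.locallyIntegrable.integrableOn_compact_subset hδΩ hL
  have hKL : K ⊆ L := Metric.self_subset_cthickening K
  refine ⟨φ.normed volume ⋆[lsmul ℝ ℝ, volume] (L.indicator u),
    φ.hasCompactSupport_normed.contDiff_convolution_left _ φ.contDiff_normed hu.locallyIntegrable, ?_⟩
  refine le_trans (le_of_eq ?_) ((eLpNorm_restrict_le _ _ _ K).trans (H φ hφr))
  refine eLpNorm_congr_ae ?_
  filter_upwards [ae_restrict_of_ae_restrict_of_subset hKL hgG,
    ae_restrict_mem hK.measurableSet] with x hx hxK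
  rw [h.fderiv_convolution hΩ hL hδΩ hgL hgG φ
    ((Metric.closedBall_subset_closedBall hφδ).trans
      (Metric.closedBall_subset_cthickening hxK δ)), Pi.sub_apply, hx]

end WeakGradient

/-! ### The local estimate for weak gradients -/

lemma integral_norm_rpow_le_measureReal_mul {α V : Type*} [MeasurableSpace α] [NormedAddCommGroup V]
    {ν : Measure α} [IsFiniteMeasure ν] {h : α → V} {q : ℝ} (hq : 1 ≤ q)
    (hh : MemLp h (ENNReal.ofReal q) ν) :
    (∫ x, ‖h x‖ ∂ν) ^ q ≤ ν.real univ ^ (q - 1) * ∫ x, ‖h x‖ ^ q ∂ν := by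
  have hq0 : 0 ≤ q := by linarith
  have h1 : ∫ x, ‖h x‖ ∂ν = (∫⁻ x, ‖h x‖ₑ ∂ν).toReal := by
    simpa using integral_norm_rpow_eq_toReal hh.1 zero_le_one
  rw [h1, integral_norm_rpow_eq_toReal hh.1 hq0, measureReal_def, ENNReal.toReal_rpow,
    ENNReal.toReal_rpow, ← ENNReal.toReal_mul]
  refine ENNReal.toReal_mono (ENNReal.mul_ne_top ?_ ?_)
    (lintegral_rpow_le_measure_univ_rpow_mul hq hh.1.enorm)
  · exact ENNReal.rpow_ne_top_of_nonneg (by linarith) (measure_ne_top _ _)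
  · have := lintegral_rpow_enorm_lt_top_of_eLpNorm_lt_top
      (by simp; linarith : ENNReal.ofReal q ≠ 0) ENNReal.ofReal_ne_top hh.2
    rw [ENNReal.toReal_ofReal hq0] at this
    exact this.ne

lemma integral_norm_rpow_le_of_eLpNorm_le {α V : Type*} [MeasurableSpace α] [NormedAddCommGroup V]
    {ν : Measure α} {h : α → V} {q σ : ℝ} (hq : 1 ≤ q) (hσ : 0 ≤ σ) (hh : AEStronglyMeasurable h ν)
    (hle : eLpNorm h (ENNReal.ofReal q) ν ≤ ENNReal.ofReal (σ ^ q⁻¹)) :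
    ∫ x, ‖h x‖ ^ q ∂ν ≤ σ := by
  have hq0 : 0 < q := by linarith
  rw [eLpNorm_eq_lintegral_rpow_enorm_toReal (by simp; linarith) ENNReal.ofReal_ne_top,
    ENNReal.toReal_ofReal hq0.le, one_div, ENNReal.rpow_inv_le_iff hq0,
    ENNReal.ofReal_rpow_of_nonneg (by positivity) hq0.le, Real.rpow_inv_rpow hσ hq0.ne'] at hle
  rw [integral_norm_rpow_eq_toReal hh hq0.le]
  exact ENNReal.toReal_le_of_le_ofReal hσ hle

section WeakGradient

variable {m n : ℕ} {p : ℝ} {F : Mat m n → ℝ}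

/-- The inequality obtained by testing quasiconcavity with `η (u - c)`, for weak gradients. -/
lemma exists_integral_cutoff_weakGradient_le (hp : 1 < p)
    (hFp : IsHomogeneous p F) (hF : IsQuasiconcave F) {ε : ℝ} (hε : 0 < ε) :
    ∃ C : ℝ, 0 ≤ C ∧ ∀ (Ω : Set (EuclideanSpace ℝ (Fin n)))
      (u : EuclideanSpace ℝ (Fin n) → EuclideanSpace ℝ (Fin m))
      (G : EuclideanSpace ℝ (Fin n) → Mat m n), IsOpen Ω → IsWeakGradient Ω u G →
      (∀ L : Set (EuclideanSpace ℝ (Fin n)), IsCompact L → L ⊆ Ω →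
        MemLp G (ENNReal.ofReal p) (volume.restrict L)) →
      ∀ (x₀ : EuclideanSpace ℝ (Fin n)) (ρ : ℝ), 0 < ρ → Metric.closedBall x₀ (2 * ρ) ⊆ Ω →
      ∫ x in Metric.closedBall x₀ (2 * ρ), ballCutoff x₀ ρ x ^ p * F (G x) ≤
        ε * (∫ x in Metric.closedBall x₀ (2 * ρ), ‖G x‖ ^ p) +
        C * (volume.real (Metric.closedBall x₀ (2 * ρ)) ^ (1 - p) *
          (∫ x in Metric.closedBall x₀ (2 * ρ), ‖G x‖) ^ p) := by
  have hp0 : 0 < p := by linarith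
  have hFc := continuous_of_isQuasiconcave hp hFp hF
  obtain ⟨M, hM0, hM⟩ := hFp.exists_abs_le hp hF
  set T : ℝ := 2 ^ (p - 1) with hT
  have hT0 : 0 < T := by positivity
  set ε₁ : ℝ := ε / (2 * T)
  have hε₁ : 0 < ε₁ := by positivity
  obtain ⟨C₁, hC₁0, hC₁⟩ := exists_abs_sub_le hp hFp hF hε₁
  obtain ⟨C₀, hC₀0, hC₀⟩ := exists_integral_cutoff_le hp hFp hF hε₁
  refine ⟨C₀ * T, by positivity, fun Ω u G hΩ hu hG x₀ ρ hρ hsub => ?_⟩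
  set B := Metric.closedBall x₀ (2 * ρ)
  have hBc : IsCompact B := isCompact_closedBall _ _
  have hBm : MeasurableSet B := measurableSet_closedBall
  have hBpos : 0 < volume.real B :=
    ENNReal.toReal_pos (Metric.measure_closedBall_pos volume x₀ (by positivity)).ne'
      hBc.measure_lt_top.ne
  have : IsFiniteMeasure (volume.restrict B) := ⟨by simpa using hBc.measure_lt_top⟩
  have hGB := hG B hBc hsub
  have hp1 : 1 ≤ ENNReal.ofReal p := by simpa using hp.le
  have hpne : ENNReal.ofReal p ≠ 0 := by simpa using hp0
  set η := ballCutoff x₀ ρ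
  have hη0 : ∀ x, 0 ≤ η x := fun x => ballCutoff_nonneg
  have hη1 : ∀ x, η x ^ p ≤ 1 := fun x => Real.rpow_le_one (hη0 x) ballCutoff_le_one hp0.le
  have hηp : Continuous fun x => η x ^ p :=
    ballCutoff_contDiff.continuous.rpow_const fun _ => Or.inr hp0.le
  set a := ∫ x in B, ‖G x‖ ^ p
  set b := ∫ x in B, ‖G x‖
  refine le_of_forall_pos_le_add fun τ hτ => ?_
  set S : ℝ := 2 * ε₁ * T + C₀ * T + C₁ + 1 with hS
  have hSpos : 0 < S := by positivity
  set σ : ℝ := τ / S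
  have hσ : 0 < σ := by positivity
  -- The smooth `U` approximates `u` so well that the additional errors sum up to at most `S σ = τ`.
  obtain ⟨U, hU, hUG⟩ := hu.exists_contDiff_eLpNorm_fderiv_sub_le hΩ hp.le hG hBc hsub
    (by positivity : 0 < σ ^ p⁻¹)
  have hcDU : Continuous (fderiv ℝ U) := hU.continuous_fderiv (by simp)
  have hDUm : AEStronglyMeasurable (fderiv ℝ U) (volume.restrict B) := hcDU.aestronglyMeasurable
  have hdm : AEStronglyMeasurable (fun x => fderiv ℝ U x - G x) (volume.restrict B) := hDUm.sub hGB.1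
  have hdL : MemLp (fun x => fderiv ℝ U x - G x) (ENNReal.ofReal p) (volume.restrict B) :=
    ⟨hdm, hUG.trans_lt ENNReal.ofReal_lt_top⟩
  have hσle := integral_norm_rpow_le_of_eLpNorm_le hp.le hσ.le hdm hUG
  have hiG : IntegrableOn (fun x => ‖G x‖ ^ p) B := by
    have := hGB.integrable_norm_rpow hpne ENNReal.ofReal_ne_top
    rwa [ENNReal.toReal_ofReal hp0.le] at this
  have hid : IntegrableOn (fun x => ‖fderiv ℝ U x - G x‖ ^ p) B := by
    have := hdL.integrable_norm_rpow hpne ENNReal.ofReal_ne_top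
    rwa [ENNReal.toReal_ofReal hp0.le] at this
  have hiG1 : IntegrableOn (fun x => ‖G x‖) B := (hGB.integrable hp1).norm
  have hid1 : IntegrableOn (fun x => ‖fderiv ℝ U x - G x‖) B := (hdL.integrable hp1).norm
  have hiU : IntegrableOn (fun x => ‖fderiv ℝ U x‖ ^ p) B := integrableOn_norm_rpow hcDU hBc hp0.le
  have hiU1 : IntegrableOn (fun x => ‖fderiv ℝ U x‖) B := hcDU.norm.continuousOn.integrableOn_compact hBc
  have hiFU : IntegrableOn (fun x => η x ^ p * F (fderiv ℝ U x)) B :=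
    (hηp.mul (hFc.comp hcDU)).continuousOn.integrableOn_compact hBc
  have hiFG : IntegrableOn (fun x => η x ^ p * F (G x)) B := by
    refine Integrable.mono' (hiG.const_mul M)
      (hηp.aestronglyMeasurable.mul (hFc.comp_aestronglyMeasurable hGB.1)) ?_
    refine Filter.Eventually.of_forall fun x => ?_
    rw [norm_mul, Real.norm_of_nonneg (Real.rpow_nonneg (hη0 x) p)]
    calc η x ^ p * ‖F (G x)‖ ≤ 1 * (M * ‖G x‖ ^ p) := by
          gcongr
          · exact hη1 x
          · exact hM _
      _ = _ := one_mul _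
  have hcmp : ∫ x in B, η x ^ p * F (G x) ≤ ∫ x in B, (η x ^ p * F (fderiv ℝ U x) +
      (ε₁ * ‖fderiv ℝ U x‖ ^ p + C₁ * ‖fderiv ℝ U x - G x‖ ^ p)) := by
    have hi2 : IntegrableOn (fun x => ε₁ * ‖fderiv ℝ U x‖ ^ p + C₁ * ‖fderiv ℝ U x - G x‖ ^ p) B :=
      (hiU.const_mul _).add (hid.const_mul _)
    refine setIntegral_mono_on hiFG (hiFU.add hi2) hBm fun x _ => ?_
    have h1 := (abs_le.1 (hC₁ (fderiv ℝ U x) (G x - fderiv ℝ U x))).2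
    rw [add_sub_cancel, norm_sub_rev] at h1
    have h2 : 0 ≤ η x ^ p := Real.rpow_nonneg (hη0 x) p
    have h3 : 0 ≤ ε₁ * ‖fderiv ℝ U x‖ ^ p + C₁ * ‖fderiv ℝ U x - G x‖ ^ p := by positivity
    nlinarith [hη1 x]
  have hi2 : IntegrableOn (fun x => ε₁ * ‖fderiv ℝ U x‖ ^ p + C₁ * ‖fderiv ℝ U x - G x‖ ^ p) B :=
    (hiU.const_mul _).add (hid.const_mul _)
  rw [integral_add hiFU hi2, integral_add (hiU.const_mul _) (hid.const_mul _),
    integral_const_mul, integral_const_mul] at hcmp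
  have hmain := hC₀ U hU x₀ ρ hρ
  have hpow : ∀ y z : ℝ, 0 ≤ y → 0 ≤ z → (y + z) ^ p ≤ T * (y ^ p + z ^ p) := fun y z hy hz => by
    lift y to ℝ≥0 using hy
    lift z to ℝ≥0 using hz
    exact_mod_cast NNReal.rpow_add_le_mul_rpow_add_rpow y z hp.le
  have hUp : ∫ x in B, ‖fderiv ℝ U x‖ ^ p ≤ T * (a + σ) := by
    have h1 : ∫ x in B, ‖fderiv ℝ U x‖ ^ p ≤ ∫ x in B, T * (‖G x‖ ^ p + ‖fderiv ℝ U x - G x‖ ^ p) := by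
      refine setIntegral_mono_on hiU ((hiG.add hid).const_mul T) hBm fun x _ => ?_
      refine le_trans ?_ (hpow _ _ (norm_nonneg _) (norm_nonneg _))
      gcongr
      have := norm_add_le (G x) (fderiv ℝ U x - G x)
      rwa [add_sub_cancel] at this
    rw [integral_const_mul, integral_add hiG hid] at h1
    refine h1.trans ?_
    gcongr
  have hb0 : 0 ≤ b := integral_nonneg fun x => norm_nonneg _
  have hU1 : volume.real B ^ (1 - p) * (∫ x in B, ‖fderiv ℝ U x‖) ^ p ≤
      T * (volume.real B ^ (1 - p) * b ^ p + σ) := by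
    have hd0 : 0 ≤ ∫ x in B, ‖fderiv ℝ U x - G x‖ := integral_nonneg fun x => norm_nonneg _
    have h1 : ∫ x in B, ‖fderiv ℝ U x‖ ≤ b + ∫ x in B, ‖fderiv ℝ U x - G x‖ := by
      rw [← integral_add hiG1 hid1]
      refine setIntegral_mono_on hiU1 (hiG1.add hid1) hBm fun x _ => ?_
      have := norm_add_le (G x) (fderiv ℝ U x - G x)
      rwa [add_sub_cancel] at this
    have h2 := integral_norm_rpow_le_measureReal_mul hp.le hdL
    rw [measureReal_restrict_apply_univ] at h2
    have h3 : volume.real B ^ (1 - p) * (∫ x in B, ‖fderiv ℝ U x - G x‖) ^ p ≤ σ := by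
      calc _ ≤ volume.real B ^ (1 - p) * (volume.real B ^ (p - 1) * σ) := by
            gcongr
            refine h2.trans ?_
            gcongr
        _ = σ := by
            rw [← mul_assoc, ← Real.rpow_add hBpos]
            simp
    calc volume.real B ^ (1 - p) * (∫ x in B, ‖fderiv ℝ U x‖) ^ p
        ≤ volume.real B ^ (1 - p) * (T * (b ^ p + (∫ x in B, ‖fderiv ℝ U x - G x‖) ^ p)) := by
          gcongr
          refine le_trans ?_ (hpow _ _ hb0 hd0)
          gcongr
      _ = T * (volume.real B ^ (1 - p) * b ^ p +
            volume.real B ^ (1 - p) * (∫ x in B, ‖fderiv ℝ U x - G x‖) ^ p) := by ring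
      _ ≤ _ := by gcongr
  have hfin : (2 * ε₁ * T + C₀ * T + C₁) * σ ≤ τ := by
    calc (2 * ε₁ * T + C₀ * T + C₁) * σ ≤ S * σ := by gcongr; linarith
      _ = τ := by simp only [σ]; field_simp
  have e1 : 2 * ε₁ * T = ε := by simp only [ε₁]; field_simp
  have h4 : ε₁ * ∫ x in B, ‖fderiv ℝ U x‖ ^ p ≤ ε₁ * (T * (a + σ)) := by gcongr
  have h5 : C₀ * (volume.real B ^ (1 - p) * (∫ x in B, ‖fderiv ℝ U x‖) ^ p) ≤
      C₀ * (T * (volume.real B ^ (1 - p) * b ^ p + σ)) := by gcongr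
  have h6 : C₁ * ∫ x in B, ‖fderiv ℝ U x - G x‖ ^ p ≤ C₁ * σ := by gcongr
  rw [← e1]
  linarith

/-- If moreover `F (Du) ≥ 0`, the cutoff can be dropped on the smaller ball. -/
lemma exists_lintegral_closedBall_le (hp : 1 < p)
    (hFp : IsHomogeneous p F) (hF : IsQuasiconcave F) {ε : ℝ} (hε : 0 < ε) :
    ∃ C : ℝ, 0 ≤ C ∧ ∀ (Ω : Set (EuclideanSpace ℝ (Fin n)))
      (u : EuclideanSpace ℝ (Fin n) → EuclideanSpace ℝ (Fin m))
      (G : EuclideanSpace ℝ (Fin n) → Mat m n), IsOpen Ω → IsWeakGradient Ω u G →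
      (∀ L : Set (EuclideanSpace ℝ (Fin n)), IsCompact L → L ⊆ Ω →
        MemLp G (ENNReal.ofReal p) (volume.restrict L)) →
      (∀ᵐ x ∂(volume.restrict Ω), 0 ≤ F (G x)) →
      ∀ (x₀ : EuclideanSpace ℝ (Fin n)) (ρ : ℝ), 0 < ρ → Metric.closedBall x₀ (2 * ρ) ⊆ Ω →
      ∫⁻ x in Metric.closedBall x₀ ρ, ENNReal.ofReal (F (G x)) ≤
        ENNReal.ofReal ε * (∫⁻ x in Metric.closedBall x₀ (2 * ρ), ‖G x‖ₑ ^ p) +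
        ENNReal.ofReal C * (volume (Metric.closedBall x₀ (2 * ρ)) ^ (1 - p) *
          (∫⁻ x in Metric.closedBall x₀ (2 * ρ), ‖G x‖ₑ) ^ p) := by
  have hp0 : 0 < p := by linarith
  have hFc := continuous_of_isQuasiconcave hp hFp hF
  obtain ⟨M, hM0, hM⟩ := hFp.exists_abs_le hp hF
  obtain ⟨C, hC0, hC⟩ := exists_integral_cutoff_weakGradient_le hp hFp hF hε
  refine ⟨C, hC0, fun Ω u G hΩ hu hG hnn x₀ ρ hρ hsub => ?_⟩
  have hmain := hC Ω u G hΩ hu hG x₀ ρ hρ hsub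
  set B := Metric.closedBall x₀ (2 * ρ)
  have hBc : IsCompact B := isCompact_closedBall _ _
  have hBm : MeasurableSet B := measurableSet_closedBall
  have hB0 : volume B ≠ 0 := (Metric.measure_closedBall_pos volume x₀ (by positivity)).ne'
  have : IsFiniteMeasure (volume.restrict B) := ⟨by simpa using hBc.measure_lt_top⟩
  have hGB := hG B hBc hsub
  have hp1 : 1 ≤ ENNReal.ofReal p := by simpa using hp.le
  have hpne : ENNReal.ofReal p ≠ 0 := by simpa using hp0
  set η := ballCutoff x₀ ρ
  have hη0 : ∀ x, 0 ≤ η x := fun x => ballCutoff_nonneg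
  have hη1 : ∀ x, η x ^ p ≤ 1 := fun x => Real.rpow_le_one (hη0 x) ballCutoff_le_one hp0.le
  have hηp : Continuous fun x => η x ^ p :=
    ballCutoff_contDiff.continuous.rpow_const fun _ => Or.inr hp0.le
  have hiG : IntegrableOn (fun x => ‖G x‖ ^ p) B := by
    have := hGB.integrable_norm_rpow hpne ENNReal.ofReal_ne_top
    rwa [ENNReal.toReal_ofReal hp0.le] at this
  have hiFG : IntegrableOn (fun x => η x ^ p * F (G x)) B := by
    refine Integrable.mono' (hiG.const_mul M)
      (hηp.aestronglyMeasurable.mul (hFc.comp_aestronglyMeasurable hGB.1)) ?_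
    refine Filter.Eventually.of_forall fun x => ?_
    rw [norm_mul, Real.norm_of_nonneg (Real.rpow_nonneg (hη0 x) p)]
    calc η x ^ p * ‖F (G x)‖ ≤ 1 * (M * ‖G x‖ ^ p) := by
          gcongr
          · exact hη1 x
          · exact hM _
      _ = _ := one_mul _
  have hnnB : ∀ᵐ x ∂(volume.restrict B), 0 ≤ F (G x) :=
    ae_restrict_of_ae_restrict_of_subset hsub hnn
  have hfin1 : ∫⁻ x in B, ‖G x‖ₑ ^ p ≠ ⊤ := by
    have := lintegral_rpow_enorm_lt_top_of_eLpNorm_lt_top hpne ENNReal.ofReal_ne_top hGB.2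
    rw [ENNReal.toReal_ofReal hp0.le] at this
    exact this.ne
  have hfin2 : ∫⁻ x in B, ‖G x‖ₑ ≠ ⊤ := (hGB.integrable hp1).2.ne
  have h1 : ∫ x in B, ‖G x‖ = (∫⁻ x in B, ‖G x‖ₑ).toReal := by
    simpa using integral_norm_rpow_eq_toReal hGB.1 zero_le_one
  calc ∫⁻ x in Metric.closedBall x₀ ρ, ENNReal.ofReal (F (G x))
      = ∫⁻ x in Metric.closedBall x₀ ρ, ENNReal.ofReal (η x ^ p * F (G x)) := by
        refine setLIntegral_congr_fun measurableSet_closedBall fun x hx => ?_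
        have : η x = 1 := ballCutoff_eq_one hρ hx
        rw [this, Real.one_rpow, one_mul]
    _ ≤ ∫⁻ x in B, ENNReal.ofReal (η x ^ p * F (G x)) :=
        lintegral_mono_set (Metric.closedBall_subset_closedBall (by linarith))
    _ = ENNReal.ofReal (∫ x in B, η x ^ p * F (G x)) := by
        rw [ofReal_integral_eq_lintegral_ofReal hiFG]
        filter_upwards [hnnB] with x hx
        exact mul_nonneg (Real.rpow_nonneg (hη0 x) p) hx
    _ ≤ _ := ENNReal.ofReal_le_ofReal hmain
    _ = _ := by
        rw [h1, integral_norm_rpow_eq_toReal hGB.1 hp0.le, ENNReal.ofReal_add (by positivity)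
          (by positivity), ENNReal.ofReal_mul hε.le, ENNReal.ofReal_toReal hfin1,
          ENNReal.ofReal_mul hC0, ENNReal.ofReal_mul (by positivity), measureReal_def,
          ENNReal.toReal_rpow, ENNReal.toReal_rpow, ENNReal.ofReal_toReal, ENNReal.ofReal_toReal]
        · exact ENNReal.rpow_ne_top_of_nonneg hp0.le hfin2
        · exact ENNReal.rpow_ne_top_of_ne_zero hB0 hBc.measure_lt_top.ne

end WeakGradient

/-! ### The stopping-time covering -/

lemma tsum_setLIntegral_le {α : Type*} [MeasurableSpace α] {μ : Measure α} {t : Set α} (ht : t.Countable)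
    {B : α → Set α} (hB : ∀ x, MeasurableSet (B x)) (hd : t.PairwiseDisjoint B) (h : α → ℝ≥0∞) :
    ∑' x : t, ∫⁻ y in B x, h y ∂μ ≤ ∫⁻ y, h y ∂μ := by
  rw [← lintegral_biUnion ht (fun x _ => hB x) hd]
  exact setLIntegral_le_lintegral _ _

lemma ENNReal.le_two_mul_of_le_half_add {a z : ℝ≥0∞} (ha : a ≠ ⊤) (h : a ≤ a / 2 + z) :
    a ≤ 2 * z := by
  have h1 : a / 2 ≤ z := by
    have h2 : a / 2 + a / 2 ≤ a / 2 + z := by rwa [ENNReal.add_halves]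
    exact (ENNReal.add_le_add_iff_left (ENNReal.div_ne_top ha (by simp))).1 h2
  calc a = a / 2 + a / 2 := (ENNReal.add_halves a).symm
    _ ≤ z + z := add_le_add h1 h1
    _ = 2 * z := (two_mul z).symm

/-- The dichotomy on a stopping ball. If the mean of `f` on a ball is at least `s ^ p` and is bounded
by the reverse-type inequality, then either the small term dominates, or the mean of `g` on the
double ball is at least a multiple of `s`, and then `g` may be restricted to `{g > c s}`. -/
lemma exists_stopping_ball_bound {α : Type*} [MeasurableSpace α] {μ : Measure α}
    {p : ℝ} (hp : 1 < p) (d : ℕ) (C : ℝ≥0) :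
    ∃ c C' : ℝ≥0, 0 < c ∧ ∀ (s ε : ℝ≥0) (b X : ℝ≥0∞) (B : Set α) (g : α → ℝ≥0∞), 0 < s →
      b ≠ 0 → b ≠ ⊤ → MeasurableSet B → Measurable g → μ B = 2 ^ d * b →
      (s : ℝ≥0∞) ^ p * b ≤ ε * X + C * (μ B ^ (1 - p) * (∫⁻ y in B, g y ∂μ) ^ p) →
      (s : ℝ≥0∞) ^ p * b ≤ 2 * ε * X +
        C' * (s : ℝ≥0∞) ^ (p - 1) * ∫⁻ y in B, {y | (c * s : ℝ≥0∞) < g y}.indicator g y ∂μ := by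
  have hp0 : 0 < p := by linarith
  -- `D` is such that `s * b ≤ D * ∫ g` in the second case, and `c` such that the part of `g` below
  -- `c * s` contributes at most half of this.
  set D : ℝ≥0 := (2 * C) ^ p⁻¹ + 1 with hD
  have hDpos : 0 < D := by positivity
  have hDp : (2 * C : ℝ≥0∞) ≤ (D : ℝ≥0∞) ^ p := by
    have h1 : 2 * C ≤ D ^ p := by
      calc 2 * C = ((2 * C) ^ p⁻¹) ^ p := (NNReal.rpow_inv_rpow hp0.ne' _).symm
        _ ≤ D ^ p := by gcongr; simp [hD]
    rw [← ENNReal.coe_rpow_of_nonneg _ hp0.le]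
    exact_mod_cast h1
  set c : ℝ≥0 := (2 * D * 2 ^ d)⁻¹ with hc
  refine ⟨c, 2 * D, by positivity, fun s ε b X B g hs hb0 hbt hB hg hμB H => ?_⟩
  set Y := ∫⁻ y in B, g y ∂μ
  set Y' := ∫⁻ y in B, {y | (c * s : ℝ≥0∞) < g y}.indicator g y ∂μ
  have hs0 : (s : ℝ≥0∞) ≠ 0 := by simpa using hs.ne'
  have hsp : (s : ℝ≥0∞) ^ p ≠ ⊤ := ENNReal.rpow_ne_top_of_nonneg hp0.le ENNReal.coe_ne_top
  have hspb : (s : ℝ≥0∞) ^ p * b ≠ ⊤ := ENNReal.mul_ne_top hsp hbt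
  rcases le_or_gt ((s : ℝ≥0∞) ^ p * b) (2 * ε * X) with hcase | hcase
  · exact hcase.trans le_self_add
  · have h1 : (s : ℝ≥0∞) ^ p * b ≤ 2 * (C * (μ B ^ (1 - p) * Y ^ p)) := by
      apply ENNReal.le_two_mul_of_le_half_add hspb
      refine H.trans ?_
      gcongr
      rw [ENNReal.le_div_iff_mul_le (by simp) (by simp)]
      refine le_trans (le_of_eq ?_) hcase.le
      ring
    have h2 : μ B ^ (1 - p) ≤ b ^ (1 - p) := by
      rw [show 1 - p = -(p - 1) by ring, ENNReal.rpow_neg, ENNReal.rpow_neg]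
      gcongr ?_⁻¹
      apply ENNReal.rpow_le_rpow _ (by linarith)
      rw [hμB]
      exact le_mul_of_one_le_left' (one_le_pow₀ (by norm_num))
    have h3 : ((s : ℝ≥0∞) * b) ^ p ≤ (D * Y) ^ p := by
      rw [ENNReal.mul_rpow_of_nonneg _ _ hp0.le, ENNReal.mul_rpow_of_nonneg _ _ hp0.le]
      have e : b ^ p = b * b ^ (p - 1) := by
        nth_rewrite 2 [← ENNReal.rpow_one b]
        rw [← ENNReal.rpow_add _ _ hb0 hbt]; congr 1; ring
      calc (s : ℝ≥0∞) ^ p * b ^ p = ((s : ℝ≥0∞) ^ p * b) * b ^ (p - 1) := by rw [e]; ring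
        _ ≤ (2 * (C * (b ^ (1 - p) * Y ^ p))) * b ^ (p - 1) :=
            mul_le_mul' (h1.trans (by gcongr)) le_rfl
        _ = 2 * C * Y ^ p * (b ^ (1 - p) * b ^ (p - 1)) := by ring
        _ = 2 * C * Y ^ p := by
            rw [← ENNReal.rpow_add _ _ hb0 hbt]; simp
        _ ≤ _ := by gcongr
    have h4 : (s : ℝ≥0∞) * b ≤ D * Y := (ENNReal.rpow_le_rpow_iff hp0).1 h3
    have h5 : Y ≤ c * s * μ B + Y' := by
      calc Y ≤ ∫⁻ y in B, ((c * s : ℝ≥0∞) + {y | (c * s : ℝ≥0∞) < g y}.indicator g y) ∂μ := by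
            refine lintegral_mono fun y => ?_
            by_cases hy : (c * s : ℝ≥0∞) < g y
            · rw [indicator_of_mem (show y ∈ {y | (c * s : ℝ≥0∞) < g y} from hy)]
              exact le_add_self
            · rw [indicator_of_notMem (show y ∉ {y | (c * s : ℝ≥0∞) < g y} from hy), add_zero]
              exact not_lt.1 hy
        _ = c * s * μ B + Y' := by
            rw [lintegral_add_left measurable_const, setLIntegral_const]
    have h6 : (s : ℝ≥0∞) * b ≤ 2 * (D * Y') := by
      apply ENNReal.le_two_mul_of_le_half_add (ENNReal.mul_ne_top ENNReal.coe_ne_top hbt)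
      refine h4.trans ((mul_le_mul' le_rfl h5).trans (le_of_eq ?_))
      rw [mul_add, hμB]
      congr 1
      have e : (D * c * 2 ^ d : ℝ≥0) = 2⁻¹ := by
        rw [hc]; field_simp
      calc (D : ℝ≥0∞) * (c * s * (2 ^ d * b)) = ((D * c * 2 ^ d : ℝ≥0) : ℝ≥0∞) * (s * b) := by
            push_cast; ring
        _ = _ := by
            rw [e, ENNReal.div_eq_inv_mul]
            norm_num
    refine le_trans ?_ le_add_self
    have e : (s : ℝ≥0∞) ^ p = (s : ℝ≥0∞) ^ (p - 1) * s := by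
      nth_rewrite 3 [← ENNReal.rpow_one (s : ℝ≥0∞)]
      rw [← ENNReal.rpow_add _ _ hs0 ENNReal.coe_ne_top]; congr 1; ring
    calc (s : ℝ≥0∞) ^ p * b = (s : ℝ≥0∞) ^ (p - 1) * (s * b) := by rw [e, mul_assoc]
      _ ≤ (s : ℝ≥0∞) ^ (p - 1) * (2 * (D * Y')) := by gcongr
      _ = _ := by push_cast; ring

section Stopping

variable {E : Type*} [NormedAddCommGroup E] [NormedSpace ℝ E] [FiniteDimensional ℝ E]
  [MeasurableSpace E] [BorelSpace E] {μ : Measure E} [μ.IsAddHaarMeasure]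

lemma measure_closedBall_mul {x y : E} {a r : ℝ} (ha : 0 ≤ a) (hr : 0 ≤ r) :
    μ (Metric.closedBall x (a * r)) =
      ENNReal.ofReal a ^ Module.finrank ℝ E * μ (Metric.closedBall y r) := by
  rw [Measure.addHaar_closedBall μ x (mul_nonneg ha hr), Measure.addHaar_closedBall μ y hr, mul_pow,
    ENNReal.ofReal_mul (by positivity), ENNReal.ofReal_pow ha, mul_assoc]

/-- At almost every point where `f > Λ` there is a critical radius at which the mean of `f` is still
at least `Λ`, while it is at most `Λ` for all radii at least twice as large. -/
lemma ae_exists_stopping_radius {f : E → ℝ≥0∞} (hf : Measurable f) (hfin : ∫⁻ x, f x ∂μ ≠ ⊤)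
    {Λ : ℝ≥0∞} {r₀ : ℝ}
    (hr₀ : ∫⁻ x, f x ∂μ < Λ * μ (Metric.closedBall 0 r₀)) :
    ∀ᵐ x ∂μ, Λ < f x → ∃ r : ℝ, 0 < r ∧ r < r₀ ∧
      Λ * μ (Metric.closedBall x r) ≤ ∫⁻ y in Metric.closedBall x r, f y ∂μ ∧
      ∀ R, 2 * r ≤ R →
        ∫⁻ y in Metric.closedBall x R, f y ∂μ ≤ Λ * μ (Metric.closedBall x R) := by
  filter_upwards [(Besicovitch.vitaliFamily μ).ae_tendsto_lintegral_div' hf hfin] with x hx hΛ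
  set S : Set ℝ := {r | 0 < r ∧ Λ * μ (Metric.closedBall x r) ≤ ∫⁻ y in Metric.closedBall x r, f y ∂μ}
  have hlt : ∀ r ∈ S, r < r₀ := by
    intro r hr
    by_contra! h
    have h1 : μ (Metric.closedBall 0 r₀) ≤ μ (Metric.closedBall x r) := by
      rw [← Measure.addHaar_closedBall_center μ x r₀]
      exact measure_mono (Metric.closedBall_subset_closedBall h)
    have h2 : Λ * μ (Metric.closedBall 0 r₀) ≤ ∫⁻ y, f y ∂μ :=
      (by gcongr : Λ * μ (Metric.closedBall 0 r₀) ≤ _).trans (hr.2.trans (setLIntegral_le_lintegral _ _))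
    exact absurd hr₀ (not_lt.2 h2)
  have hne : S.Nonempty := by
    have h1 := (hx.comp (Besicovitch.tendsto_filterAt μ x)).eventually (lt_mem_nhds hΛ)
    obtain ⟨r, hr, hr0⟩ := (h1.and self_mem_nhdsWithin).exists
    refine ⟨r, hr0, ?_⟩
    simp only [Function.comp] at hr
    refine (ENNReal.le_div_iff_mul_le (Or.inl (Metric.measure_closedBall_pos μ x hr0).ne')
      (Or.inl measure_closedBall_lt_top.ne)).1 hr.le
  have hbdd : BddAbove S := ⟨r₀, fun r hr => (hlt r hr).le⟩
  have hpos : 0 < sSup S := by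
    obtain ⟨r, hr⟩ := hne
    exact hr.1.trans_le (le_csSup hbdd hr)
  obtain ⟨r, hr, hrs⟩ := exists_lt_of_lt_csSup hne (half_lt_self hpos)
  -- The radius exceeds half the supremum of `S`, so `S` contains no radius from `2 r` on.
  refine ⟨r, hr.1, hlt r hr, hr.2, fun R hR => ?_⟩
  by_contra! h
  have hRS : R ∈ S := ⟨by linarith [hr.1], h.le⟩
  linarith [le_csSup hbdd hRS]

/-- A stopping-time covering: the integral of `f` over its superlevel set is controlled by the total
measure of balls on which `f` has mean at least `Λ` and whose doubles are disjoint. -/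
lemma exists_stopping_balls {f : E → ℝ≥0∞} (hf : Measurable f) (hfin : ∫⁻ x, f x ∂μ ≠ ⊤)
    {Λ : ℝ≥0∞} {r₀ : ℝ} (hr₀ : ∫⁻ x, f x ∂μ < Λ * μ (Metric.closedBall 0 r₀)) (K : Set E) :
    ∃ (t : Set E) (r : E → ℝ), t.Countable ∧ t ⊆ K ∧
      (t.PairwiseDisjoint fun x => Metric.closedBall x (2 * r x)) ∧
      (∀ x ∈ t, 0 < r x ∧ r x < r₀ ∧
        Λ * μ (Metric.closedBall x (r x)) ≤ ∫⁻ y in Metric.closedBall x (r x), f y ∂μ) ∧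
      ∫⁻ x in K ∩ {x | Λ < f x}, f x ∂μ ≤
        10 ^ Module.finrank ℝ E * ∑' x : t, Λ * μ (Metric.closedBall (x : E) (r x)) := by
  have hae := ae_exists_stopping_radius hf hfin hr₀
  set Good : Set E := {x | Λ < f x → ∃ r : ℝ, 0 < r ∧ r < r₀ ∧
      Λ * μ (Metric.closedBall x r) ≤ ∫⁻ y in Metric.closedBall x r, f y ∂μ ∧
      ∀ R, 2 * r ≤ R →
        ∫⁻ y in Metric.closedBall x R, f y ∂μ ≤ Λ * μ (Metric.closedBall x R)}
  set A : Set E := {x | x ∈ K ∧ Λ < f x ∧ x ∈ Good}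
  have hA : ∀ x : E, ∃ r : ℝ, x ∈ A → (0 < r ∧ r < r₀ ∧
      Λ * μ (Metric.closedBall x r) ≤ ∫⁻ y in Metric.closedBall x r, f y ∂μ ∧
      ∀ R, 2 * r ≤ R →
        ∫⁻ y in Metric.closedBall x R, f y ∂μ ≤ Λ * μ (Metric.closedBall x R)) := by
    intro x
    by_cases hx : x ∈ A
    · obtain ⟨r, hr⟩ := hx.2.2 hx.2.1
      exact ⟨r, fun _ => hr⟩
    · exact ⟨0, fun h => absurd h hx⟩
  choose r hr using hA
  obtain ⟨t, htA, hdisj, hcov⟩ := Vitali.exists_disjoint_subfamily_covering_enlargement_closedBall A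
    (fun x => x) (fun x => 2 * r x) (2 * r₀) (fun x hx => by linarith [(hr x hx).2.1]) 5 (by norm_num)
  have htc : t.Countable := hdisj.countable_of_nonempty_interior fun x hx => by
    refine ⟨x, Metric.ball_subset_interior_closedBall (Metric.mem_ball_self ?_)⟩
    have := (hr x (htA hx)).1
    positivity
  refine ⟨t, r, htc, fun x hx => (htA hx).1, hdisj, fun x hx => ?_, ?_⟩
  · obtain ⟨h1, h2, h3, -⟩ := hr x (htA hx)
    exact ⟨h1, h2, h3⟩
  have : Countable t := htc.to_subtype
  have hsub : (K ∩ {x | Λ < f x} : Set E) ≤ᵐ[μ]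
      ⋃ x : t, Metric.closedBall (x : E) (5 * (2 * r x)) := by
    filter_upwards [hae] with x hx hxK
    have hxA : x ∈ A := ⟨hxK.1, hxK.2, hx⟩
    obtain ⟨b, hb, hsub⟩ := hcov x hxA
    refine mem_iUnion.2 ⟨⟨b, hb⟩, hsub (Metric.mem_closedBall_self ?_)⟩
    have := (hr x hxA).1
    positivity
  calc ∫⁻ x in K ∩ {x | Λ < f x}, f x ∂μ
      ≤ ∫⁻ x in ⋃ x : t, Metric.closedBall (x : E) (5 * (2 * r x)), f x ∂μ :=
        lintegral_mono_set' hsub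
    _ ≤ ∑' x : t, ∫⁻ y in Metric.closedBall (x : E) (5 * (2 * r x)), f y ∂μ :=
        lintegral_iUnion_le _ _
    _ ≤ ∑' x : t, 10 ^ Module.finrank ℝ E * (Λ * μ (Metric.closedBall (x : E) (r x))) := by
        refine ENNReal.tsum_le_tsum fun x => ?_
        obtain ⟨h1, -, -, h4⟩ := hr x (htA x.2)
        refine (h4 _ (by linarith)).trans (le_of_eq ?_)
        rw [show 5 * (2 * r x) = 10 * r x by ring,
          measure_closedBall_mul (y := (x : E)) (by norm_num) h1.le]
        simp only [ENNReal.ofReal_ofNat]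
        ring
    _ = _ := ENNReal.tsum_mul_left

/-- Superlevel estimate: summing the dichotomy over the disjoint stopping balls. -/
lemma exists_lintegral_superlevel_le {p : ℝ} (hp : 1 < p) (C : ℝ≥0) :
    ∃ c C' : ℝ≥0, 0 < c ∧ ∀ (s ε : ℝ≥0) (r₀ : ℝ) (K : Set E) (f g : E → ℝ≥0∞), 0 < s →
      Measurable f → Measurable g → ∫⁻ x, f x ∂μ ≠ ⊤ →
      ∫⁻ x, f x ∂μ < (s : ℝ≥0∞) ^ p * μ (Metric.closedBall 0 r₀) →
      (∀ x ∈ K, ∀ r, 0 < r → r < r₀ → ∫⁻ y in Metric.closedBall x r, f y ∂μ ≤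
        ε * (∫⁻ y in Metric.closedBall x (2 * r), g y ^ p ∂μ) +
        C * (μ (Metric.closedBall x (2 * r)) ^ (1 - p) *
          (∫⁻ y in Metric.closedBall x (2 * r), g y ∂μ) ^ p)) →
      ∫⁻ x in K ∩ {x | (s : ℝ≥0∞) ^ p < f x}, f x ∂μ ≤
        10 ^ Module.finrank ℝ E * (2 * ε * (∫⁻ x, g x ^ p ∂μ) +
          C' * (s : ℝ≥0∞) ^ (p - 1) * ∫⁻ x, {y | (c * s : ℝ≥0∞) < g y}.indicator g x ∂μ) := by
  obtain ⟨c, C', hc, H⟩ := exists_stopping_ball_bound (α := E) (μ := μ) hp (Module.finrank ℝ E) C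
  refine ⟨c, C', hc, fun s ε r₀ K f g hs hf hg hfin hr₀ hloc => ?_⟩
  obtain ⟨t, r, htc, htK, hdisj, hball, hle⟩ := exists_stopping_balls hf hfin hr₀ K
  refine hle.trans (mul_le_mul' le_rfl ?_)
  calc ∑' x : t, (s : ℝ≥0∞) ^ p * μ (Metric.closedBall (x : E) (r x))
      ≤ ∑' x : t, (2 * ε * (∫⁻ y in Metric.closedBall (x : E) (2 * r x), g y ^ p ∂μ) +
        C' * (s : ℝ≥0∞) ^ (p - 1) * ∫⁻ y in Metric.closedBall (x : E) (2 * r x),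
          {y | (c * s : ℝ≥0∞) < g y}.indicator g y ∂μ) := by
        refine ENNReal.tsum_le_tsum fun x => ?_
        obtain ⟨h1, h2, h3⟩ := hball x x.2
        refine H s ε _ _ _ g hs (Metric.measure_closedBall_pos μ _ h1).ne'
          measure_closedBall_lt_top.ne measurableSet_closedBall hg ?_
          (h3.trans (hloc x (htK x.2) _ h1 h2))
        rw [measure_closedBall_mul (y := (x : E)) (by norm_num) h1.le]
        simp
    _ = 2 * ε * (∑' x : t, ∫⁻ y in Metric.closedBall (x : E) (2 * r x), g y ^ p ∂μ) +
        C' * (s : ℝ≥0∞) ^ (p - 1) * ∑' x : t, ∫⁻ y in Metric.closedBall (x : E) (2 * r x),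
          {y | (c * s : ℝ≥0∞) < g y}.indicator g y ∂μ := by
        rw [ENNReal.tsum_add, ENNReal.tsum_mul_left, ENNReal.tsum_mul_left]
    _ ≤ _ := by
        gcongr
        · exact tsum_setLIntegral_le htc (B := fun x => Metric.closedBall x (2 * r x))
            (fun _ => measurableSet_closedBall) hdisj _
        · exact tsum_setLIntegral_le htc (B := fun x => Metric.closedBall x (2 * r x))
            (fun _ => measurableSet_closedBall) hdisj _

end Stopping

/-! ### Averaging over dyadic heights -/

/-- A geometric sum truncated at height `X` is comparable to `X`. -/
lemma sum_geometric_lt_le {q : ℝ} (hq : 1 < q) {a X : ℝ} (ha : 0 ≤ a) (hX : 0 ≤ X) (N : ℕ) :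
    ∑ k ∈ Finset.range N, (if a * q ^ k < X then a * q ^ k else 0) ≤ q / (q - 1) * X := by
  have hq1 : 0 < q - 1 := by linarith
  induction N with
  | zero => simp; positivity
  | succ N ih =>
    by_cases h : a * q ^ N < X
    · calc ∑ k ∈ Finset.range (N + 1), (if a * q ^ k < X then a * q ^ k else 0)
          ≤ ∑ k ∈ Finset.range (N + 1), a * q ^ k := by
            refine Finset.sum_le_sum fun k _ => ?_
            split_ifs
            · exact le_rfl
            · positivity
        _ = a * ((q ^ (N + 1) - 1) / (q - 1)) := by rw [← Finset.mul_sum, geom_sum_eq hq.ne']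
        _ ≤ a * (q ^ (N + 1) / (q - 1)) := by gcongr; linarith
        _ = q / (q - 1) * (a * q ^ N) := by rw [pow_succ]; ring
        _ ≤ _ := by gcongr
    · rw [Finset.sum_range_succ, if_neg h, add_zero]
      exact ih

/-- Summing over dyadic levels `s 2 ^ k` the truncations `y 1_{y > c s 2 ^ k}`, with weights
`(s 2 ^ k) ^ (p - 1)`, costs only a multiple of `y ^ p`, whatever the number of levels. -/
lemma exists_sum_dyadic_truncation_le {p : ℝ} (hp : 1 < p) {c : ℝ≥0} (hc : 0 < c) :
    ∃ C : ℝ≥0, ∀ (s : ℝ≥0) (N : ℕ) (y : ℝ≥0∞),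
      ∑ k ∈ Finset.range N, ((s * 2 ^ k : ℝ≥0) : ℝ≥0∞) ^ (p - 1) *
        (if (c * (s * 2 ^ k : ℝ≥0) : ℝ≥0∞) < y then y else 0) ≤ C * y ^ p := by
  have hp0 : 0 < p := by linarith
  have hp1 : 0 < p - 1 := by linarith
  set q : ℝ := 2 ^ (p - 1) with hqdef
  have hq : 1 < q := Real.one_lt_rpow (by norm_num) hp1
  have hq1 : 0 < q - 1 := by linarith
  set C : ℝ := q / (q - 1) * (c⁻¹ : ℝ) ^ (p - 1) with hC
  have hCpos : 0 < C := by have : (0 : ℝ) < c := hc; positivity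
  refine ⟨C.toNNReal, fun s N y => ?_⟩
  induction y using ENNReal.recTopCoe with
  | top =>
    rw [ENNReal.top_rpow_of_pos hp0, ENNReal.mul_top (by simpa using hCpos)]
    exact le_top
  | coe y =>
    have key := sum_geometric_lt_le hq (a := (s : ℝ) ^ (p - 1)) (X := ((c⁻¹ : ℝ) * y) ^ (p - 1))
      (by positivity) (by positivity) N
    have hpow : ∀ k : ℕ, ((s * 2 ^ k : ℝ≥0) : ℝ) ^ (p - 1) = (s : ℝ) ^ (p - 1) * q ^ k := by
      intro k
      push_cast
      rw [Real.mul_rpow (by positivity) (by positivity), hqdef, ← Real.rpow_natCast,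
        ← Real.rpow_natCast, ← Real.rpow_mul (by norm_num), ← Real.rpow_mul (by norm_num), mul_comm (k : ℝ)]
    have hiff : ∀ k : ℕ, ((c * (s * 2 ^ k : ℝ≥0) : ℝ≥0∞) < y ↔
        (s : ℝ) ^ (p - 1) * q ^ k < ((c⁻¹ : ℝ) * y) ^ (p - 1)) := by
      intro k
      rw [← hpow, Real.rpow_lt_rpow_iff (by positivity) (by positivity) hp1, lt_inv_mul_iff₀ (by exact hc)]
      norm_cast
    have hterm : ∀ k : ℕ, ((s * 2 ^ k : ℝ≥0) : ℝ≥0∞) ^ (p - 1) *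
        (if (c * (s * 2 ^ k : ℝ≥0) : ℝ≥0∞) < y then (y : ℝ≥0∞) else 0) =
        ENNReal.ofReal ((if (s : ℝ) ^ (p - 1) * q ^ k < ((c⁻¹ : ℝ) * y) ^ (p - 1) then
          (s : ℝ) ^ (p - 1) * q ^ k else 0) * y) := by
      intro k
      by_cases h : (c * (s * 2 ^ k : ℝ≥0) : ℝ≥0∞) < y
      · rw [if_pos h, if_pos ((hiff k).1 h), ← hpow, ENNReal.ofReal_mul (by positivity),
          ← ENNReal.ofReal_rpow_of_nonneg (by positivity) hp1.le, ENNReal.ofReal_coe_nnreal,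
          ENNReal.ofReal_coe_nnreal]
      · rw [if_neg h, if_neg (fun h' => h ((hiff k).2 h'))]
        simp
    simp_rw [hterm]
    rw [← ENNReal.ofReal_sum_of_nonneg (fun k _ => by positivity), ← Finset.sum_mul]
    calc ENNReal.ofReal _ ≤ ENNReal.ofReal (C * (y : ℝ) ^ p) := by
          refine ENNReal.ofReal_le_ofReal ((mul_le_mul_of_nonneg_right key y.2).trans (le_of_eq ?_))
          rw [Real.mul_rpow (by positivity) (by positivity), hC]
          rcases eq_or_ne y 0 with rfl | hy
          · simp [hp0.ne']
          · have e : (y : ℝ) ^ p = (y : ℝ) ^ (p - 1) * y := by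
              rw [← Real.rpow_add_one (by exact_mod_cast hy)]; congr 1; ring
            rw [e]; simp only [NNReal.val_eq_coe]; ring
      _ = _ := by
          rw [ENNReal.ofReal_mul hCpos.le, ← ENNReal.ofReal_rpow_of_nonneg y.coe_nonneg hp0.le,
            ENNReal.ofReal_coe_nnreal, ENNReal.ofReal]

section Superlevel

variable {E : Type*} [NormedAddCommGroup E] [NormedSpace ℝ E] [FiniteDimensional ℝ E]
  [MeasurableSpace E] [BorelSpace E] {μ : Measure E} [μ.IsAddHaarMeasure]

/-- A self-improvement: if the means of `f` on small balls are bounded by `ε` times the mean of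
`g ^ p` and the `p`-th power of the mean of `g`, then `f` is small on a superlevel set, at a height
which depends on `f` and `g` only through bounds of their integrals. The superlevel estimates for
`N` dyadic heights are averaged, whereby their last term is divided by `N`. -/
lemma exists_height_lintegral_superlevel_le {p : ℝ} (hp : 1 < p) (C M M' : ℝ≥0) {ε : ℝ≥0}
    (hε : 0 < ε) {r₀ : ℝ} (hr₀ : 0 < r₀) :
    ∃ Λ : ℝ≥0, ∀ (K : Set E) (f g : E → ℝ≥0∞), Measurable f → Measurable g →
      ∫⁻ x, g x ^ p ∂μ ≤ M → ∫⁻ x, f x ∂μ ≤ M' →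
      (∀ x ∈ K, ∀ r, 0 < r → r < r₀ → ∫⁻ y in Metric.closedBall x r, f y ∂μ ≤
        ε * (∫⁻ y in Metric.closedBall x (2 * r), g y ^ p ∂μ) +
        C * (μ (Metric.closedBall x (2 * r)) ^ (1 - p) *
          (∫⁻ y in Metric.closedBall x (2 * r), g y ∂μ) ^ p)) →
      ∫⁻ x in K ∩ {x | (Λ : ℝ≥0∞) < f x}, f x ∂μ ≤
        10 ^ Module.finrank ℝ E * (2 * ε * M + ε) := by
  have hp0 : 0 < p := by linarith
  obtain ⟨c, C', hc, H⟩ := exists_lintegral_superlevel_le (E := E) (μ := μ) hp C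
  obtain ⟨C'', H'⟩ := exists_sum_dyadic_truncation_le hp hc
  set b := μ (Metric.closedBall 0 r₀) with hb
  have hb0 : b ≠ 0 := (Metric.measure_closedBall_pos μ _ hr₀).ne'
  have hbt : b ≠ ⊤ := measure_closedBall_lt_top.ne
  have hbn : b.toNNReal ≠ 0 := by simp [ENNReal.toNNReal_eq_zero_iff, hb0, hbt]
  -- The lowest height `s ^ p` is so large that no ball of radius `r₀` can have a larger mean of `f`.
  set s : ℝ≥0 := ((M' + 1) / b.toNNReal) ^ p⁻¹ with hs
  have hs0 : 0 < s := by have := pos_iff_ne_zero.2 hbn; positivity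
  have hsb : (M' : ℝ≥0∞) < (s : ℝ≥0∞) ^ p * b := by
    rw [← ENNReal.coe_rpow_of_nonneg _ hp0.le, hs, NNReal.rpow_inv_rpow hp0.ne',
      ← ENNReal.coe_toNNReal hbt, ← ENNReal.coe_mul, ENNReal.toNNReal_coe, div_mul_cancel₀ _ hbn]
    exact_mod_cast lt_add_one M'
  obtain ⟨N, hN⟩ := exists_nat_gt (C' * C'' * M / ε)
  have hN0 : N ≠ 0 := by rintro rfl; simp at hN
  have hNε : (C' * C'' * M : ℝ≥0∞) ≤ N * ε := by
    have := ((div_lt_iff₀ hε).1 hN).le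
    exact_mod_cast this
  refine ⟨(s * 2 ^ N) ^ p, fun K f g hf hg hgM hfM hloc => ?_⟩
  have hstep : ∀ k ∈ Finset.range N,
      ∫⁻ x in K ∩ {x | (((s * 2 ^ N) ^ p : ℝ≥0) : ℝ≥0∞) < f x}, f x ∂μ ≤
        10 ^ Module.finrank ℝ E * (2 * ε * M + C' * ∫⁻ x, ((s * 2 ^ k : ℝ≥0) : ℝ≥0∞) ^ (p - 1) *
          (if (c * (s * 2 ^ k : ℝ≥0) : ℝ≥0∞) < g x then g x else 0) ∂μ) := by
    intro k hk
    have hk' : k ≤ N := (Finset.mem_range.1 hk).le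
    have h1 := H (s * 2 ^ k) ε r₀ K f g (by positivity) hf hg (hfM.trans_lt ENNReal.coe_lt_top).ne
      (hfM.trans_lt (hsb.trans_le (by
        gcongr
        exact le_mul_of_one_le_right' (one_le_pow₀ one_le_two)))) hloc
    refine (lintegral_mono_set ?_).trans (h1.trans ?_)
    · refine inter_subset_inter_right _ fun x hx => ?_
      refine lt_of_le_of_lt ?_ (show (((s * 2 ^ N) ^ p : ℝ≥0) : ℝ≥0∞) < f x from hx)
      rw [ENNReal.coe_rpow_of_nonneg _ hp0.le]
      gcongr
      norm_num
    · rw [mul_assoc (C' : ℝ≥0∞), ← lintegral_const_mul' _ _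
        (ENNReal.rpow_ne_top_of_nonneg (by linarith) ENNReal.coe_ne_top)]
      gcongr with x
      simp only [indicator_apply, mem_ofPred]
      exact le_rfl
  have hsum := Finset.sum_le_sum hstep
  rw [Finset.sum_const, Finset.card_range, nsmul_eq_mul, ← Finset.mul_sum, Finset.sum_add_distrib,
    Finset.sum_const, Finset.card_range, nsmul_eq_mul, ← Finset.mul_sum,
    ← lintegral_finsetSum] at hsum
  swap
  · intro k _
    exact (Measurable.ite (measurableSet_lt measurable_const hg) hg measurable_const).const_mul _
  have hlast : (C' : ℝ≥0∞) * ∫⁻ x, ∑ k ∈ Finset.range N, ((s * 2 ^ k : ℝ≥0) : ℝ≥0∞) ^ (p - 1) *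
      (if (c * (s * 2 ^ k : ℝ≥0) : ℝ≥0∞) < g x then g x else 0) ∂μ ≤ N * ε := by
    refine le_trans ?_ hNε
    rw [mul_assoc]
    gcongr
    calc _ ≤ ∫⁻ x, C'' * g x ^ p ∂μ := lintegral_mono fun x => H' s N (g x)
      _ = C'' * ∫⁻ x, g x ^ p ∂μ := lintegral_const_mul' _ _ ENNReal.coe_ne_top
      _ ≤ _ := by gcongr
  have hfinal := hsum.trans (mul_le_mul' le_rfl (add_le_add le_rfl hlast))
  rw [← mul_add, mul_left_comm] at hfinal
  exact (ENNReal.mul_le_mul_iff_right (by exact_mod_cast hN0) (ENNReal.natCast_ne_top N)).1 hfinal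

end Superlevel

/-- A sequence of real functions is uniformly integrable if it is dominated by functions whose
integrals over superlevel sets tend to `0` uniformly. -/
lemma uniformIntegrable_of_enorm_le {α ι : Type*} [MeasurableSpace α] {μ : Measure α}
    [IsFiniteMeasure μ] {h : ι → α → ℝ} {f : ι → α → ℝ≥0∞} (a : ℝ≥0)
    (hh : ∀ j, AEStronglyMeasurable (h j) μ) (hle : ∀ j, ∀ᵐ x ∂μ, ‖h j x‖ₑ ≤ a * f j x)
    (htail : ∀ η : ℝ≥0, 0 < η → ∃ Λ : ℝ≥0, ∀ j,
      ∫⁻ x, {x | (Λ : ℝ≥0∞) < f j x}.indicator (f j) x ∂μ ≤ η) :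
    UniformIntegrable h 1 μ := by
  refine uniformIntegrable_of le_rfl ENNReal.one_ne_top hh fun ε hε => ?_
  lift ε to ℝ≥0 using hε.le
  have hε' : 0 < ε := hε
  obtain ⟨Λ, hΛ⟩ := htail (ε / (a + 1)) (by positivity)
  refine ⟨a * Λ + 1, fun j => ?_⟩
  rw [eLpNorm_one_eq_lintegral_enorm, ENNReal.ofReal_coe_nnreal]
  calc ∫⁻ x, ‖{x | a * Λ + 1 ≤ ‖h j x‖₊}.indicator (h j) x‖ₑ ∂μ
      ≤ ∫⁻ x, a * {x | (Λ : ℝ≥0∞) < f j x}.indicator (f j) x ∂μ := by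
        refine lintegral_mono_ae ?_
        filter_upwards [hle j] with x hx
        by_cases hmem : a * Λ + 1 ≤ ‖h j x‖₊
        · have hf : (Λ : ℝ≥0∞) < f j x := by
            by_contra! hcon
            have h1 : ((a * Λ + 1 : ℝ≥0) : ℝ≥0∞) ≤ ((a * Λ : ℝ≥0) : ℝ≥0∞) := by
              refine (ENNReal.coe_le_coe.2 hmem).trans (hx.trans ?_)
              rw [ENNReal.coe_mul]
              gcongr
            exact absurd (ENNReal.coe_le_coe.1 h1) (not_le.2 (lt_add_one _))
          rw [indicator_of_mem (show x ∈ {x | a * Λ + 1 ≤ ‖h j x‖₊} from hmem),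
            indicator_of_mem (show x ∈ {x | (Λ : ℝ≥0∞) < f j x} from hf)]
          exact hx
        · rw [indicator_of_notMem (show x ∉ {x | a * Λ + 1 ≤ ‖h j x‖₊} from hmem)]
          simp
    _ = a * ∫⁻ x, {x | (Λ : ℝ≥0∞) < f j x}.indicator (f j) x ∂μ :=
        lintegral_const_mul' _ _ ENNReal.coe_ne_top
    _ ≤ a * (ε / (a + 1) : ℝ≥0) := by gcongr; exact hΛ j
    _ ≤ ε := by
        rw [← ENNReal.coe_mul]
        refine ENNReal.coe_le_coe.2 ?_
        rw [mul_div_assoc', div_le_iff₀ (by positivity), mul_comm]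
        gcongr
        exact le_self_add

lemma lintegral_enorm_indicator_rpow {α V : Type*} [MeasurableSpace α] {μ : Measure α}
    [NormedAddCommGroup V] {L : Set α} (hL : MeasurableSet L) (v : α → V) {p : ℝ} (hp : 0 < p) :
    ∫⁻ x, ‖L.indicator v x‖ₑ ^ p ∂μ = ∫⁻ x in L, ‖v x‖ₑ ^ p ∂μ := by
  rw [← lintegral_indicator hL]
  refine lintegral_congr fun x => ?_
  by_cases hx : x ∈ L
  · rw [indicator_of_mem hx, indicator_of_mem hx]
  · rw [indicator_of_notMem hx, indicator_of_notMem hx, enorm_zero, ENNReal.zero_rpow_of_pos hp]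

/-- The integrals of `F (Du_j)` over its superlevel sets are small, uniformly in `j`. -/
lemma exists_lintegral_superlevel_gradient_le {m n : ℕ} {p : ℝ} (hp : 1 < p) {F : Mat m n → ℝ}
    (hF : IsQuasiconcave F) (hFp : IsHomogeneous p F)
    {Ω : Set (EuclideanSpace ℝ (Fin n))} (hΩ : IsOpen Ω)
    {u : ℕ → EuclideanSpace ℝ (Fin n) → EuclideanSpace ℝ (Fin m)}
    {G : ℕ → EuclideanSpace ℝ (Fin n) → Mat m n}
    (hG : ∀ j, IsWeakGradient Ω (u j) (G j)) (hbdd : IsBoundedInLpLoc p Ω G)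
    (hnonneg : ∀ j, ∀ᵐ x ∂(volume.restrict Ω), 0 ≤ F (G j x))
    {K : Set (EuclideanSpace ℝ (Fin n))} (hK : IsCompact K) (hKΩ : K ⊆ Ω) {η : ℝ≥0} (hη : 0 < η) :
    ∃ Λ : ℝ≥0, ∀ j, ∫⁻ x in K, {x | (Λ : ℝ≥0∞) < ENNReal.ofReal (F (G j x))}.indicator
      (fun x => ENNReal.ofReal (F (G j x))) x ≤ η := by
  have hp0 : 0 < p := by linarith
  have hFc := continuous_of_isQuasiconcave hp hFp hF
  have hmeas : ∀ j L, IsCompact L → L ⊆ Ω → AEStronglyMeasurable (G j) (volume.restrict L) :=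
    fun j L hL hLΩ => ((hG j).locallyIntegrable_grad.integrableOn_compact_subset hLΩ hL).1
  have hmem : ∀ j L, IsCompact L → L ⊆ Ω → MemLp (G j) (ENNReal.ofReal p) (volume.restrict L) := by
    intro j L hL hLΩ
    obtain ⟨C, hC⟩ := hbdd L hL hLΩ
    exact ⟨hmeas j L hL hLΩ, (hC j).trans_lt ENNReal.coe_lt_top⟩
  obtain ⟨δ, hδ, hδΩ⟩ := hK.exists_cthickening_subset_open hΩ hKΩ
  set K' := Metric.cthickening δ K with hK'
  have hK'c : IsCompact K' := hK.cthickening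
  have hK'm : MeasurableSet K' := hK'c.measurableSet
  obtain ⟨M₀, hM₀⟩ := hbdd K' hK'c hδΩ
  obtain ⟨MF, hMF0, hMF⟩ := hFp.exists_abs_le hp hF
  -- The factor `10 ^ n (2 M + 1)` of the averaged superlevel estimate is compensated by `ε`.
  set M : ℝ≥0 := M₀ ^ p with hM
  set ε : ℝ≥0 := η / (10 ^ n * (2 * M + 1)) with hε
  have hεpos : 0 < ε := by positivity
  obtain ⟨C, hC0, hC⟩ := exists_lintegral_closedBall_le hp hFp hF (ε := ε) (by exact_mod_cast hεpos)
  obtain ⟨Λ, hΛ⟩ := exists_height_lintegral_superlevel_le (E := EuclideanSpace ℝ (Fin n))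
    (μ := volume) hp C.toNNReal M (MF.toNNReal * M) hεpos (half_pos hδ)
  refine ⟨Λ, fun j => ?_⟩
  have hGm := hmeas j K' hK'c hδΩ
  set g : EuclideanSpace ℝ (Fin n) → Mat m n := K'.indicator (hGm.mk (G j)) with hg
  have hgm : Measurable g := (hGm.stronglyMeasurable_mk.measurable).indicator hK'm
  have hgae : ∀ L ⊆ K', ∀ᵐ x ∂(volume.restrict L), g x = G j x := by
    intro L hL
    refine ae_restrict_of_ae_restrict_of_subset hL ?_
    filter_upwards [hGm.ae_eq_mk, ae_restrict_mem hK'm] with x hx hxK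
    rw [hg, indicator_of_mem hxK, hx]
  have hfm : Measurable fun x => ENNReal.ofReal (F (g x)) :=
    (hFc.measurable.comp hgm).ennreal_ofReal
  have hgM : ∫⁻ x, ‖g x‖ₑ ^ p ≤ M := by
    have h1 : ∫⁻ x, ‖g x‖ₑ ^ p = ∫⁻ x in K', ‖hGm.mk (G j) x‖ₑ ^ p :=
      lintegral_enorm_indicator_rpow hK'm _ hp0
    have h2 := hM₀ j
    rw [eLpNorm_eq_lintegral_rpow_enorm_toReal (by simpa using hp0) ENNReal.ofReal_ne_top,
      ENNReal.toReal_ofReal hp0.le, one_div, ENNReal.rpow_inv_le_iff hp0] at h2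
    rw [h1, hM, ENNReal.coe_rpow_of_nonneg _ hp0.le]
    refine le_trans (le_of_eq (lintegral_congr_ae ?_)) h2
    filter_upwards [hGm.ae_eq_mk] with x hx
    rw [hx]
  have hfM : ∫⁻ x, ENNReal.ofReal (F (g x)) ≤ (MF.toNNReal * M : ℝ≥0) := by
    calc ∫⁻ x, ENNReal.ofReal (F (g x)) ≤ ∫⁻ x, MF.toNNReal * ‖g x‖ₑ ^ p := by
          refine lintegral_mono fun x => ?_
          refine (ENNReal.ofReal_le_ofReal ((le_abs_self _).trans (hMF (g x)))).trans (le_of_eq ?_)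
          rw [ENNReal.ofReal_mul hMF0, ← ENNReal.ofReal_rpow_of_nonneg (norm_nonneg _) hp0.le,
            ofReal_norm, ENNReal.ofReal]
      _ = MF.toNNReal * ∫⁻ x, ‖g x‖ₑ ^ p := lintegral_const_mul' _ _ ENNReal.coe_ne_top
      _ ≤ _ := by rw [ENNReal.coe_mul]; gcongr
  have key := hΛ K (fun x => ENNReal.ofReal (F (g x))) (fun x => ‖g x‖ₑ) hfm hgm.enorm hgM hfM ?_
  · have hset : MeasurableSet {x | (Λ : ℝ≥0∞) < ENNReal.ofReal (F (g x))} :=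
      measurableSet_lt measurable_const hfm
    calc _ = ∫⁻ x in K, {x | (Λ : ℝ≥0∞) < ENNReal.ofReal (F (g x))}.indicator
          (fun x => ENNReal.ofReal (F (g x))) x := by
          refine lintegral_congr_ae ?_
          filter_upwards [hgae K (Metric.self_subset_cthickening K)] with x hx
          simp only [indicator_apply, mem_ofPred, hx]
      _ = ∫⁻ x in K ∩ {x | (Λ : ℝ≥0∞) < ENNReal.ofReal (F (g x))}, ENNReal.ofReal (F (g x)) := by
          rw [lintegral_indicator hset, Measure.restrict_restrict hset, inter_comm]
      _ ≤ _ := key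
      _ = η := by
          rw [finrank_euclideanSpace_fin]
          have : (10 ^ n * (2 * ε * M + ε) : ℝ≥0) = η := by
            rw [hε]; field_simp
          exact_mod_cast this
  · intro x hx r hr hrδ
    have hsub : Metric.closedBall x (2 * r) ⊆ K' :=
      (Metric.closedBall_subset_closedBall (by linarith)).trans
        (Metric.closedBall_subset_cthickening hx δ)
    have hsub' : Metric.closedBall x r ⊆ K' :=
      (Metric.closedBall_subset_closedBall (by linarith)).trans hsub
    have h := hC Ω (u j) (G j) hΩ (hG j) (hmem j) (hnonneg j) x r hr (hsub.trans hδΩ)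
    have e1 : ∫⁻ y in Metric.closedBall x r, ENNReal.ofReal (F (g y)) =
        ∫⁻ y in Metric.closedBall x r, ENNReal.ofReal (F (G j y)) := by
      refine lintegral_congr_ae ?_
      filter_upwards [hgae _ hsub'] with y hy
      rw [hy]
    have e2 : ∫⁻ y in Metric.closedBall x (2 * r), ‖g y‖ₑ ^ p =
        ∫⁻ y in Metric.closedBall x (2 * r), ‖G j y‖ₑ ^ p := by
      refine lintegral_congr_ae ?_
      filter_upwards [hgae _ hsub] with y hy
      rw [hy]
    have e3 : ∫⁻ y in Metric.closedBall x (2 * r), ‖g y‖ₑ =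
        ∫⁻ y in Metric.closedBall x (2 * r), ‖G j y‖ₑ := by
      refine lintegral_congr_ae ?_
      filter_upwards [hgae _ hsub] with y hy
      rw [hy]
    rw [ENNReal.ofReal_coe_nnreal] at h
    rw [e1, e2, e3]
    exact h

theorem mainTheorem4 (m n : ℕ) (p : ℝ) (hp : 1 < p)
    (F : Mat m n → ℝ) (hF : IsQuasiconcave F) (hFp : IsHomogeneous p F)
    (Ω : Set (EuclideanSpace ℝ (Fin n))) (hΩ : IsOpen Ω)
    (u : ℕ → EuclideanSpace ℝ (Fin n) → EuclideanSpace ℝ (Fin m))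
    (Du : ℕ → EuclideanSpace ℝ (Fin n) → Mat m n)
    (hDu : ∀ j, IsWeakGradient Ω (u j) (Du j))
    (hbdd : IsBoundedInLpLoc p Ω Du)
    (hnonneg : ∀ j, ∀ᵐ x ∂(volume.restrict Ω), 0 ≤ F (Du j x)) :
    IsLocallyUniformlyIntegrable Ω (fun j x => F (Du j x)) ∧
    ∀ c : ℝ, 0 < c →
      (∀ j, ∀ᵐ x ∂(volume.restrict Ω), c * ‖Du j x‖ ^ p ≤ F (Du j x)) →
      IsLocallyUniformlyIntegrable Ω (fun j x => ‖Du j x‖ ^ p) := by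
  have hp0 : 0 < p := by linarith
  have hmeas : ∀ j L, IsCompact L → L ⊆ Ω → AEStronglyMeasurable (Du j) (volume.restrict L) :=
    fun j L hL hLΩ => ((hDu j).locallyIntegrable_grad.integrableOn_compact_subset hLΩ hL).1
  constructor
  · intro K hK hKΩ
    have : IsFiniteMeasure (volume.restrict K) := ⟨by simpa using hK.measure_lt_top⟩
    refine uniformIntegrable_of_enorm_le 1
      (fun j => (continuous_of_isQuasiconcave hp hFp hF).comp_aestronglyMeasurable
        (hmeas j K hK hKΩ)) (fun j => ?_) fun η hη =>
      exists_lintegral_superlevel_gradient_le hp hF hFp hΩ hDu hbdd hnonneg hK hKΩ hη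
    filter_upwards [ae_restrict_of_ae_restrict_of_subset hKΩ (hnonneg j)] with x hx
    rw [ENNReal.coe_one, one_mul, Real.enorm_of_nonneg hx]
  · intro c hc hcoer K hK hKΩ
    have : IsFiniteMeasure (volume.restrict K) := ⟨by simpa using hK.measure_lt_top⟩
    refine uniformIntegrable_of_enorm_le (c⁻¹).toNNReal
      (fun j => (Real.continuous_rpow_const hp0.le).comp_aestronglyMeasurable
        (hmeas j K hK hKΩ).norm) (fun j => ?_) fun η hη =>
      exists_lintegral_superlevel_gradient_le hp hF hFp hΩ hDu hbdd hnonneg hK hKΩ hη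
    filter_upwards [ae_restrict_of_ae_restrict_of_subset hKΩ (hcoer j)] with x hx
    rw [Real.enorm_of_nonneg (by positivity), ← ENNReal.ofReal, ← ENNReal.ofReal_mul (by positivity)]
    refine ENNReal.ofReal_le_ofReal ?_
    rwa [← div_eq_inv_mul, le_div_iff₀' hc]
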